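/- Let $\Omega\subset\mathbb{C}$ be an open neighbourhood of the closed unit disc, with coordinate $\eta$, and let $(\mathcal{H}',\mathcal{H}'',\mathcal{C}_{\mathbf S},\nabla)$ be an integrable twistor structure: $\mathcal{H}',\mathcal{H}''$ are holomorphic vector bundles of the same finite rank on $\Omega$, each with a meromorphic connection $\nabla$ having a pole of order at most two at $\eta=0$ and no other pole, and $\mathcal{C}_{\mathbf S}$ is a nondegenerate real-analytic sesquilinear pairing on the unit circle $\mathbf S$ between the fibre of $\mathcal{H}'$ at $\eta$ and that of $\mathcal{H}''$ at $-\eta=-1/\bar\eta$, such that $$\Big(\eta\tfrac{\partial}{\partial \eta}-\bar \eta\tfrac{\partial}{\partial\bar \eta}\Big)\mathcal{C}_{\mathbf S}(m',\overline{m''})=\mathcal{C}_{\mathbf S}(\eta\nabla_{\partial_\eta}m',\overline{m''})-\mathcal{C}_{\mathbf S}(m',\overline{\eta\nabla_{\partial_\eta}m''}).$$ Let $\mathcal{H}$ be $\mathcal{H}'$ or $\mathcal{H}''$. Set $\mu(\tau',z)=\tau'z$ and, near $\{\tau'=0\}\times\Omega$, let $\widetilde{\mathcal M}=\mu^*\mathcal{H}[\tau'^{-1}]$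 be the pulled-back module, localized along $\tau'=0$, with the operator $\tau'\eth_{\tau'}:=z\tau'\partial_{\tau'}$ determined by $\tau'\eth_{\tau'}(1\otimes m)=\tau'^{-1}(1\otimes \eta^2\nabla_{\partial_\eta}m)$. For $q\ge1$ and $\varphi\in t^{-1}\mathbb{C}[t^{-1}]$, let $\widetilde{\mathcal M}_{q,\varphi}$ be the pull-back of $\widetilde{\mathcal M}$ by $\tau'=t^q$, twisted by $\mathcal{E}^{-\varphi/z}$; that is, the operator $t\eth_t=zt\partial_t$ of the pull-back is replaced with $t\eth_t-t\varphi'(t)$. For $\beta\in\mathbb{C}$, put $\beta\star z=(\mathrm{Re}\,\beta)\,z+\tfrac{i}{2}(\mathrm{Im}\,\beta)(z^2+1)$ and $\ell_{z_o}(\beta)=\mathrm{Re}\,\beta-(\mathrm{Im}\,\beta)(\mathrm{Im}\, z_o)$. One says that $\widetilde{\mathcal M}_{q,\varphi}$ is strictly specializable along $t=0$ if, at each point $(0,z_o)$ with $z_o\in\Omega$, its germ has an exhaustive decreasing filtration $V^\bullet$ indexed by $\mathbb{R}$, with jumps in $S+\mathbb{Z}$ for some finite set $S\subset\mathbb R$,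 such that, for each $b\in\mathbb R$: - $V^b$ is a module of finite type over $\mathcal{O}_{(0,z_o)}\langle t\eth_t\rangle$, and $tV^b=V^{b+1}$; - some finite product of operators $t\eth_t-\beta\star z$ with $\ell_{z_o}(\beta)=b$ vanishes on $\mathrm{gr}_V^b=V^b/V^{>b}$; - $\mathrm{gr}^b_V$ is strict, i.e., has no torsion over the ring of germs at $z_o$ of holomorphic functions of $z$. One says that $\widetilde{\mathcal M}$ is strictly specializable with ramification and exponential twist at $\tau'=0$ if $\widetilde{\mathcal M}_{q,\varphi}$ is strictly specializable along $t=0$ for every $q\geq1$ and every $\varphi\in t^{-1}\mathbb{C}[t^{-1}]$. **Proposition.** If $\widetilde{\mathcal M}$ is strictly specializable with ramification and exponential twist at $\tau'=0$, then $(\mathcal{H},\nabla_{\partial_\eta})$ has no ramification at $\eta=0$: without ramification of $\eta$, the formal connection $\mathbb{C}(\!(\eta)\!)\otimes\mathcal{H}$ decomposes as a finite direct sum of connections $\mathcal{E}^{\varphi_i}\otimes R_i$, with pairwise distinct $\varphi_i\in\eta^{-1}\mathbb{C}[\eta^{-1}]$, where $\mathcal E^{\varphi_i}$ is the rank-one connection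 $d+d\varphi_i$ and each $R_i$ has a regular singularity (it has a lattice stable by $\eta\nabla_{\partial_\eta}$). -/

import Mathlib

open scoped PowerSeries LaurentSeries

noncomputable section

namespace Rescaling

/-! ### Holomorphic bundles with a connection having a pole of order at most two -/

/-- A holomorphic vector bundle `H` of rank `d` on `Ω ⊆ ℂ`, with a meromorphic connection `∇` having
a pole of order at most two at the origin and no other pole, given by local frames:
* `e_i` is a holomorphic frame on the open set `U i`;
* `e_j = e_i · g i j` on `U i ∩ U j`, with `g` a holomorphic cocycle;
* `A i` is the (holomorphic) matrix of `η²∇_{∂_η}` in the frame `e_i`, that is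
  `η²∇_{∂_η} e_i = e_i · A i`. Hence `∇_{∂_η}` has the matrix `A i / η²`.
Every point `η` of `Ω` comes with a preferred frame, of index `chartAt η`. -/
structure ConnBundle (Ω : Set ℂ) (d : ℕ) where
  ι : Type
  U : ι → Set ℂ
  isOpen_U : ∀ i, IsOpen (U i)
  U_subset : ∀ i, U i ⊆ Ω
  chartAt : ℂ → ι
  mem_chartAt : ∀ η ∈ Ω, η ∈ U (chartAt η)
  g : ι → ι → ℂ → Matrix (Fin d) (Fin d) ℂ
  g_analytic : ∀ i j, ∀ η ∈ U i ∩ U j, ∀ a b, AnalyticAt ℂ (fun x => g i j x a b) η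
  g_self : ∀ i, ∀ η ∈ U i, g i i η = 1
  g_cocycle : ∀ i j k, ∀ η ∈ U i ∩ U j ∩ U k, g i j η * g j k η = g i k η
  A : ι → ℂ → Matrix (Fin d) (Fin d) ℂ
  A_analytic : ∀ i, ∀ η ∈ U i, ∀ a b, AnalyticAt ℂ (fun x => A i x a b) η
  A_gauge : ∀ i j, ∀ η ∈ U i ∩ U j,
    g i j η * A j η =
      A i η * g i j η + η ^ 2 • Matrix.of (fun a b => deriv (fun x => g i j x a b) η)

/-- An integrable twistor structure of rank `d` on a point: bundles `H'`, `H''` on an open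
neighbourhood `Ω` of the closed unit disc, each with a connection having a pole of order at most two
at the origin, and a nondegenerate pairing `C_S` on the unit circle `S`. On `S` the involution
`z ↦ -1/conj z` is `z ↦ -z`, so `C_S` pairs sesquilinearly the fibre of `H'` at `z` with the fibre of
`H''` at `-z`, and `C i j z a b` is `C_S(e'_{i,a}, conj e''_{j,b})` at `z`.
`C_S` is real analytic on `S`; as `z∂_z - conj z ∂_{conj z} = -i ∂_θ` for `z = exp (i θ)`,
the field `C_flat` is the compatibility
`(z∂_z - conj z ∂_{conj z}) C_S(m', conj m'')
  = C_S(z∇_{∂_z} m', conj m'') - C_S(m', conj (z∇_{∂_z} m''))`. -/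
structure IntegrableTwistorStructure (Ω : Set ℂ) (d : ℕ) where
  isOpen_Ω : IsOpen Ω
  closedBall_subset : Metric.closedBall (0 : ℂ) 1 ⊆ Ω
  H' : ConnBundle Ω d
  H'' : ConnBundle Ω d
  C : H'.ι → H''.ι → ℂ → Matrix (Fin d) (Fin d) ℂ
  C_change : ∀ i i' j j' (z : ℂ), ‖z‖ = 1 → z ∈ H'.U i ∩ H'.U i' → -z ∈ H''.U j ∩ H''.U j' →
    C i' j' z = (H'.g i i' z).transpose * C i j z * (H''.g j j' (-z)).map (starRingEnd ℂ)
  C_nondegenerate : ∀ i j (z : ℂ), ‖z‖ = 1 → z ∈ H'.U i → -z ∈ H''.U j → IsUnit (C i j z).det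
  C_analytic : ∀ i j (θ : ℝ), Complex.exp (θ * Complex.I) ∈ H'.U i →
    -Complex.exp (θ * Complex.I) ∈ H''.U j →
    ∀ a b, AnalyticAt ℝ (fun s : ℝ => C i j (Complex.exp (s * Complex.I)) a b) θ
  C_flat : ∀ i j (θ : ℝ) (z : ℂ), z = Complex.exp (θ * Complex.I) → z ∈ H'.U i → -z ∈ H''.U j →
    ∀ a b, -Complex.I * deriv (fun s : ℝ => C i j (Complex.exp (s * Complex.I)) a b) θ =
      (((z⁻¹ • H'.A i z).transpose * C i j z
        - C i j z * ((-z)⁻¹ • H''.A j (-z)).map (starRingEnd ℂ)) a b)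

/-! ### Laurent series -/

/-- The operator `x ∂_x` on Laurent series in `x`. -/
def euler {R : Type} [CommRing R] (f : R⸨X⸩) : R⸨X⸩ :=
  HahnSeries.single 1 1 * LaurentSeries.derivative R f

/-- The polar part `φ(x) = p(1/x)`, as a Laurent series in `x`. -/
def polar (R : Type) [CommRing R] [Algebra ℂ R] (p : Polynomial ℂ) : R⸨X⸩ :=
  p.sum fun k a => HahnSeries.single (-(k : ℤ)) (algebraMap ℂ R a)

/-- The Taylor expansion at `η = 0` of a matrix of functions. -/
def taylor {d : ℕ} (A : ℂ → Matrix (Fin d) (Fin d) ℂ) : Matrix (Fin d) (Fin d) ℂ⟦X⟧ :=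
  fun a b => PowerSeries.mk fun n => iteratedDeriv n (fun η => A η a b) 0 / (n.factorial : ℂ)

/-! ### Germs of holomorphic functions at `(t, z) = (0, zo)` -/

/-- Convergence of a power series `∑ a_{ij} t^i w^j`; the outer variable is `t`, the inner one `w`. -/
def IsConvergent (f : ℂ⟦X⟧⟦X⟧) : Prop :=
  ∃ c ρ : ℝ, 0 ≤ ρ ∧
    ∀ i j : ℕ, ‖PowerSeries.coeff j (PowerSeries.coeff i f)‖ ≤ c * ρ ^ (i + j)

lemma IsConvergent.nonneg {f : ℂ⟦X⟧⟦X⟧} {c ρ : ℝ}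
    (h : ∀ i j : ℕ, ‖PowerSeries.coeff j (PowerSeries.coeff i f)‖ ≤ c * ρ ^ (i + j)) : 0 ≤ c := by
  simpa using (norm_nonneg _).trans (h 0 0)

lemma IsConvergent.add {f g : ℂ⟦X⟧⟦X⟧} (hf : IsConvergent f) (hg : IsConvergent g) :
    IsConvergent (f + g) := by
  obtain ⟨c, ρ, hρ, h⟩ := hf
  obtain ⟨c', ρ', hρ', h'⟩ := hg
  have hc := IsConvergent.nonneg h
  have hc' := IsConvergent.nonneg h'
  refine ⟨c + c', max ρ ρ', hρ.trans (le_max_left _ _), fun i j => ?_⟩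
  rw [map_add, map_add, add_mul]
  refine (norm_add_le _ _).trans (add_le_add ((h i j).trans ?_) ((h' i j).trans ?_))
  · gcongr; exact le_max_left _ _
  · gcongr; exact le_max_right _ _

lemma IsConvergent.neg {f : ℂ⟦X⟧⟦X⟧} (hf : IsConvergent f) : IsConvergent (-f) := by
  obtain ⟨c, ρ, hρ, h⟩ := hf
  exact ⟨c, ρ, hρ, fun i j => by simpa using h i j⟩

lemma IsConvergent.mul {f g : ℂ⟦X⟧⟦X⟧} (hf : IsConvergent f) (hg : IsConvergent g) :
    IsConvergent (f * g) := by
  obtain ⟨c, ρ, hρ, h⟩ := hf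
  obtain ⟨c', ρ', hρ', h'⟩ := hg
  have hc := IsConvergent.nonneg h
  have hc' := IsConvergent.nonneg h'
  have hm : 0 ≤ max ρ ρ' := hρ.trans (le_max_left _ _)
  refine ⟨c * c', 2 * max ρ ρ', by positivity, fun i j => ?_⟩
  have key : ∀ p ∈ Finset.HasAntidiagonal.antidiagonal i, ∀ q ∈ Finset.HasAntidiagonal.antidiagonal j,
      ‖PowerSeries.coeff q.1 (PowerSeries.coeff p.1 f) *
        PowerSeries.coeff q.2 (PowerSeries.coeff p.2 g)‖ ≤ c * c' * max ρ ρ' ^ (i + j) := by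
    intro p hp q hq
    rw [Finset.HasAntidiagonal.mem_antidiagonal] at hp hq
    rw [norm_mul]
    calc _ ≤ (c * max ρ ρ' ^ (p.1 + q.1)) * (c' * max ρ ρ' ^ (p.2 + q.2)) := by
          refine mul_le_mul ((h _ _).trans ?_) ((h' _ _).trans ?_) (norm_nonneg _) (by positivity)
          · gcongr; exact le_max_left _ _
          · gcongr; exact le_max_right _ _
      _ = c * c' * max ρ ρ' ^ (i + j) := by
          rw [← hp, ← hq]; ring
  rw [PowerSeries.coeff_mul, map_sum]
  calc _ ≤ ∑ p ∈ Finset.HasAntidiagonal.antidiagonal i, ∑ q ∈ Finset.HasAntidiagonal.antidiagonal j,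
        c * c' * max ρ ρ' ^ (i + j) := by
        refine (norm_sum_le _ _).trans (Finset.sum_le_sum fun p hp => ?_)
        rw [PowerSeries.coeff_mul]
        exact (norm_sum_le _ _).trans (Finset.sum_le_sum fun q hq => key p hp q hq)
    _ = ((i + 1 : ℕ) : ℝ) * ((j + 1 : ℕ) : ℝ) * (c * c' * max ρ ρ' ^ (i + j)) := by
        simp [Finset.sum_const, mul_assoc]
    _ ≤ (2 ^ i) * (2 ^ j) * (c * c' * max ρ ρ' ^ (i + j)) := by
        have h1 : ((i + 1 : ℕ) : ℝ) ≤ 2 ^ i := by exact_mod_cast i.lt_two_pow_self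
        have h2 : ((j + 1 : ℕ) : ℝ) ≤ 2 ^ j := by exact_mod_cast j.lt_two_pow_self
        gcongr
    _ = c * c' * (2 * max ρ ρ') ^ (i + j) := by
        rw [mul_pow, pow_add]; ring

lemma IsConvergent.C {a : ℂ} : IsConvergent (PowerSeries.C (PowerSeries.C a)) := by
  refine ⟨‖a‖, 1, zero_le_one, fun i j => ?_⟩
  rw [PowerSeries.coeff_C]
  split_ifs
  · rw [PowerSeries.coeff_C]
    split_ifs <;> simp
  · simp

/-- The ring `ℂ{t, w}` of convergent power series. -/
def convergent : Subring ℂ⟦X⟧⟦X⟧ where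
  carrier := {f | IsConvergent f}
  mul_mem' := IsConvergent.mul
  one_mem' := by simpa using IsConvergent.C (a := 1)
  add_mem' := IsConvergent.add
  zero_mem' := by simpa using IsConvergent.C (a := 0)
  neg_mem' := IsConvergent.neg

/-- The Laurent series in `t` with coefficients in `ℂ⟦w⟧`, in which all germs are expanded. -/
abbrev Amb : Type := ℂ⟦X⟧⸨X⸩

/-- The ring of germs at `(t, z) = (0, zo)` of holomorphic functions of `(t, z)`, identified through
Taylor expansion, with `w = z - zo`, with the ring `ℂ{t, w}`. -/
def Germs : Subring Amb := convergent.map (HahnSeries.ofPowerSeries ℤ ℂ⟦X⟧)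

/-- The function `t`. -/
def tvar : Amb := HahnSeries.single 1 1

/-- The function `z = zo + w`, as a germ at `zo`. -/
def zvar (zo : ℂ) : ℂ⟦X⟧ := PowerSeries.C zo + PowerSeries.X

/-! ### The rescaled module, with ramification and exponential twist -/

/-- The expansion at `(t, z) = (0, zo)` of `F(t^q z)`, for `F(η) = ∑ a_n η^n`. -/
def rescaleSeries (q : ℕ) (zo : ℂ) (F : ℂ⟦X⟧) : ℂ⟦X⟧⟦X⟧ :=
  PowerSeries.mk fun m =>
    if q ∣ m then PowerSeries.C (PowerSeries.coeff (m / q) F) * zvar zo ^ (m / q) else 0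

/-- The germ at `(0, zo)` of `𝒪[t⁻¹]^d`: vectors of germs that are holomorphic up to a pole
along `t = 0`. -/
def stalk (d : ℕ) : Submodule Germs (Fin d → Amb) where
  carrier := {m | ∃ n : ℕ, ∀ a, tvar ^ n * m a ∈ Germs}
  zero_mem' := ⟨0, fun a => by simp⟩
  add_mem' := by
    rintro m m' ⟨n, h⟩ ⟨n', h'⟩
    have ht : tvar ∈ Germs := by
      refine ⟨PowerSeries.X, ⟨1, 1, zero_le_one, fun i j => ?_⟩, ?_⟩
      · rw [PowerSeries.coeff_X]
        split_ifs
        · rw [PowerSeries.coeff_one]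
          split_ifs <;> simp
        · simp
      · simp [tvar]
    refine ⟨n + n', fun a => ?_⟩
    have e : tvar ^ (n + n') * (m + m') a
        = tvar ^ n' * (tvar ^ n * m a) + tvar ^ n * (tvar ^ n' * m' a) := by
      rw [Pi.add_apply]; ring
    rw [e]
    exact Germs.add_mem (Germs.mul_mem (Germs.pow_mem ht _) (h a))
      (Germs.mul_mem (Germs.pow_mem ht _) (h' a))
  smul_mem' := by
    rintro f m ⟨n, h⟩
    refine ⟨n, fun a => ?_⟩
    have e : tvar ^ n * (f • m) a = (f : Amb) * (tvar ^ n * m a) := by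
      rw [Pi.smul_apply, Subring.smul_def, smul_eq_mul]; ring
    rw [e]
    exact Germs.mul_mem f.2 (h a)

/-- Let `A` be the expansion of the matrix of `η²∂_η` in a frame `e` of `H` near `η = 0`. On
`μ^*H[τ'⁻¹]`, where `μ(τ', z) = τ' z`, the operator `τ'ð_{τ'} = zτ'∂_{τ'}` satisfies
`τ'ð_{τ'} (1 ⊗ e) = (1 ⊗ e) · A(τ' z) / τ'`. On the pull-back by the ramification `τ' = t^q`, the
operator `t ð_t = z t ∂_t` satisfies `t ð_t e = e · q A(t^q z) / t^q`, and after twisting by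
`E^{-φ/z}`, with `φ(t) = p(1/t)`, the term `- t φ'(t)` has to be added. This is the resulting operator
`t ð_t` on coordinate vectors, at `z = zo`. -/
def tDt {d : ℕ} (A : Matrix (Fin d) (Fin d) ℂ⟦X⟧) (q : ℕ) (p : Polynomial ℂ) (zo : ℂ)
    (m : Fin d → Amb) : Fin d → Amb := fun a =>
  HahnSeries.C (zvar zo) * euler (m a)
    + (q : Amb) * HahnSeries.single (-(q : ℤ)) 1 *
        ∑ b, HahnSeries.ofPowerSeries ℤ ℂ⟦X⟧ (rescaleSeries q zo (A a b)) * m b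
    - euler (polar ℂ⟦X⟧ p) * m a

/-! ### Strict specializability -/

/-- `β ⋆ z = β' z + i β'' (z² + 1) / 2` for `β = β' + i β''`, as a germ at `zo`. -/
def star (zo β : ℂ) : ℂ⟦X⟧ :=
  PowerSeries.C (β.re : ℂ) * zvar zo
    + PowerSeries.C (Complex.I * β.im / 2) * (zvar zo ^ 2 + 1)

/-- `ℓ_{zo}(β) = β' - β'' Im zo` for `β = β' + i β''`. -/
def ell (zo β : ℂ) : ℝ := β.re - β.im * zo.im

/-- `V^{>b}`. -/
def Vgt {d : ℕ} (V : ℝ → Submodule Germs (Fin d → Amb)) (b : ℝ) :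
    Submodule Germs (Fin d → Amb) := ⨆ c : Set.Ioi b, V c

/-- `V` is a decreasing `V`-filtration of the germ at `(0, zo)` of `𝒪[t⁻¹]^d` with the operator
`D = t ð_t`, showing that this module is strictly specializable along `t = 0` at `zo`. -/
structure IsStrictVFiltration {d : ℕ} (D : (Fin d → Amb) → (Fin d → Amb)) (zo : ℂ)
    (V : ℝ → Submodule Germs (Fin d → Amb)) : Prop where
  antitone : Antitone V
  exhaustive : ∀ m, m ∈ stalk d ↔ ∃ b, m ∈ V b
  /-- the jumps lie in `S + ℤ`, for some finite set `S` -/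
  jumps : ∃ S : Finset ℝ, ∀ a b : ℝ, a < b →
    (∀ s ∈ S, ∀ n : ℤ, ¬ (a ≤ s + n ∧ s + n < b)) → V a = V b
  /-- each step is stable by `t ð_t`, and of finite type over `𝒪⟨t ð_t⟩` -/
  stable : ∀ b, ∀ m ∈ V b, D m ∈ V b
  finite_type : ∀ b, ∃ G : Finset (Fin d → Amb),
    V b = Submodule.span Germs {m | ∃ x ∈ G, ∃ n : ℕ, m = D^[n] x}
  /-- `t V^b = V^{b+1}` -/
  shift : ∀ b m, m ∈ V b ↔ tvar • m ∈ V (b + 1)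
  /-- some product of operators `t ð_t - β ⋆ z` with `ℓ_{zo}(β) = b` vanishes on `gr^b_V` -/
  bernstein : ∀ b, ∃ B : List ℂ, (∀ β ∈ B, ell zo β = b) ∧
    ∀ m ∈ V b, B.foldr (fun β x => D x - (HahnSeries.C (star zo β) : Amb) • x) m ∈ Vgt V b
  /-- `gr^b_V` is strict: it has no torsion over the ring of germs at `zo` of functions of `z` -/
  strict : ∀ b, ∀ f : ℂ⟦X⟧, f ≠ 0 → (HahnSeries.C f : Amb) ∈ Germs →
    ∀ m ∈ V b, (HahnSeries.C f : Amb) • m ∈ Vgt V b → m ∈ Vgt V b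

/-- `μ^*H[τ'⁻¹]` is strictly specializable with ramification and exponential twist at `τ' = 0`:
for every ramification `τ' = t^q` and every `φ ∈ t⁻¹ℂ[t⁻¹]`, the module obtained from it by the
ramification and the twist by `E^{-φ/z}` is strictly specializable along `t = 0`, at
every `(0, zo)` with `zo ∈ Ω`. -/
def ConnBundle.RescalingStrictlySpecializable {Ω : Set ℂ} {d : ℕ} (H : ConnBundle Ω d) : Prop :=
  ∀ q : ℕ, 1 ≤ q → ∀ p : Polynomial ℂ, p.coeff 0 = 0 → ∀ zo ∈ Ω,
    ∃ V, IsStrictVFiltration (tDt (taylor (H.A (H.chartAt 0))) q p zo) zo V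

/-! ### The no-ramification condition -/

/-- The operator `η∇_{∂_η}` on `ℂ((η)) ⊗ H`, if `A` is the expansion of the matrix of
`η²∇_{∂_η}` in a frame of `H` near `η = 0`. -/
def formalConn {d : ℕ} (A : Matrix (Fin d) (Fin d) ℂ⟦X⟧) (v : Fin d → ℂ⸨X⸩) : Fin d → ℂ⸨X⸩ :=
  fun a => euler (v a)
    + HahnSeries.single (-1) 1 * ∑ b, HahnSeries.ofPowerSeries ℤ ℂ (A a b) * v b

/-- The subspace `W`, with the operator `D` for `η∇_{∂_η}`, is regular: it has a lattice
which is stable by `D`. -/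
def IsRegular {d : ℕ} (D : (Fin d → ℂ⸨X⸩) → (Fin d → ℂ⸨X⸩)) (W : Submodule ℂ⸨X⸩ (Fin d → ℂ⸨X⸩)) :
    Prop :=
  ∃ L : Submodule ℂ⟦X⟧ (Fin d → ℂ⸨X⸩), L.FG ∧
    Submodule.span ℂ⸨X⸩ (L : Set (Fin d → ℂ⸨X⸩)) = W ∧ ∀ v ∈ L, D v ∈ L

/-- `(H, ∇_{∂_η})` has no ramification at `η = 0`: without ramification of `η`, the formal connection
`ℂ((η)) ⊗ H` is the direct sum of connections `W i = E^{φ_i} ⊗ R_i` with `R_i` regular and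
`φ_i ∈ η⁻¹ℂ[η⁻¹]` pairwise distinct; equivalently `E^{-φ_i} ⊗ W i` is regular. -/
def ConnBundle.NoRamification {Ω : Set ℂ} {d : ℕ} (H : ConnBundle Ω d) : Prop :=
  ∃ (n : ℕ) (p : Fin n → Polynomial ℂ) (W : Fin n → Submodule ℂ⸨X⸩ (Fin d → ℂ⸨X⸩)),
    Function.Injective p ∧ (∀ i, (p i).coeff 0 = 0) ∧ DirectSum.IsInternal W ∧
    (∀ i, ∀ v ∈ W i, formalConn (taylor (H.A (H.chartAt 0))) v ∈ W i) ∧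
    ∀ i, IsRegular
      (fun v => formalConn (taylor (H.A (H.chartAt 0))) v - euler (polar ℂ (p i)) • v) (W i)

end Rescaling

end

open scoped PowerSeries LaurentSeries

noncomputable section

set_option linter.unusedSectionVars false

namespace Rescaling

/-! ### Calculus of Laurent series -/

section Coefficients

variable {R : Type} [CommRing R]

/-! Only the point `z = 1` is used. The argument has an analytic half, which restricts the
exponential factors of the dual formal connection, and a formal half, which deduces the
decomposition.

Analytic half. The matrix of the rescaled module is a function of `t^q z`, so it is constant along
`t∂_t - q z∂_z`. Hence `z(t∂_t - q z∂_z)` lifts to an operator on the module; after the twist by `φ`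
it becomes `scaling`, with the extra term `-(t∂_t + q)φ`. It commutes with `tð_t` up to `q z · tð_t`
(`scaling_tDt`). Finite type implies that `scaling` lowers the index of the `V`-filtration by a
bounded integer. The Bernstein roots on `V^n / V^(n+1)` have real part in `[n, n+1)`, so different
`n` give disjoint roots, and strictness improves the bound to zero
(`IsStrictVFiltration.scaling_mem`). If `φ` is not a multiple of `t^(-q)`, then `(t∂_t + q)φ` has a
genuine pole, and stability under `scaling` forces `t⁻¹`-stability: `V^0` is the whole module
(`IsStrictVFiltration.eq_stalk`). The whole module is then of finite type over `𝒪⟨tð_t⟩`. At `z = 1`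
this excludes eigenvectors of the dual connection whose eigenvalue is `-t∂_tφ` modulo power series:
pairing with one would have bounded poles on a space stable under `t⁻¹`
(`IsStrictVFiltration.eq_zero_of_conn_eq_smul`). So, after any ramification `η = t^q`, every
irregular eigenvalue of the dual comes from a factor proportional to `t^(-q) = η⁻¹`.

Formal half. The formal connection splits along the eigenvalues `α` of the leading matrix
(`iSup_genEig`, `iSupIndep_genEig`), and the summand of `α` should be regular after removing `α/η`.
A connection with an irregular cyclic vector acquires, after ramification, an eigenvector with
irregular eigenvalue (`IsCyclic.exists_irregular_eigenvector`, which rests on the existence theorem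
`hasEigenvector`). By the analytic half this cannot happen in the twisted dual of the summand, so
all its vectors have iterates with bounded poles. These iterates, taken as linear forms, cut out a
stable lattice in the summand (`isRegular_genEig`). -/

lemma coeff_euler (f : R⸨X⸩) (n : ℤ) : (euler f).coeff n = (n : R) * f.coeff n := by
  rw [euler, HahnSeries.coeff_single_mul, one_mul, LaurentSeries.derivative_apply,
    LaurentSeries.hasseDeriv_coeff]
  simp

lemma euler_add (f g : R⸨X⸩) : euler (f + g) = euler f + euler g := by
  ext n; simp [coeff_euler, mul_add]

@[simp] lemma euler_zero : euler (0 : R⸨X⸩) = 0 := by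
  ext n; simp [coeff_euler]

lemma euler_neg (f : R⸨X⸩) : euler (-f) = -euler f := by
  ext n; simp [coeff_euler]

lemma euler_sub (f g : R⸨X⸩) : euler (f - g) = euler f - euler g := by
  rw [sub_eq_add_neg, euler_add, euler_neg, ← sub_eq_add_neg]

lemma euler_sum {ι : Type*} (s : Finset ι) (f : ι → R⸨X⸩) :
    euler (∑ i ∈ s, f i) = ∑ i ∈ s, euler (f i) := by
  classical
  induction s using Finset.induction_on with
  | empty => simp
  | insert a s ha ih => rw [Finset.sum_insert ha, Finset.sum_insert ha, euler_add, ih]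

/-- The Leibniz rule for an operator acting on each coefficient of a Laurent series. -/
lemma leibniz_of_coeff {δ : R⸨X⸩ → R⸨X⸩} (d : ℤ → R →+ R)
    (hd : ∀ i j a b, d (i + j) (a * b) = d i a * b + a * d j b)
    (hδ : ∀ f n, (δ f).coeff n = d n (f.coeff n)) (f g : R⸨X⸩) :
    δ (f * g) = δ f * g + f * δ g := by
  -- The operator does not enlarge supports, so the three convolution sums can all be taken over the
  -- index set of `f * g`.
  have hs : ∀ f, (δ f).support ⊆ f.support := fun f n hn h => hn (by
    rw [hδ, show f.coeff n = 0 from h, map_zero])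
  ext n
  rw [hδ, HahnSeries.coeff_add, HahnSeries.coeff_mul_left' f.isPWO_support (hs f),
    HahnSeries.coeff_mul_right' g.isPWO_support (hs g), HahnSeries.coeff_mul, map_sum,
    ← Finset.sum_add_distrib]
  refine Finset.sum_congr rfl fun ij hij => ?_
  rw [Finset.mem_antidiagonal] at hij
  rw [hδ, hδ, ← hij.2.2, hd]

lemma euler_mul (f g : R⸨X⸩) : euler (f * g) = euler f * g + f * euler g :=
  leibniz_of_coeff (fun n => AddMonoidHom.mulLeft (n : R))
    (fun i j a b => by simp; ring) (fun f n => by simp [coeff_euler]) f g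

lemma euler_single (n : ℤ) (a : R) :
    euler (HahnSeries.single n a) = HahnSeries.single n ((n : R) * a) := by
  ext m
  rw [coeff_euler, HahnSeries.coeff_single, HahnSeries.coeff_single]
  split_ifs with h <;> simp [h]

lemma euler_C (a : R) : euler (HahnSeries.C a) = 0 := by
  rw [HahnSeries.C_apply, euler_single]; simp

lemma euler_natCast (n : ℕ) : euler (n : R⸨X⸩) = 0 := by
  rw [← map_natCast (HahnSeries.C : R →+* R⸨X⸩), euler_C]

end Coefficients

/-! ### The differential field of Laurent series -/

/-- The field of Laurent series over `K`. -/
def LS (K : Type) [Field K] : Type := K⸨X⸩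

namespace LS

variable {K : Type} [Field K]

instance : Field (LS K) := inferInstanceAs (Field K⸨X⸩)

instance : Algebra K (LS K) := (HahnSeries.C : K →+* K⸨X⸩).toAlgebra

/-- A Laurent series, as an element of the field of Laurent series. -/
def of : K⸨X⸩ ≃+* LS K := RingEquiv.refl _

lemma algebraMap_eq (a : K) : algebraMap K (LS K) a = of (HahnSeries.C a) := rfl

/-- The coefficient of `X ^ n`. -/
def coeff (n : ℤ) : LS K →ₗ[K] K where
  toFun f := HahnSeries.coeff (of.symm f) n
  map_add' f g := by simp
  map_smul' a f := by
    rw [Algebra.smul_def, algebraMap_eq, map_mul, RingEquiv.symm_apply_apply]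
    simp

lemma coeff_of (n : ℤ) (f : K⸨X⸩) : coeff n (of f) = f.coeff n := rfl

@[ext] lemma ext {f g : LS K} (h : ∀ n, coeff n f = coeff n g) : f = g :=
  HahnSeries.ext (funext h)

/-- The derivation `X∂_X`. -/
def d : Derivation K (LS K) (LS K) :=
  Derivation.mk'
    { toFun := fun f => of (euler (of.symm f))
      map_add' := fun f g => by rw [map_add, euler_add, map_add]
      map_smul' := fun a f => by
        rw [Algebra.smul_def, algebraMap_eq, map_mul, RingEquiv.symm_apply_apply, euler_mul,
          euler_C, zero_mul, zero_add, map_mul]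
        simp [Algebra.smul_def, algebraMap_eq] }
    (fun f g => by
      change of (euler (of.symm (f * g))) = _
      rw [map_mul, euler_mul, map_add, map_mul, map_mul, add_comm]
      simp [mul_comm])

lemma coeff_d (n : ℤ) (f : LS K) : coeff n (d f) = (n : K) * coeff n f :=
  coeff_euler _ _

lemma d_mul (f g : LS K) : d (f * g) = d f * g + f * d g := by
  rw [Derivation.leibniz, smul_eq_mul, smul_eq_mul]; ring

/-- The function `X ^ n`. -/
def x (K : Type) [Field K] (n : ℤ) : LS K := of (HahnSeries.single n 1)

lemma x_zero : (x K 0 : LS K) = 1 := rfl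

lemma x_mul_x (m n : ℤ) : (x K m * x K n : LS K) = x K (m + n) := by
  rw [x, x, ← map_mul, HahnSeries.single_mul_single, mul_one]; rfl

lemma x_mul_x_neg (m : ℤ) : (x K m * x K (-m) : LS K) = 1 := by
  rw [x_mul_x, add_neg_cancel, x_zero]

lemma x_neg_mul_x (m : ℤ) : (x K (-m) * x K m : LS K) = 1 := by
  rw [mul_comm, x_mul_x_neg]

lemma x_ne_zero (m : ℤ) : (x K m : LS K) ≠ 0 := left_ne_zero_of_mul_eq_one (x_mul_x_neg m)

lemma coeff_x_mul (m n : ℤ) (f : LS K) : coeff n (x K m * f) = coeff (n - m) f := by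
  obtain ⟨f, rfl⟩ := of.surjective f
  rw [x, ← map_mul, coeff_of, HahnSeries.coeff_single_mul, one_mul]; rfl

lemma coeff_one (n : ℤ) : coeff n (1 : LS K) = if n = 0 then 1 else 0 := by
  change HahnSeries.coeff (1 : K⸨X⸩) n = _
  rw [HahnSeries.coeff_one]
  split_ifs <;> rfl

lemma coeff_x (m n : ℤ) : coeff n (x K m : LS K) = if n = m then 1 else 0 := by
  rw [← mul_one (x K m), coeff_x_mul, coeff_one]
  simp [sub_eq_zero]

lemma d_x (m : ℤ) : d (x K m : LS K) = (m : LS K) * x K m := by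
  ext n
  rw [coeff_d, ← zsmul_eq_mul (x K m) m, map_zsmul, coeff_x, zsmul_eq_mul]
  split_ifs with h <;> simp [h]

lemma d_natCast (k : ℕ) : d (k : LS K) = 0 := Derivation.map_natCast _ _

/-! ### The filtration by the order of the pole -/

/-- The Laurent series with a zero of order at least `m`. -/
def ordGE (K : Type) [Field K] (m : ℤ) : Submodule K (LS K) where
  carrier := {f | ∀ n < m, coeff n f = 0}
  zero_mem' := fun n _ => by simp
  add_mem' := fun hf hg n hn => by rw [map_add, hf n hn, hg n hn, add_zero]
  smul_mem' := fun c f hf n hn => by rw [map_smul, hf n hn, smul_zero]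

lemma mem_ordGE_iff_orderTop {m : ℤ} {f : K⸨X⸩} :
    of f ∈ ordGE K m ↔ (m : WithTop ℤ) ≤ f.orderTop := by
  constructor
  · intro h
    by_contra hlt
    rw [not_le] at hlt
    obtain ⟨k, hk⟩ := WithTop.ne_top_iff_exists.mp (ne_top_of_lt hlt)
    rw [← hk, WithTop.coe_lt_coe] at hlt
    exact HahnSeries.coeff_orderTop_ne hk.symm (h k hlt)
  · intro h n hn
    exact HahnSeries.coeff_eq_zero_of_lt_orderTop ((WithTop.coe_lt_coe.mpr hn).trans_le h)

lemma ordGE_mono {m n : ℤ} (h : m ≤ n) : ordGE K n ≤ ordGE K m :=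
  fun _ hf k hk => hf k (hk.trans_le h)

lemma mul_mem_ordGE {m n : ℤ} {f g : LS K} (hf : f ∈ ordGE K m) (hg : g ∈ ordGE K n) :
    f * g ∈ ordGE K (m + n) := by
  obtain ⟨f, rfl⟩ := of.surjective f
  obtain ⟨g, rfl⟩ := of.surjective g
  rw [← map_mul]
  rw [mem_ordGE_iff_orderTop] at *
  rw [WithTop.coe_add]
  exact (add_le_add hf hg).trans HahnSeries.orderTop_add_le_mul

lemma mul_mem_ordGE_of_left {m : ℤ} {f g : LS K} (hf : f ∈ ordGE K 0) (hg : g ∈ ordGE K m) :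
    f * g ∈ ordGE K m := by
  simpa using mul_mem_ordGE hf hg

lemma x_mem_ordGE (m : ℤ) : x K m ∈ ordGE K m := fun n hn => by
  rw [coeff_x, if_neg hn.ne]

lemma x_mul_mem_ordGE {m n : ℤ} {f : LS K} (hf : f ∈ ordGE K n) : x K m * f ∈ ordGE K (m + n) :=
  mul_mem_ordGE (x_mem_ordGE m) hf

/-- Removing the leading term of `f` raises the order of the product by one, and the product with a
monomial is a shift of coefficients. -/
lemma coeff_mul_of_mem_ordGE {m n : ℤ} {f g : LS K} (hf : f ∈ ordGE K m) (hg : g ∈ ordGE K n) :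
    coeff (m + n) (f * g) = coeff m f * coeff n g := by
  have hf' : f - coeff m f • x K m ∈ ordGE K (m + 1) := fun k hk => by
    rw [map_sub, map_smul, coeff_x]
    split_ifs with h
    · simp [h]
    · rw [hf k (by lia), smul_zero, sub_zero]
  have h2 := mul_mem_ordGE hf' hg (m + n) (by lia)
  rw [sub_mul, map_sub, sub_eq_zero] at h2
  rw [h2, smul_mul_assoc, map_smul, coeff_x_mul, add_sub_cancel_left, smul_eq_mul]

lemma d_mem_ordGE {m : ℤ} {f : LS K} (hf : f ∈ ordGE K m) : d f ∈ ordGE K m :=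
  fun n hn => by rw [coeff_d, hf n hn, mul_zero]

lemma one_mem_ordGE : (1 : LS K) ∈ ordGE K 0 := x_mem_ordGE 0

lemma algebraMap_mem_ordGE (a : K) : algebraMap K (LS K) a ∈ ordGE K 0 := by
  rw [Algebra.algebraMap_eq_smul_one]
  exact Submodule.smul_mem _ _ one_mem_ordGE

lemma coeff_ofPowerSeries (f : K⟦X⟧) (n : ℤ) :
    coeff n (of (HahnSeries.ofPowerSeries ℤ K f)) =
      if n < 0 then 0 else PowerSeries.coeff n.natAbs f :=
  PowerSeries.coeff_coe f n

lemma ofPowerSeries_mem_ordGE (f : K⟦X⟧) : of (HahnSeries.ofPowerSeries ℤ K f) ∈ ordGE K 0 :=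
  fun n hn => by rw [coeff_ofPowerSeries, if_pos hn]

lemma exists_ofPowerSeries {f : LS K} (hf : f ∈ ordGE K 0) :
    ∃ g : K⟦X⟧, of (HahnSeries.ofPowerSeries ℤ K g) = f := by
  refine ⟨PowerSeries.mk fun n => coeff n f, ?_⟩
  ext n
  rw [coeff_ofPowerSeries]
  split_ifs with h
  · exact (hf n h).symm
  · rw [PowerSeries.coeff_mk, Int.natAbs_of_nonneg (not_lt.mp h)]

lemma exists_mem_ordGE (f : LS K) : ∃ m : ℤ, f ∈ ordGE K m :=
  ⟨HahnSeries.order (of.symm f), fun _ hn => HahnSeries.coeff_eq_zero_of_lt_order hn⟩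

lemma exists_forall_mem_ordGE {ι : Type*} [Finite ι] (f : ι → LS K) :
    ∃ m : ℤ, ∀ i, f i ∈ ordGE K m := by
  choose m hm using fun i => exists_mem_ordGE (f i)
  obtain ⟨M, hM⟩ := Set.Finite.bddBelow (Set.finite_range m)
  exact ⟨M, fun i => ordGE_mono (hM ⟨i, rfl⟩) (hm i)⟩

lemma eq_zero_of_forall_mem_ordGE {f : LS K} (h : ∀ m, f ∈ ordGE K m) : f = 0 := by
  ext n; rw [h (n + 1) n (by lia), map_zero]

/-! ### Ramification -/

lemma mulLeft_nat_injective (q : ℕ+) :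
    Function.Injective (AddMonoidHom.mulLeft ((q : ℕ) : ℤ)) := fun a b h => by simpa using h

/-- The substitution `X ↦ X ^ q`. -/
def ram (q : ℕ+) : LS K →ₐ[K] LS K :=
  { (of : K⸨X⸩ ≃+* LS K).toRingHom.comp ((HahnSeries.embDomainRingHom
      (AddMonoidHom.mulLeft ((q : ℕ) : ℤ)) (mulLeft_nat_injective q)
        (fun a b => by simp)).comp (of : K⸨X⸩ ≃+* LS K).symm.toRingHom) with
    commutes' := fun a => HahnSeries.embDomainRingHom_C }

lemma coeff_ram_mul (q : ℕ+) (f : LS K) (n : ℤ) : coeff ((q : ℕ) * n) (ram q f) = coeff n f :=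
  HahnSeries.embDomain_coeff

lemma coeff_ram_of_not_dvd (q : ℕ+) (f : LS K) {n : ℤ} (h : ¬ ((q : ℕ) : ℤ) ∣ n) :
    coeff n (ram q f) = 0 := by
  refine HahnSeries.embDomain_of_notMem_range ?_
  rintro ⟨m, rfl⟩
  exact h ⟨m, rfl⟩

lemma d_ram (q : ℕ+) (f : LS K) : d (ram q f) = ((q : ℕ) : K) • ram q (d f) := by
  ext n
  rw [coeff_d, map_smul, smul_eq_mul]
  by_cases h : ((q : ℕ) : ℤ) ∣ n
  · obtain ⟨m, rfl⟩ := h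
    rw [coeff_ram_mul, coeff_ram_mul, coeff_d]
    push_cast; ring
  · rw [coeff_ram_of_not_dvd q _ h, coeff_ram_of_not_dvd q _ h]; simp

lemma ram_mem_ordGE (q : ℕ+) {m : ℤ} {f : LS K} (hf : f ∈ ordGE K m) :
    ram q f ∈ ordGE K ((q : ℕ) * m) := by
  intro n hn
  by_cases h : ((q : ℕ) : ℤ) ∣ n
  · obtain ⟨k, rfl⟩ := h
    rw [coeff_ram_mul]
    exact hf k (lt_of_mul_lt_mul_left hn (by positivity))
  · exact coeff_ram_of_not_dvd q f h

lemma ram_x (q : ℕ+) (n : ℤ) : ram q (x K n : LS K) = x K ((q : ℕ) * n) := by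
  ext m
  by_cases h : ((q : ℕ) : ℤ) ∣ m
  · obtain ⟨k, rfl⟩ := h
    rw [coeff_ram_mul, coeff_x, coeff_x]
    simp
  · rw [coeff_ram_of_not_dvd q _ h, coeff_x, if_neg]
    rintro rfl
    exact h ⟨n, rfl⟩

lemma ram_ram (q q' : ℕ+) (f : LS K) : ram q' (ram q f) = ram (q * q') f := by
  ext n
  by_cases h : (((q * q' : ℕ+) : ℕ) : ℤ) ∣ n
  · obtain ⟨m, rfl⟩ := h
    rw [coeff_ram_mul]
    rw [show (((q * q' : ℕ+) : ℕ) : ℤ) * m = (q' : ℕ) * ((q : ℕ) * m) by push_cast; ring,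
      coeff_ram_mul, coeff_ram_mul]
  · rw [coeff_ram_of_not_dvd _ _ h]
    by_cases h' : ((q' : ℕ) : ℤ) ∣ n
    · obtain ⟨m, rfl⟩ := h'
      rw [coeff_ram_mul]
      refine coeff_ram_of_not_dvd _ _ fun ⟨k, hk⟩ => h ⟨k, ?_⟩
      rw [hk]; push_cast; ring
    · exact coeff_ram_of_not_dvd _ _ h'

end LS

section

open Matrix LS
open Polynomial (aeval X C aeval_X aeval_monomial)
open scoped Polynomial

/-! ### Formal connections and their lattices -/

section Conn

variable {K : Type} [Field K] {ι : Type} [Fintype ι]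

/-- The connection `X∂_X + B` on `K((X))^ι`. -/
def conn (B : Matrix ι ι (LS K)) : (ι → LS K) →ₗ[K] (ι → LS K) where
  toFun v := fun a => d (v a) + (B *ᵥ v) a
  map_add' v w := by
    funext a; simp only [Pi.add_apply, map_add, mulVec_add]; ring
  map_smul' c v := by
    funext a
    simp only [Pi.smul_apply, mulVec_smul, Derivation.map_smul, smul_add, RingHom.id_apply]

lemma conn_apply (B : Matrix ι ι (LS K)) (v : ι → LS K) (a : ι) :
    conn B v a = d (v a) + (B *ᵥ v) a := rfl

lemma conn_smul (B : Matrix ι ι (LS K)) (f : LS K) (v : ι → LS K) :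
    conn B (f • v) = d f • v + f • conn B v := by
  funext a
  simp only [conn_apply, Pi.smul_apply, Pi.add_apply, smul_eq_mul, d_mul, mulVec_smul]
  ring

/-- The vectors of Laurent series with a zero of order at least `m`. -/
def lat {K : Type} [Field K] (ι : Type) (m : ℤ) : Submodule K (ι → LS K) where
  carrier := {v | ∀ a, v a ∈ ordGE K m}
  zero_mem' := fun _ => (ordGE K m).zero_mem
  add_mem' := fun hv hw a => (ordGE K m).add_mem (hv a) (hw a)
  smul_mem' := fun c _ hv a => (ordGE K m).smul_mem c (hv a)

lemma lat_mono {m n : ℤ} (h : m ≤ n) : (lat ι n : Submodule K (ι → LS K)) ≤ lat ι m :=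
  fun _ hv a => ordGE_mono h (hv a)

lemma smul_mem_lat {m n : ℤ} {f : LS K} {v : ι → LS K} (hf : f ∈ ordGE K m) (hv : v ∈ lat ι n) :
    f • v ∈ lat ι (m + n) := fun a => mul_mem_ordGE hf (hv a)

lemma exists_mem_lat (v : ι → LS K) : ∃ m, v ∈ lat ι m := exists_forall_mem_ordGE v

lemma eq_zero_of_forall_mem_lat {v : ι → LS K} (h : ∀ m, v ∈ lat ι m) : v = 0 :=
  funext fun a => eq_zero_of_forall_mem_ordGE fun m => h m a

lemma eq_zero_of_forall_mem_lat_nat {v : ι → LS K} (h : ∀ m : ℕ, v ∈ lat ι m) : v = 0 :=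
  eq_zero_of_forall_mem_lat fun m => lat_mono (Int.self_le_toNat m) (h m.toNat)

/-- The coefficients of `X ^ m` in a vector of Laurent series. -/
def lead (m : ℤ) (v : ι → LS K) : ι → K := fun a => coeff m (v a)

lemma mem_lat_succ {m : ℤ} {v : ι → LS K} (hv : v ∈ lat ι m) (h : lead m v = 0) :
    v ∈ lat ι (m + 1) := by
  intro a n hn
  rcases (Int.lt_add_one_iff.mp hn).lt_or_eq with h' | rfl
  · exact hv a n h'
  · exact congrFun h a

lemma lead_eq_zero {m : ℤ} {v : ι → LS K} (hv : v ∈ lat ι (m + 1)) : lead m v = 0 :=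
  funext fun a => hv a m (by lia)

lemma exists_lead_ne_zero {v : ι → LS K} (hv : v ≠ 0) : ∃ m, v ∈ lat ι m ∧ lead m v ≠ 0 := by
  by_contra! h
  obtain ⟨m, hm⟩ := exists_mem_lat v
  refine hv (eq_zero_of_forall_mem_lat fun n => ?_)
  have key : ∀ j : ℕ, v ∈ lat ι (m + j) := by
    intro j
    induction j with
    | zero => simpa using hm
    | succ j ih =>
      have := mem_lat_succ ih (h _ ih)
      rwa [add_assoc] at this
  exact lat_mono (by lia) (key (n - m).toNat)

/-- A sequence whose successive differences tend to zero converges. -/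
lemma exists_limit (u : ℕ → ι → LS K) (h0 : u 0 ∈ lat ι 0)
    (h : ∀ m : ℕ, u (m + 1) - u m ∈ lat ι m) :
    ∃ v ∈ lat ι 0, ∀ m : ℕ, v - u m ∈ lat ι m := by
  have hu : ∀ m, u m ∈ lat ι 0 := by
    intro m
    induction m with
    | zero => exact h0
    | succ m ih =>
      have := (lat ι 0).add_mem (lat_mono (by positivity) (h m)) ih
      rwa [sub_add_cancel] at this
  have hst : ∀ (m j : ℕ), u (m + j) - u m ∈ lat ι m := by
    intro m j
    induction j with
    | zero => simp
    | succ j ih =>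
      have := (lat ι m).add_mem (lat_mono (by simp) (h (m + j))) ih
      rwa [sub_add_sub_cancel] at this
  -- The coefficient of index `j` no longer changes from `u (j + 1)` on, since later differences lie
  -- in `lat ι (j + 1)`.
  let v : ι → LS K := fun a =>
    of (HahnSeries.ofPowerSeries ℤ K (PowerSeries.mk fun j => coeff j (u (j + 1) a)))
  have hv : ∀ a (j : ℕ), coeff j (v a) = coeff j (u (j + 1) a) := fun a j => by
    simp only [v]
    rw [coeff_ofPowerSeries, if_neg (by simp)]
    simp
  have hv0 : v ∈ lat ι 0 := fun a => ofPowerSeries_mem_ordGE _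
  refine ⟨v, hv0, fun m a n hn => ?_⟩
  rcases lt_or_ge n 0 with h' | h'
  · rw [Pi.sub_apply, map_sub, hv0 a n h', hu m a n h', sub_zero]
  · lift n to ℕ using h'
    obtain ⟨j, rfl⟩ : ∃ j, m = n + 1 + j := ⟨m - (n + 1), by lia⟩
    have := hst (n + 1) j a n (by simp)
    rw [Pi.sub_apply, map_sub] at this ⊢
    rw [hv, ← sub_eq_zero.mp this, sub_self]

end Conn

/-! ### The splitting with respect to the leading eigenvalues -/

section Split

variable {K : Type} [Field K] {ι : Type} [Fintype ι]

/-- The operator `X^k · X∂_X + A`. -/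
def delta (k : ℤ) (A : Matrix ι ι (LS K)) : (ι → LS K) →ₗ[K] (ι → LS K) where
  toFun v := x K k • conn (x K (-k) • A) v
  map_add' v w := by rw [map_add, smul_add]
  map_smul' c v := by rw [map_smul, smul_comm]; rfl

lemma delta_eq_smul_conn (k : ℤ) (A : Matrix ι ι (LS K)) (v : ι → LS K) :
    delta k A v = x K k • conn (x K (-k) • A) v := rfl

lemma conn_eq_smul_delta (k : ℤ) (A : Matrix ι ι (LS K)) (v : ι → LS K) :
    conn (x K (-k) • A) v = x K (-k) • delta k A v := by
  rw [delta_eq_smul_conn, smul_smul, x_neg_mul_x, one_smul]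

lemma delta_apply (k : ℤ) (A : Matrix ι ι (LS K)) (v : ι → LS K) (a : ι) :
    delta k A v a = x K k * d (v a) + (A *ᵥ v) a := by
  rw [delta_eq_smul_conn, Pi.smul_apply, conn_apply, smul_mulVec, Pi.smul_apply, smul_eq_mul,
    smul_eq_mul, mul_add, ← mul_assoc, x_mul_x_neg, one_mul]

lemma delta_smul (k : ℤ) (A : Matrix ι ι (LS K)) (f : LS K) (v : ι → LS K) :
    delta k A (f • v) = (x K k * d f) • v + f • delta k A v := by
  rw [delta_eq_smul_conn, conn_smul, smul_add, smul_smul, smul_smul, mul_comm _ f, ← smul_smul f]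
  rfl

/-- A matrix of Laurent series without poles. -/
def Integral (A : Matrix ι ι (LS K)) : Prop := ∀ a b, A a b ∈ ordGE K 0

/-- The value at the origin of a matrix. -/
def leadMatrix (A : Matrix ι ι (LS K)) : Matrix ι ι K := A.map (coeff 0)

variable {k : ℤ} {A : Matrix ι ι (LS K)}

lemma mulVec_mem_lat (hA : Integral A) {m : ℤ} {v : ι → LS K} (hv : v ∈ lat ι m) :
    A *ᵥ v ∈ lat ι m := fun a =>
  (ordGE K m).sum_mem fun b _ => by simpa using mul_mem_ordGE (hA a b) (hv b)

lemma x_mul_d_mem (hk : 0 < k) {m : ℤ} {f : LS K} (hf : f ∈ ordGE K m) :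
    x K k * d f ∈ ordGE K (m + 1) :=
  ordGE_mono (by lia) (x_mul_mem_ordGE (m := k) (d_mem_ordGE hf))

lemma delta_mem_lat (hk : 0 < k) (hA : Integral A) {m : ℤ} {v : ι → LS K} (hv : v ∈ lat ι m) :
    delta k A v ∈ lat ι m := fun a => by
  rw [delta_apply]
  exact (ordGE K m).add_mem (ordGE_mono (by lia) (x_mul_d_mem hk (hv a)))
    (mulVec_mem_lat hA hv a)

/-- For `k > 0` the part `X^k · X∂_X` raises the order, so `δ` acts on every quotient of successive
lattices through the constant matrix `A(0)`. The whole splitting rests on this. -/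
lemma lead_delta (hk : 0 < k) (hA : Integral A) {m : ℤ} {v : ι → LS K} (hv : v ∈ lat ι m) :
    lead m (delta k A v) = leadMatrix A *ᵥ lead m v := by
  funext a
  have h1 : coeff m (x K k * d (v a)) = 0 := x_mul_d_mem hk (hv a) m (by lia)
  rw [lead, delta_apply, map_add, h1, zero_add]
  simp only [mulVec, dotProduct, map_sum, leadMatrix, map_apply, lead]
  refine Finset.sum_congr rfl fun b _ => ?_
  have := coeff_mul_of_mem_ordGE (hA a b) (hv b)
  rwa [zero_add] at this

lemma aeval_delta_mem_lat (hk : 0 < k) (hA : Integral A) (P : K[X]) {m : ℤ} {v : ι → LS K}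
    (hv : v ∈ lat ι m) : aeval (delta k A) P v ∈ lat ι m := by
  induction P using Polynomial.induction_on' with
  | add p q hp hq => rw [map_add, LinearMap.add_apply]; exact (lat ι m).add_mem hp hq
  | monomial n a =>
    rw [aeval_monomial, Module.End.mul_apply, Module.algebraMap_end_apply]
    refine (lat ι m).smul_mem a ?_
    induction n with
    | zero => simpa using hv
    | succ n ih => rw [pow_succ', Module.End.mul_apply]; exact delta_mem_lat hk hA ih

lemma lead_aeval_delta [DecidableEq ι] (hk : 0 < k) (hA : Integral A) (P : K[X]) {m : ℤ}
    {v : ι → LS K} (hv : v ∈ lat ι m) :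
    lead m (aeval (delta k A) P v) = aeval (leadMatrix A) P *ᵥ lead m v := by
  induction P using Polynomial.induction_on' with
  | add p q hp hq =>
    rw [map_add, LinearMap.add_apply, map_add, add_mulVec, ← hp, ← hq]
    funext a; simp [lead]
  | monomial n a =>
    rw [aeval_monomial, Module.End.mul_apply, Module.algebraMap_end_apply, aeval_monomial,
      ← Algebra.smul_def, smul_mulVec]
    have h : ∀ w : ι → LS K, lead m (a • w) = a • lead m w := fun w => by funext i; simp [lead]
    rw [h]
    congr 1
    induction n with
    | zero => simp
    | succ n ih =>
      rw [pow_succ', Module.End.mul_apply, lead_delta hk hA, ih, pow_succ', mulVec_mulVec]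
      have := aeval_delta_mem_lat hk hA (X ^ n) hv
      simpa using this

/-- Each factor `P(δ)` vanishes on leading terms and so gains one order. This makes polynomials in
`δ` converge when they are congruent modulo growing powers of `P`. -/
lemma aeval_delta_pow_mem_lat [DecidableEq ι] (hk : 0 < k) (hA : Integral A) {P : K[X]}
    (hP : aeval (leadMatrix A) P = 0) (n : ℕ) {m : ℤ} {v : ι → LS K} (hv : v ∈ lat ι m) :
    aeval (delta k A) (P ^ n) v ∈ lat ι (m + n) := by
  induction n with
  | zero => simpa using hv
  | succ n ih =>
    rw [pow_succ', map_mul, Module.End.mul_apply]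
    have := mem_lat_succ (aeval_delta_mem_lat hk hA P ih)
      (by rw [lead_aeval_delta hk hA P ih, hP, zero_mulVec])
    rwa [add_assoc] at this

/-- `δ - c`, for `δ = X^k · X∂_X + A`. -/
def deltaSub (k : ℤ) (A : Matrix ι ι (LS K)) (c : K) : Module.End K (ι → LS K) :=
  aeval (delta k A) (X - C c)

lemma deltaSub_apply (k : ℤ) (A : Matrix ι ι (LS K)) (c : K) (v : ι → LS K) :
    deltaSub k A c v = delta k A v - c • v := by
  simp [deltaSub]

lemma deltaSub_pow (k : ℤ) (A : Matrix ι ι (LS K)) (c : K) (n : ℕ) :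
    deltaSub k A c ^ n = aeval (delta k A) ((X - C c) ^ n) := by
  rw [deltaSub, map_pow]

lemma deltaSub_pow_mem_lat (hk : 0 < k) (hA : Integral A) (c : K) (n : ℕ) {m : ℤ}
    {v : ι → LS K} (hv : v ∈ lat ι m) : (deltaSub k A c ^ n) v ∈ lat ι m := by
  rw [deltaSub_pow]; exact aeval_delta_mem_lat hk hA _ hv

lemma deltaSub_pow_mem_of_le (hk : 0 < k) (hA : Integral A) (c : K) {n n' : ℕ} (hn : n ≤ n')
    {m : ℤ} {v : ι → LS K} (hv : (deltaSub k A c ^ n) v ∈ lat ι m) :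
    (deltaSub k A c ^ n') v ∈ lat ι m := by
  obtain ⟨j, rfl⟩ := Nat.exists_eq_add_of_le' hn
  rw [pow_add, Module.End.mul_apply]
  exact deltaSub_pow_mem_lat hk hA c j hv

lemma exists_deltaSub_pow_add (hk : 0 < k) (hA : Integral A) (c : K) {m : ℤ}
    {v w : ι → LS K} (hv : ∃ n, (deltaSub k A c ^ n) v ∈ lat ι m)
    (hw : ∃ n, (deltaSub k A c ^ n) w ∈ lat ι m) :
    ∃ n, (deltaSub k A c ^ n) (v + w) ∈ lat ι m := by
  obtain ⟨n, hn⟩ := hv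
  obtain ⟨n', hn'⟩ := hw
  refine ⟨max n n', ?_⟩
  rw [map_add]
  exact (lat ι m).add_mem (deltaSub_pow_mem_of_le hk hA c (le_max_left _ _) hn)
    (deltaSub_pow_mem_of_le hk hA c (le_max_right _ _) hn')

lemma deltaSub_smul (c : K) (f : LS K) (v : ι → LS K) :
    deltaSub k A c (f • v) = (x K k * d f) • v + f • deltaSub k A c v := by
  rw [deltaSub_apply, deltaSub_apply, delta_smul, smul_sub, smul_comm c f v, add_sub_assoc]

/-- `δ` is not linear over Laurent series, but `(δ - c)(f v) = (X^k · X∂_X f) v + f (δ - c) v`. In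
the first term the scalar has gained one order; in the second, one power less of `δ - c` is needed.
Hence the double induction, on the missing order `j` and on `n`. It makes `genEig` a subspace over
Laurent series and not only over `K`. -/
lemma exists_deltaSub_pow_smul (hk : 0 < k) (hA : Integral A) (c : K) (m b : ℤ) (j : ℕ) :
    ∀ (f : LS K) (a : ℤ), f ∈ ordGE K a → m ≤ a + b + j → ∀ (n : ℕ) (v : ι → LS K), v ∈ lat ι b →
      (deltaSub k A c ^ n) v ∈ lat ι (m - a) → ∃ n', (deltaSub k A c ^ n') (f • v) ∈ lat ι m := by
  induction j with
  | zero =>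
    intro f a hf hm n v hv _
    exact ⟨0, lat_mono (by simpa using hm) (smul_mem_lat hf hv)⟩
  | succ j ih =>
    intro f a hf hm n
    induction n with
    | zero =>
      intro v _ hv
      exact ⟨0, lat_mono (by lia) (smul_mem_lat hf hv)⟩
    | succ n ihn =>
      intro v hvb hv
      have h1 := ih _ (a + 1) (x_mul_d_mem hk hf) (by push_cast at hm ⊢; lia) (n + 1) v hvb
        (lat_mono (by lia) hv)
      have h2 := ihn (deltaSub k A c v) (by simpa using deltaSub_pow_mem_lat hk hA c 1 hvb)
        (by rwa [pow_succ, Module.End.mul_apply] at hv)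
      obtain ⟨n', hn'⟩ := exists_deltaSub_pow_add hk hA c h1 h2
      refine ⟨n' + 1, ?_⟩
      rwa [pow_succ, Module.End.mul_apply, deltaSub_smul]

/-- The vectors on which `δ - c` is topologically nilpotent, for `δ = X^k · X∂_X + A`. -/
def genEig (hk : 0 < k) (hA : Integral A) (c : K) : Submodule (LS K) (ι → LS K) where
  carrier := {v | ∀ m : ℤ, ∃ n : ℕ, (deltaSub k A c ^ n) v ∈ lat ι m}
  zero_mem' := fun m => ⟨0, by simp⟩
  add_mem' := fun hv hw m => exists_deltaSub_pow_add hk hA c (hv m) (hw m)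
  smul_mem' := fun f v hv m => by
    obtain ⟨a, ha⟩ := exists_mem_ordGE f
    obtain ⟨b, hb⟩ := exists_mem_lat v
    obtain ⟨n, hn⟩ := hv (m - a)
    exact exists_deltaSub_pow_smul hk hA c m b (m - a - b).toNat f a ha (by lia) n v hb hn

lemma delta_mem_genEig (hk : 0 < k) (hA : Integral A) {c : K} {v : ι → LS K}
    (hv : v ∈ genEig hk hA c) : delta k A v ∈ genEig hk hA c := by
  intro m
  obtain ⟨n, hn⟩ := hv m
  refine ⟨n, ?_⟩
  have h : (deltaSub k A c ^ n) (delta k A v) = delta k A ((deltaSub k A c ^ n) v) := by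
    have : Commute (deltaSub k A c ^ n) (delta k A) := by
      rw [deltaSub_pow]
      nth_rewrite 2 [← aeval_X (R := K) (delta k A)]
      exact (Commute.all ((X - C c) ^ n) X).map (aeval (delta k A))
    exact LinearMap.congr_fun this.eq v
  rw [h]
  exact delta_mem_lat hk hA hn

lemma conn_mem_genEig (hk : 0 < k) (hA : Integral A) {c : K} {v : ι → LS K}
    (hv : v ∈ genEig hk hA c) : conn (x K (-k) • A) v ∈ genEig hk hA c := by
  rw [conn_eq_smul_delta]
  exact Submodule.smul_mem _ _ (delta_mem_genEig hk hA hv)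

end Split

end

section

open Matrix LS
open Polynomial (aeval X C aeval_X aeval_monomial)
open scoped Polynomial

/-! ### Decomposition into generalized eigenspaces of the leading matrix. -/

section Decomposition

variable {K : Type} [Field K] {ι : Type} [Fintype ι] {k : ℤ} {A : Matrix ι ι (LS K)}

lemma aeval_delta_mem_of_dvd (hk : 0 < k) (hA : Integral A) {P Q : K[X]} (h : P ∣ Q) {m : ℤ}
    {v : ι → LS K} (hv : aeval (delta k A) P v ∈ lat ι m) : aeval (delta k A) Q v ∈ lat ι m := by
  obtain ⟨R, rfl⟩ := h
  rw [mul_comm, map_mul, Module.End.mul_apply]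
  exact aeval_delta_mem_lat hk hA R hv

lemma isCoprime_pow_sub_C {c c' : K} (h : c ≠ c') (n n' : ℕ) :
    IsCoprime ((X - C c) ^ n) ((X - C c') ^ n') :=
  (Polynomial.isCoprime_X_sub_C_of_isUnit_sub (sub_ne_zero.mpr h).isUnit).pow

/-- Modulo `lat ι m`, the vector `w c` is killed by a power of `δ - c`, and also by a product of
powers of the other `δ - c'`, since it is minus the sum of the other vectors. These polynomials are
coprime, so Bézout puts `w c` in every lattice. -/
lemma eq_zero_of_sum_genEig_eq_zero (hk : 0 < k) (hA : Integral A) (S : Finset K)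
    (w : K → ι → LS K) (hw : ∀ c ∈ S, w c ∈ genEig hk hA c) (h : ∑ c ∈ S, w c = 0) :
    ∀ c ∈ S, w c = 0 := by
  classical
  intro c hc
  refine eq_zero_of_forall_mem_lat fun m => ?_
  have hn : ∀ c', ∃ n : ℕ, c' ∈ S → (deltaSub k A c' ^ n) (w c') ∈ lat ι m := fun c' => by
    by_cases hc' : c' ∈ S
    · exact (hw c' hc' m).imp fun n hn _ => hn
    · exact ⟨0, fun h => absurd h hc'⟩
  choose n hn using hn
  let P : K[X] := ∏ c' ∈ S.erase c, (X - C c') ^ n c'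
  have hcop : IsCoprime P ((X - C c) ^ n c) := IsCoprime.prod_left fun c' hc' =>
    isCoprime_pow_sub_C (Finset.ne_of_mem_erase hc') _ _
  obtain ⟨a, b, hab⟩ := hcop
  have h1 : aeval (delta k A) P (w c) ∈ lat ι m := by
    rw [← Finset.add_sum_erase S w hc, add_eq_zero_iff_eq_neg] at h
    rw [h, map_neg, map_sum]
    refine (lat ι m).neg_mem ((lat ι m).sum_mem fun c' hc' => ?_)
    refine aeval_delta_mem_of_dvd hk hA (Finset.dvd_prod_of_mem _ hc') ?_
    rw [← deltaSub_pow]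
    exact hn c' (Finset.mem_of_mem_erase hc')
  have h2 : aeval (delta k A) ((X - C c) ^ n c) (w c) ∈ lat ι m := by
    rw [← deltaSub_pow]; exact hn c hc
  have h3 : w c = aeval (delta k A) (a * P + b * (X - C c) ^ n c) (w c) := by
    rw [hab, map_one, Module.End.one_apply]
  rw [h3, map_add, LinearMap.add_apply]
  exact (lat ι m).add_mem (aeval_delta_mem_of_dvd hk hA (dvd_mul_left _ _) h1)
    (aeval_delta_mem_of_dvd hk hA (dvd_mul_left _ _) h2)

lemma iSupIndep_genEig (hk : 0 < k) (hA : Integral A) : iSupIndep (genEig hk hA) := by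
  rw [iSupIndep_iff_finsetSum_eq_zero_imp_eq_zero]
  intro S w hw h
  exact eq_zero_of_sum_genEig_eq_zero hk hA S w hw h

/-- Chinese remainders: `e c` is congruent to `0` modulo `(X - c')^N` for `c' ≠ c`, hence to `1`
modulo `(X - c)^N`. Evaluated at `δ`, these polynomials approximate the projectors onto the
summands. -/
lemma exists_partition_of_unity (S : Finset K) (hS : S.Nonempty) (N : ℕ) :
    ∃ e : K → K[X], ∑ c ∈ S, e c = 1 ∧
      ∀ c ∈ S, ∀ c' ∈ S, c' ≠ c → (X - C c') ^ N ∣ e c := by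
  classical
  have hp : Pairwise (Function.onFun IsCoprime fun c : S => (X - C (c : K)) ^ N) :=
    fun c c' h => isCoprime_pow_sub_C (fun e => h (Subtype.ext e)) _ _
  obtain ⟨μ, hμ⟩ := (exists_sum_eq_one_iff_pairwise_coprime
    (s := fun c : K => (X - C c) ^ N) hS).mpr hp
  refine ⟨_, hμ, fun c _ c' hc' h => ?_⟩
  exact Dvd.dvd.mul_left (Finset.dvd_prod_of_mem _ (by simp [hc', h])) _

/-- The leading eigenvalues of the connection `X∂_X + X^(-k) A`. -/
def leadEigs [DecidableEq ι] [DecidableEq K] (A : Matrix ι ι (LS K)) : Finset K :=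
  (leadMatrix A).charpoly.roots.toFinset

/-- Cayley–Hamilton, with all multiplicities replaced by the uniform bound `Fintype.card ι`. -/
lemma aeval_leadMatrix_prod [DecidableEq ι] [DecidableEq K] [IsAlgClosed K] :
    aeval (leadMatrix A) (∏ c ∈ leadEigs A, (X - C c) ^ Fintype.card ι) = 0 := by
  have h : (leadMatrix A).charpoly ∣ ∏ c ∈ leadEigs A, (X - C c) ^ Fintype.card ι := by
    have hs := IsAlgClosed.splits (leadMatrix A).charpoly
    have h1 : ((leadMatrix A).charpoly.roots.map fun a => X - C a).prod =
        (leadMatrix A).charpoly :=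
      (hs.eq_prod_roots_of_monic (charpoly_monic _)).symm
    rw [← h1, Finset.prod_multiset_map_count]
    refine Finset.prod_dvd_prod_of_dvd _ _ fun c _ => pow_dvd_pow _ ?_
    refine (Multiset.count_le_card _ _).trans ((Polynomial.card_roots' _).trans ?_)
    rw [charpoly_natDegree_eq_dim]
  obtain ⟨R, hR⟩ := h
  rw [hR, map_mul, aeval_self_charpoly, zero_mul]

/-- A Hensel argument. The approximate projectors `e m c`, built for the exponent `N * m`, satisfy
`P^m ∣ e (m + 1) c - e m c`, and `P^m(δ)` raises the order by `m`; so `e m c (δ) v` converges. The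
limit lies in the eigenspace of `c` because `P^m` divides `(X - c)^(N m) · e m c`. -/
lemma exists_sum_genEig [DecidableEq ι] [DecidableEq K] [IsAlgClosed K] [Nonempty ι]
    (hk : 0 < k) (hA : Integral A) {v : ι → LS K} (hv : v ∈ lat ι 0) :
    ∃ w : K → ι → LS K, (∀ c ∈ leadEigs A, w c ∈ genEig hk hA c) ∧ ∑ c ∈ leadEigs A, w c = v := by
  set S := leadEigs A with hSdef
  set N := Fintype.card ι
  have hS : S.Nonempty := by
    obtain ⟨c, hc⟩ := IsAlgClosed.exists_root (leadMatrix A).charpoly (by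
      rw [charpoly_degree_eq_dim]
      exact_mod_cast Fintype.card_ne_zero)
    refine ⟨c, ?_⟩
    rw [hSdef, leadEigs, Multiset.mem_toFinset,
      Polynomial.mem_roots (charpoly_monic _).ne_zero]
    exact hc
  set P : K[X] := ∏ c ∈ S, (X - C c) ^ N with hP
  have hPm : ∀ m : ℕ, P ^ m = ∏ c ∈ S, (X - C c) ^ (N * m) := fun m => by
    rw [hP, ← Finset.prod_pow]; simp_rw [← pow_mul]
  have hP0 : aeval (leadMatrix A) P = 0 := aeval_leadMatrix_prod
  have hlat : ∀ (m : ℕ) (Q : K[X]), P ^ m ∣ Q → aeval (delta k A) Q v ∈ lat ι m := by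
    intro m Q hQ
    refine aeval_delta_mem_of_dvd hk hA hQ ?_
    simpa using aeval_delta_pow_mem_lat hk hA hP0 m hv
  choose e he1 he2 using fun m => exists_partition_of_unity S hS (N * m)
  have hdvd : ∀ c ∈ S, ∀ m, P ^ m ∣ (X - C c) ^ (N * m) * e m c := by
    intro c hc m
    rw [hPm, ← Finset.mul_prod_erase S _ hc]
    refine mul_dvd_mul_left _ (Finset.prod_dvd_of_coprime ?_ fun c' hc' => ?_)
    · intro a _ b _ hab
      exact isCoprime_pow_sub_C hab _ _
    · exact he2 m c hc c' (Finset.mem_of_mem_erase hc') (Finset.ne_of_mem_erase hc')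
  have hdiff : ∀ c ∈ S, ∀ m, P ^ m ∣ e (m + 1) c - e m c := by
    intro c hc m
    have hle : ∀ (a : K) (b : K[X]), (X - C a) ^ (N * (m + 1)) ∣ b → (X - C a) ^ (N * m) ∣ b := fun a b =>
      (pow_dvd_pow _ (by gcongr; lia)).trans
    rw [hPm]
    refine Finset.prod_dvd_of_coprime (fun a _ b _ hab => isCoprime_pow_sub_C hab _ _) ?_
    intro c' hc'
    by_cases h : c' = c
    · subst h
      -- At its own root the congruence `e j c' ≡ 1` is read off from the complementary sum, so that
      -- the ones cancel in the difference.
      have hs : ∀ j, e j c' = 1 - ∑ c ∈ S.erase c', e j c := fun j => by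
        rw [← he1 j, ← Finset.add_sum_erase S _ hc', add_sub_cancel_right]
      have hd : ∀ j, (X - C c') ^ (N * j) ∣ ∑ c ∈ S.erase c', e j c := fun j =>
        Finset.dvd_sum fun c hc => he2 j c (Finset.mem_of_mem_erase hc) c' hc'
          (Finset.ne_of_mem_erase hc).symm
      rw [hs, hs, sub_sub_sub_cancel_left]
      exact dvd_sub (hd m) (hle _ _ (hd (m + 1)))
    · exact dvd_sub (hle _ _ (he2 _ c hc c' hc' h)) (he2 _ c hc c' hc' h)
  have hlim : ∀ c, ∃ w, c ∈ S → ∀ m : ℕ, w - aeval (delta k A) (e m c) v ∈ lat ι m := by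
    intro c
    by_cases hc : c ∈ S
    · obtain ⟨w, -, hw⟩ := exists_limit (fun m => aeval (delta k A) (e m c) v)
        (aeval_delta_mem_lat hk hA _ hv) (fun m => by
          rw [← LinearMap.sub_apply, ← map_sub]
          exact hlat m _ (hdiff c hc m))
      exact ⟨w, fun _ => hw⟩
    · exact ⟨0, fun h => absurd h hc⟩
  choose w hw using hlim
  refine ⟨w, fun c hc m => ⟨N * m.toNat, ?_⟩, ?_⟩
  · refine lat_mono (Int.self_le_toNat m) ?_
    have h1 := deltaSub_pow_mem_lat hk hA c (N * m.toNat) (hw c hc m.toNat)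
    have h2 := hlat m.toNat _ (hdvd c hc m.toNat)
    rw [map_mul, Module.End.mul_apply, ← deltaSub_pow] at h2
    have := (lat ι m.toNat).add_mem h1 h2
    rwa [map_sub, sub_add_cancel] at this
  · refine sub_eq_zero.mp (eq_zero_of_forall_mem_lat_nat fun m => ?_)
    have : ∑ c ∈ S, w c - v = ∑ c ∈ S, (w c - aeval (delta k A) (e m c) v) := by
      rw [Finset.sum_sub_distrib, ← LinearMap.sum_apply, ← map_sum, he1, map_one,
        Module.End.one_apply]
    rw [this]
    exact (lat ι m).sum_mem fun c hc => hw c hc m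

lemma iSup_genEig [DecidableEq ι] [DecidableEq K] [IsAlgClosed K] (hk : 0 < k)
    (hA : Integral A) : ⨆ c ∈ leadEigs A, genEig hk hA c = ⊤ := by
  rcases isEmpty_or_nonempty ι with h | h
  · exact Subsingleton.elim _ _
  refine eq_top_iff.mpr fun v _ => ?_
  obtain ⟨m, hm⟩ := exists_mem_lat v
  obtain ⟨w, hw, hs⟩ := exists_sum_genEig hk hA (v := x K (-m) • v) (by
    simpa using smul_mem_lat (x_mem_ordGE (-m)) hm)
  have hv : v = x K m • ∑ c ∈ leadEigs A, w c := by
    rw [hs, smul_smul, x_mul_x_neg, one_smul]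
  rw [hv]
  exact Submodule.smul_mem _ _ (Submodule.sum_mem_biSup hw)

/-- If the summand were zero, the constant lift of `u` would decompose along the other eigenvalues,
so some polynomial `P(δ)` with `P(c) ≠ 0` would send it into `lat ι 1`. But the leading term of the
image is `P(c) u ≠ 0`. -/
lemma genEig_ne_bot [DecidableEq ι] [DecidableEq K] [IsAlgClosed K] (hk : 0 < k)
    (hA : Integral A) {c : K} {u : ι → K} (hu : u ≠ 0) (hc : leadMatrix A *ᵥ u = c • u) :
    genEig hk hA c ≠ ⊥ := by
  intro hbot
  have : Nonempty ι := by
    by_contra h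
    rw [not_nonempty_iff] at h
    exact hu (Subsingleton.elim _ _)
  let v : ι → LS K := fun a => algebraMap K (LS K) (u a)
  have hv : v ∈ lat ι 0 := fun a => algebraMap_mem_ordGE _
  have hlv : lead 0 v = u := by
    funext a
    simp [lead, v, Algebra.algebraMap_eq_smul_one, coeff_one]
  obtain ⟨w, hw, hs⟩ := exists_sum_genEig hk hA hv
  have hn : ∀ c', ∃ n : ℕ, c' ∈ leadEigs A → (deltaSub k A c' ^ n) (w c') ∈ lat ι 1 := fun c' => by
    by_cases hc' : c' ∈ leadEigs A
    · exact (hw c' hc' 1).imp fun n hn _ => hn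
    · exact ⟨0, fun h => absurd h hc'⟩
  choose n hn using hn
  let P : K[X] := ∏ c' ∈ (leadEigs A).erase c, (X - C c') ^ n c'
  have h1 : aeval (delta k A) P v ∈ lat ι 1 := by
    rw [← hs, map_sum]
    refine (lat ι 1).sum_mem fun c' hc' => ?_
    by_cases h : c' = c
    · subst h
      have := hw c' hc'
      rw [hbot, Submodule.mem_bot] at this
      rw [this, map_zero]
      exact (lat ι 1).zero_mem
    · refine aeval_delta_mem_of_dvd hk hA
        (Finset.dvd_prod_of_mem _ (Finset.mem_erase.mpr ⟨h, hc'⟩)) ?_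
      rw [← deltaSub_pow]
      exact hn c' hc'
  have h2 := lead_aeval_delta hk hA P hv
  rw [lead_eq_zero (m := 0) (by simpa using h1), hlv] at h2
  have h3 : aeval (leadMatrix A) P *ᵥ u = P.eval c • u := by
    have := Module.End.aeval_apply_of_hasEigenvector (f := Matrix.toLin' (leadMatrix A)) (μ := c)
      (x := u) (p := P) ⟨Module.End.mem_eigenspace_iff.mpr (by simpa using hc), hu⟩
    rw [← this, ← Matrix.toLinAlgEquiv'_apply]
    exact LinearMap.congr_fun (Polynomial.aeval_algHom_apply
      (Matrix.toLinAlgEquiv' (R := K) (n := ι)).toAlgHom (leadMatrix A) P).symm u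
  rw [h3] at h2
  rcases smul_eq_zero.mp h2.symm with h | h
  · simp only [P, Polynomial.eval_prod, Polynomial.eval_pow, Polynomial.eval_sub,
      Polynomial.eval_X, Polynomial.eval_C] at h
    obtain ⟨c', hc', h⟩ := Finset.prod_eq_zero_iff.mp h
    exact (Finset.ne_of_mem_erase hc') (sub_eq_zero.mp (eq_zero_of_pow_eq_zero h)).symm
  · exact hu h

/-- The eigenvalue of an eigenvector in `genEig c` has the leading term `c X^(-k)`. -/
lemma eigenvalue_of_mem_genEig (hk : 0 < k) (hA : Integral A) {c : K} {v : ι → LS K}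
    (hv : v ∈ genEig hk hA c) (hv0 : v ≠ 0) {h : LS K} (hh : conn (x K (-k) • A) v = h • v) :
    h ∈ ordGE K (-k) ∧ coeff (-k) h = c := by
  obtain ⟨m, hm, hm0⟩ := exists_lead_ne_zero hv0
  obtain ⟨a, ha⟩ := Function.ne_iff.mp hm0
  change coeff m (v a) ≠ 0 at ha
  set g := x K k * h with hg
  have hδ : delta k A v = g • v := by rw [delta_eq_smul_conn, hh, smul_smul]
  -- A pole of `g` would make `δ v = g v` have a worse order than `v`, although `δ` preserves the
  -- lattices.
  have hg0 : g ∈ ordGE K 0 := by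
    rcases eq_or_ne g 0 with h0 | h0
    · rw [h0]; exact Submodule.zero_mem _
    obtain ⟨n, hn, hn0⟩ := exists_lead_ne_zero (v := fun _ : Unit => g)
      (fun e => h0 (congrFun e ()))
    obtain ⟨_, hn0⟩ := Function.ne_iff.mp hn0
    have h1 : coeff (n + m) (g * v a) ≠ 0 := by
      rw [coeff_mul_of_mem_ordGE (hn ()) (hm a)]
      exact mul_ne_zero hn0 ha
    have h2 := delta_mem_lat hk hA hm a
    rw [hδ] at h2
    refine ordGE_mono ?_ (hn ())
    by_contra hlt
    exact h1 (h2 (n + m) (by lia))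
  have hhg : h = x K (-k) * g := by rw [hg, ← mul_assoc, x_neg_mul_x, one_mul]
  have hgc : coeff 0 g = c := by
    by_contra hne
    -- If the constant term of `g` is not `c`, every `(δ - c)^n v` is `v` times a power series with
    -- nonzero constant term, so it cannot tend to zero.
    have key : ∀ n : ℕ, ∃ u ∈ ordGE K 0, coeff 0 u ≠ 0 ∧ (deltaSub k A c ^ n) v = u • v := by
      intro n
      induction n with
      | zero => exact ⟨1, one_mem_ordGE, by simp [coeff_one], by simp⟩
      | succ n ih =>
        obtain ⟨u, hu, hu0, hun⟩ := ih
        have hgc' : g - algebraMap K (LS K) c ∈ ordGE K 0 :=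
          Submodule.sub_mem _ hg0 (algebraMap_mem_ordGE c)
        refine ⟨x K k * d u + u * (g - algebraMap K (LS K) c), ?_, ?_, ?_⟩
        · exact Submodule.add_mem _ (ordGE_mono (by lia) (x_mul_d_mem hk hu))
            (mul_mem_ordGE_of_left hu hgc')
        · have h1 := coeff_mul_of_mem_ordGE hu hgc'
          rw [add_zero] at h1
          rw [map_add, x_mul_d_mem hk hu 0 (by lia), zero_add, h1, map_sub,
            Algebra.algebraMap_eq_smul_one, map_smul, coeff_one, if_pos rfl, smul_eq_mul, mul_one]
          exact mul_ne_zero hu0 (sub_ne_zero.mpr hne)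
        · rw [pow_succ', Module.End.mul_apply, hun, deltaSub_smul, deltaSub_apply, hδ,
            ← algebraMap_smul (LS K) c v, ← sub_smul, smul_smul, ← add_smul]
    obtain ⟨n, hn⟩ := hv (m + 1)
    obtain ⟨u, hu, hu0, hun⟩ := key n
    have h1 := hn a m (by lia)
    rw [hun, Pi.smul_apply, smul_eq_mul] at h1
    have h2 := coeff_mul_of_mem_ordGE hu (hm a)
    rw [zero_add, h1] at h2
    exact mul_ne_zero hu0 ha h2.symm
  constructor
  · rw [hhg]; simpa using x_mul_mem_ordGE (m := -k) hg0
  · rw [hhg, coeff_x_mul, sub_self, hgc]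

end Decomposition

/-! ### Ramification of connections -/

section Ram

variable {K : Type} [Field K] {ι κ : Type} [Fintype ι] [Fintype κ]

/-- The vector obtained by the substitution `X ↦ X ^ q`. -/
def ramV (q : ℕ+) (v : ι → LS K) : ι → LS K := fun a => ram q (v a)

/-- The matrix of the pull-back of a connection by `X ↦ X ^ q`. -/
def ramM (q : ℕ+) (B : Matrix ι ι (LS K)) : Matrix ι ι (LS K) := ((q : ℕ) : K) • B.map (ram q)

lemma map_ram_mulVec (q : ℕ+) (B : Matrix ι κ (LS K)) (v : κ → LS K) :
    B.map (ram q) *ᵥ ramV q v = ramV q (B *ᵥ v) := by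
  funext a
  simp [mulVec, dotProduct, ramV]

lemma conn_ramM (q : ℕ+) (B : Matrix ι ι (LS K)) (v : ι → LS K) :
    conn (ramM q B) (ramV q v) = ((q : ℕ) : K) • ramV q (conn B v) := by
  funext a
  rw [conn_apply, ramM, smul_mulVec, map_ram_mulVec, Pi.smul_apply, Pi.smul_apply]
  simp only [ramV, conn_apply, d_ram, map_add, smul_add]

lemma ramM_ramM (q q' : ℕ+) (B : Matrix ι ι (LS K)) :
    ramM q' (ramM q B) = ramM (q * q') B := by
  ext1 a b
  simp only [ramM, Matrix.smul_apply, map_apply, map_smul, ram_ram, smul_smul]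
  push_cast
  rw [mul_comm]

lemma ramV_ramV (q q' : ℕ+) (v : ι → LS K) : ramV q' (ramV q v) = ramV (q * q') v :=
  funext fun _ => ram_ram _ _ _

lemma ramV_smul (q : ℕ+) (f : LS K) (v : ι → LS K) :
    ramV q (f • v) = ram q f • ramV q v := funext fun _ => map_mul _ _ _

lemma ramV_smul_scalar (q : ℕ+) (c : K) (v : ι → LS K) :
    ramV q (c • v) = c • ramV q v := funext fun a => map_smul (ram q) c (v a)

lemma ramV_sub (q : ℕ+) (v w : ι → LS K) : ramV q (v - w) = ramV q v - ramV q w :=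
  funext fun _ => map_sub _ _ _

lemma ramV_sum {σ : Type*} (q : ℕ+) (s : Finset σ) (v : σ → ι → LS K) :
    ramV q (∑ i ∈ s, v i) = ∑ i ∈ s, ramV q (v i) := by
  funext a
  simp [ramV]

lemma ramV_mem_lat (q : ℕ+) {m : ℤ} {v : ι → LS K} (hv : v ∈ lat ι m) :
    ramV q v ∈ lat ι ((q : ℕ) * m) := fun a => ram_mem_ordGE q (hv a)

lemma ramM_smul_x (q : ℕ+) (k : ℤ) (A : Matrix ι ι (LS K)) :
    ramM q (x K (-k) • A) = x K (-((q : ℕ) * k)) • ramM q A := by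
  ext1 a b
  simp only [ramM, Matrix.smul_apply, map_apply, smul_eq_mul, map_mul, ram_x, mul_neg]
  rw [mul_smul_comm]

lemma delta_ramM (q : ℕ+) (k : ℤ) (A : Matrix ι ι (LS K)) (v : ι → LS K) :
    delta ((q : ℕ) * k) (ramM q A) (ramV q v) = ((q : ℕ) : K) • ramV q (delta k A v) := by
  rw [delta_eq_smul_conn, ← ramM_smul_x, conn_ramM, delta_eq_smul_conn, ramV_smul, ram_x,
    smul_comm]

lemma integral_ramM (q : ℕ+) {A : Matrix ι ι (LS K)} (hA : Integral A) : Integral (ramM q A) :=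
  fun a b => Submodule.smul_mem _ _ (by simpa using ram_mem_ordGE q (hA a b))

lemma ramV_mem_genEig (q : ℕ+) {k : ℤ} {A : Matrix ι ι (LS K)} (hk : 0 < k) (hA : Integral A)
    (hqk : 0 < ((q : ℕ) : ℤ) * k) {c : K} {v : ι → LS K} (hv : v ∈ genEig hk hA c) :
    ramV q v ∈ genEig hqk (integral_ramM q hA) ((q : ℕ) * c) := by
  have h1 : ∀ v : ι → LS K, deltaSub ((q : ℕ) * k) (ramM q A) ((q : ℕ) * c) (ramV q v) =
      ((q : ℕ) : K) • ramV q (deltaSub k A c v) := fun v => by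
    rw [deltaSub_apply, deltaSub_apply, delta_ramM, ramV_sub, smul_sub, ramV_smul_scalar, smul_smul]
  have h2 : ∀ n : ℕ, (deltaSub ((q : ℕ) * k) (ramM q A) ((q : ℕ) * c) ^ n) (ramV q v) =
      ((q : ℕ) : K) ^ n • ramV q ((deltaSub k A c ^ n) v) := by
    intro n
    induction n with
    | zero => simp
    | succ n ih =>
      rw [pow_succ', Module.End.mul_apply, ih, map_smul, h1, smul_smul, pow_succ' (deltaSub k A c),
        Module.End.mul_apply, pow_succ]
  intro m
  -- Ramification multiplies orders by `q ≥ 1`, which improves them only when they are nonnegative;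
  -- hence `max m 0`.
  obtain ⟨n, hn⟩ := hv (max m 0)
  refine ⟨n, ?_⟩
  rw [h2]
  refine Submodule.smul_mem _ _ (lat_mono ?_ (ramV_mem_lat q hn))
  have : (1 : ℤ) ≤ (q : ℕ) := by exact_mod_cast q.pos
  nlinarith [le_max_left m 0, le_max_right m 0]

end Ram

end

section

open Matrix LS

/-! ### Subconnections -/

section Sub

variable {K : Type} [Field K] {ι κ : Type} [Fintype ι] [Fintype κ] [DecidableEq κ]

/-- The columns of `G` form a basis of a subconnection of `X∂_X + B`, in which it has the
matrix `C`. -/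
def IsSub (B : Matrix ι ι (LS K)) (C : Matrix κ κ (LS K)) (G : Matrix ι κ (LS K)) : Prop :=
  (∀ j, conn B (fun a => G a j) = G *ᵥ fun i => C i j) ∧ ∃ L : Matrix κ ι (LS K), L * G = 1

lemma mulVec_eq_sum_smul (G : Matrix ι κ (LS K)) (w : κ → LS K) :
    G *ᵥ w = ∑ j, w j • fun a => G a j := by
  funext a
  simp [mulVec, dotProduct, mul_comm]

lemma IsSub.conn_mulVec {B : Matrix ι ι (LS K)} {C : Matrix κ κ (LS K)} {G : Matrix ι κ (LS K)}
    (h : IsSub B C G) (w : κ → LS K) : conn B (G *ᵥ w) = G *ᵥ conn C w := by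
  have h1 : conn C w = (fun j => d (w j)) + ∑ j, w j • fun i => C i j := by
    rw [← mulVec_eq_sum_smul]; rfl
  rw [h1, mulVec_add, mulVec_eq_sum_smul G w, mulVec_eq_sum_smul G (fun j => d (w j)), map_sum,
    ← mulVecLin_apply, map_sum, ← Finset.sum_add_distrib]
  refine Finset.sum_congr rfl fun j _ => ?_
  rw [conn_smul, h.1 j, map_smul, mulVecLin_apply]

lemma IsSub.mulVec_ne_zero {B : Matrix ι ι (LS K)} {C : Matrix κ κ (LS K)}
    {G : Matrix ι κ (LS K)} (h : IsSub B C G) {w : κ → LS K} (hw : w ≠ 0) : G *ᵥ w ≠ 0 := by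
  obtain ⟨L, hL⟩ := h.2
  intro h0
  apply hw
  rw [← one_mulVec w, ← hL, ← mulVec_mulVec, h0, mulVec_zero]

lemma map_ram_mul_eq_one (q : ℕ+) {L : Matrix κ ι (LS K)} {G : Matrix ι κ (LS K)} (h : L * G = 1) :
    L.map (ram q) * G.map (ram q) = 1 := by
  rw [← Matrix.map_mul, h, Matrix.map_one _ (map_zero _) (map_one _)]

lemma IsSub.ram {B : Matrix ι ι (LS K)} {C : Matrix κ κ (LS K)} {G : Matrix ι κ (LS K)}
    (h : IsSub B C G) (q : ℕ+) : IsSub (ramM q B) (ramM q C) (G.map (ram q)) := by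
  refine ⟨fun j => ?_, ?_⟩
  · have h1 := conn_ramM q B (fun a => G a j)
    rw [h.1 j, ← map_ram_mulVec, ← mulVec_smul] at h1
    exact h1
  · obtain ⟨L, hL⟩ := h.2
    exact ⟨_, map_ram_mul_eq_one q hL⟩

/-- A left inverse is the form of independence that is carried along by the substitution `X ↦ X ^
q`. -/
lemma exists_left_inverse_iff (G : Matrix ι κ (LS K)) :
    (∃ L : Matrix κ ι (LS K), L * G = 1) ↔ LinearIndependent (LS K) fun j a => G a j := by
  classical
  rw [show (fun j a => G a j) = G.col from rfl, ← Matrix.mulVec_injective_iff]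
  constructor
  · rintro ⟨L, hL⟩ v w hvw
    rw [← one_mulVec v, ← hL, ← mulVec_mulVec]
    change L *ᵥ (G.mulVec v) = w
    rw [hvw, mulVec_mulVec, hL, one_mulVec]
  · intro h
    obtain ⟨g, hg⟩ := LinearMap.exists_leftInverse_of_injective G.mulVecLin
      (LinearMap.ker_eq_bot.mpr h)
    refine ⟨LinearMap.toMatrix' g, ?_⟩
    have := congrArg LinearMap.toMatrix' hg
    rwa [LinearMap.toMatrix'_comp, LinearMap.toMatrix'_id, ← Matrix.toLin'_apply',
      LinearMap.toMatrix'_toLin'] at this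

lemma exists_isSub_of_stable (B : Matrix ι ι (LS K)) (W : Submodule (LS K) (ι → LS K))
    (hW : ∀ v ∈ W, conn B v ∈ W) :
    ∃ (C : Matrix (Fin (Module.finrank (LS K) W)) (Fin (Module.finrank (LS K) W)) (LS K))
      (G : Matrix ι (Fin (Module.finrank (LS K) W)) (LS K)),
      IsSub B C G ∧ ∀ j, (fun a => G a j) ∈ W := by
  let b := Module.finBasis (LS K) W
  let G : Matrix ι (Fin (Module.finrank (LS K) W)) (LS K) := Matrix.of fun a j => (b j : ι → LS K) a
  let w : Fin (Module.finrank (LS K) W) → W := fun j => ⟨conn B (b j), hW _ (b j).2⟩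
  refine ⟨Matrix.of fun i j => b.repr (w j) i, G, ⟨fun j => ?_, ?_⟩, fun j => (b j).2⟩
  · have h := congrArg Subtype.val (b.sum_repr (w j))
    rw [mulVec_eq_sum_smul]
    simp only [Submodule.coe_sum, Submodule.coe_smul] at h
    exact h.symm
  · rw [exists_left_inverse_iff]
    exact b.linearIndependent.map' W.subtype (Submodule.ker_subtype W)

end Sub

/-! ### Cyclic vectors -/

section Cyclic

variable {K : Type} [Field K] {ι : Type} [Fintype ι]

/-- The vectors `v, Dv, …, D^(r-1)v` are independent, and `D^r v = ∑ a_j D^j v`, where `D` is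
the connection `X∂_X + B`. -/
structure IsCyclic (B : Matrix ι ι (LS K)) (v : ι → LS K) (r : ℕ) (a : Fin r → LS K) : Prop where
  indep : LinearIndependent (LS K) fun j : Fin r => (conn B ^ (j : ℕ)) v
  rel : (conn B ^ r) v = ∑ j, a j • (conn B ^ (j : ℕ)) v

/-- `r` is the first index at which `D^r v` depends on the earlier iterates. The vector is cyclic
for the subconnection it generates, not necessarily for the whole space. -/
lemma exists_isCyclic (B : Matrix ι ι (LS K)) {v : ι → LS K} (hv : v ≠ 0) :
    ∃ r, 0 < r ∧ r ≤ Fintype.card ι ∧ ∃ a, IsCyclic B v r a := by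
  classical
  have hex : ∃ r, ¬ LinearIndependent (LS K) fun j : Fin (r + 1) => (conn B ^ (j : ℕ)) v := by
    refine ⟨Fintype.card ι, fun h => ?_⟩
    have := h.fintype_card_le_finrank
    simp at this
  set r := Nat.find hex with hr
  have hdep := Nat.find_spec hex
  have hpos : 0 < r := by
    rw [hr, Nat.find_pos, not_not]
    exact (linearIndependent_unique_iff (ι := Fin 1)).mpr (by simpa using hv)
  have hind : LinearIndependent (LS K) fun j : Fin r => (conn B ^ (j : ℕ)) v := by
    obtain ⟨s, hs⟩ := Nat.exists_eq_add_one_of_ne_zero hpos.ne'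
    have := Nat.find_min hex (m := s) (by lia)
    rw [not_not] at this
    rw [hs]
    exact this
  refine ⟨r, hpos, by simpa using hind.fintype_card_le_finrank, ?_⟩
  rw [linearIndependent_finSucc', not_and, not_not] at hdep
  have h := hdep hind
  obtain ⟨a, ha⟩ := (Submodule.mem_span_range_iff_exists_fun _).mp h
  exact ⟨a, hind, ha.symm⟩

lemma conn_pow_ramM (q : ℕ+) (B : Matrix ι ι (LS K)) (v : ι → LS K) (j : ℕ) :
    (conn (ramM q B) ^ j) (ramV q v) = ((q : ℕ) : K) ^ j • ramV q ((conn B ^ j) v) := by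
  induction j with
  | zero => simp
  | succ j ih =>
    rw [pow_succ', Module.End.mul_apply, ih, map_smul, conn_ramM, smul_smul, pow_succ' (conn B),
      Module.End.mul_apply, pow_succ]

/-- Pull-back replaces `D^j` by `q^j D^j`; in the relation of degree `r`, the coefficient of `D^j`
keeps the factor `q^(r-j)`. -/
lemma IsCyclic.ram [CharZero K] {B : Matrix ι ι (LS K)} {v : ι → LS K} {r : ℕ} {a : Fin r → LS K}
    (h : IsCyclic B v r a) (q : ℕ+) :
    IsCyclic (ramM q B) (ramV q v) r fun j => ((q : ℕ) : K) ^ (r - j) • ram q (a j) := by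
  have hq : ((q : ℕ) : K) ≠ 0 := by exact_mod_cast q.ne_zero
  constructor
  · have h1 : LinearIndependent (LS K) fun j : Fin r => ramV q ((conn B ^ (j : ℕ)) v) := by
      obtain ⟨L, hL⟩ := (exists_left_inverse_iff
        (Matrix.of fun a (j : Fin r) => (conn B ^ (j : ℕ)) v a)).mpr h.indep
      exact (exists_left_inverse_iff _).mp ⟨_, map_ram_mul_eq_one q hL⟩
    have h2 := h1.units_smul fun j => Units.mk0 (algebraMap K (LS K) (((q : ℕ) : K) ^ (j : ℕ)))
      (by rw [map_ne_zero]; exact pow_ne_zero _ hq)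
    convert! h2 using 2 with j
    rw [conn_pow_ramM, Pi.smul_apply', Units.smul_mk0, algebraMap_smul]
  · rw [conn_pow_ramM, h.rel, ramV_sum, Finset.smul_sum]
    refine Finset.sum_congr rfl fun j _ => ?_
    rw [conn_pow_ramM, ramV_smul, smul_assoc, smul_comm (LS.ram q (a j)) (((q : ℕ) : K) ^ (j : ℕ)),
      smul_smul, ← pow_add, Nat.sub_add_cancel j.2.le]

/-- The matrix of `X^k (X∂_X + B)` in the basis `X^(kj) D^j v` if `v` is a cyclic vector. -/
def cyclicMatrix {r : ℕ} (k : ℤ) (a : Fin r → LS K) : Matrix (Fin r) (Fin r) (LS K) :=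
  Matrix.of fun i j => (if (i : ℕ) = j + 1 then 1 else 0)
    + (if i = j then ((k * (j : ℕ) : ℤ) : LS K) * x K k else 0)
    + (if (j : ℕ) + 1 = r then x K (k * (r - (i : ℕ))) * a i else 0)

lemma IsCyclic.isSub {B : Matrix ι ι (LS K)} {v : ι → LS K} {r : ℕ} {a : Fin r → LS K}
    (h : IsCyclic B v r a) (k : ℤ) :
    IsSub B (x K (-k) • cyclicMatrix k a)
      (Matrix.of fun i (j : Fin r) => (x K (k * (j : ℕ)) • (conn B ^ (j : ℕ)) v) i) := by
  set u : ℕ → ι → LS K := fun j => (conn B ^ j) v with hu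
  have hsucc : ∀ j, conn B (u j) = u (j + 1) := fun j => by
    rw [hu]; simp only [pow_succ', Module.End.mul_apply]
  refine ⟨fun j => ?_, ?_⟩
  · rw [mulVec_eq_sum_smul]
    change conn B (x K (k * (j : ℕ)) • u j) = ∑ i : Fin r, (x K (-k) • cyclicMatrix k a) i j •
      (x K (k * (i : ℕ)) • u i)
    -- The three terms are the next basis vector, the derivative of the factor `X^(kj)`, and the
    -- cyclic relation, which is present only in the last column.
    have hC : ∀ i, (x K (-k) • cyclicMatrix k a) i j • (x K (k * (i : ℕ)) • u i) =
        (if (i : ℕ) = j + 1 then x K (k * (j : ℕ)) • u (j + 1) else 0)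
        + (if i = j then (((k * (j : ℕ) : ℤ) : LS K) * x K (k * (j : ℕ))) • u j else 0)
        + (if (j : ℕ) + 1 = r then x K (k * (j : ℕ)) • (a i • u i) else 0) := by
      intro i
      rw [Matrix.smul_apply, cyclicMatrix, Matrix.of_apply, smul_smul, smul_eq_mul, mul_add,
        mul_add, add_mul, add_mul, add_smul, add_smul]
      congr 1
      · congr 1
        · split_ifs with h1
          · rw [h1, mul_one, x_mul_x]
            congr 2
            push_cast; ring
          · simp
        · split_ifs with h1
          · subst h1
            congr 1
            have h2 := x_neg_mul_x (K := K) k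
            linear_combination (((k * (i : ℕ) : ℤ) : LS K) * x K (k * (i : ℕ))) * h2
          · simp
      · split_ifs with h1
        · rw [smul_smul]
          congr 1
          have h2 : x K (-k) * x K (k * (r - (i : ℕ))) * x K (k * (i : ℕ)) = x K (k * (j : ℕ)) := by
            have h3 : (r : ℤ) = (j : ℕ) + 1 := by exact_mod_cast h1.symm
            rw [x_mul_x, x_mul_x, h3]
            congr 1
            ring
          linear_combination a i * h2
        · simp
    rw [Finset.sum_congr rfl fun i _ => hC i, Finset.sum_add_distrib, Finset.sum_add_distrib,
      conn_smul, d_x, hsucc, Finset.sum_ite_eq' Finset.univ j, if_pos (Finset.mem_univ _)]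
    by_cases h1 : (j : ℕ) + 1 = r
    · have h2 : ∀ i : Fin r, ¬ (i : ℕ) = j + 1 := fun i => by lia
      simp only [h2, if_pos h1, if_false, Finset.sum_const_zero, zero_add]
      rw [← Finset.smul_sum, ← h.rel, h1]
    · have h2 : ∀ i : Fin r, ((i : ℕ) = j + 1) ↔ i = ⟨j + 1, by lia⟩ := fun i => by
        rw [Fin.ext_iff]
      simp only [h2, h1, if_false, Finset.sum_const_zero, add_zero]
      rw [Finset.sum_ite_eq' Finset.univ, if_pos (Finset.mem_univ _), add_comm]
  · rw [exists_left_inverse_iff]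
    exact h.indep.units_smul fun j => Units.mk0 (x K (k * (j : ℕ))) (x_ne_zero _)

end Cyclic

end

section

open Matrix LS

/-! ### Companion matrices and the largest slope of a cyclic vector. -/

section Companion

variable {K : Type} [Field K]

lemma exists_coeff_ne_zero {f : LS K} (hf : f ≠ 0) : ∃ n, f ∈ ordGE K n ∧ coeff n f ≠ 0 := by
  obtain ⟨n, hn, hn0⟩ := exists_lead_ne_zero (v := fun _ : Unit => f) (fun e => hf (congrFun e ()))
  obtain ⟨_, hn0⟩ := Function.ne_iff.mp hn0
  exact ⟨n, hn (), hn0⟩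

/-- The companion matrix with last column `p`. -/
def compan {r : ℕ} (p : Fin r → K) : Matrix (Fin r) (Fin r) K :=
  Matrix.of fun i j => (if (i : ℕ) = j + 1 then 1 else 0) + if (j : ℕ) + 1 = r then p i else 0

lemma trace_compan {s : ℕ} (p : Fin (s + 1) → K) : (compan p).trace = p (Fin.last s) := by
  have h : ∀ i : Fin (s + 1), compan p i i = if i = Fin.last s then p i else 0 := fun i => by
    simp [compan, Fin.ext_iff]
  simp [Matrix.trace, h]

lemma exists_eigenvector_of_mem_roots {ι : Type} [Fintype ι] [DecidableEq ι] {M : Matrix ι ι K}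
    {c : K} (hc : c ∈ M.charpoly.roots) : ∃ u, u ≠ 0 ∧ M *ᵥ u = c • u := by
  have h : M.charpoly.eval c = 0 := (Polynomial.mem_roots'.mp hc).2
  rw [Matrix.eval_charpoly] at h
  obtain ⟨u, hu, h⟩ := Matrix.exists_mulVec_eq_zero_iff.mpr h
  refine ⟨u, hu, ?_⟩
  rw [sub_mulVec, sub_eq_zero] at h
  rw [← h]
  simp

lemma compan_pow_mulVec {r : ℕ} (p : Fin r → K) (hr : 0 < r) (j : ℕ) (hj : j < r) :
    (compan p ^ j) *ᵥ Pi.single ⟨0, hr⟩ 1 = Pi.single ⟨j, hj⟩ 1 := by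
  induction j with
  | zero => rw [pow_zero, one_mulVec]
  | succ j ih =>
    rw [pow_succ', ← mulVec_mulVec, ih (by lia)]
    funext i
    have : ¬ (j + 1 = r) := by lia
    simp [compan, this, Pi.single_apply, Fin.ext_iff]

/-- If all eigenvalues vanished, the matrix would be nilpotent of index at most `r`; but its `r`-th
power sends the first basis vector to `p ≠ 0`. -/
lemma exists_ne_zero_mem_roots_compan [IsAlgClosed K] {r : ℕ} {p : Fin r → K} (hp : p ≠ 0) :
    ∃ c ∈ (compan p).charpoly.roots, c ≠ 0 := by
  classical
  by_contra! h
  obtain ⟨i, _⟩ := Function.ne_iff.mp hp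
  have hr : 0 < r := i.pos
  have hX : (compan p).charpoly = Polynomial.X ^ r := by
    have hs := IsAlgClosed.splits (compan p).charpoly
    have h2 : (compan p).charpoly.roots = Multiset.replicate r 0 := by
      rw [Multiset.eq_replicate]
      refine ⟨?_, fun b hb => h b hb⟩
      rw [← hs.natDegree_eq_card_roots, charpoly_natDegree_eq_dim, Fintype.card_fin]
    rw [hs.eq_prod_roots_of_monic (charpoly_monic _), h2]
    simp
  have h1 : compan p ^ r = 0 := by
    have := aeval_self_charpoly (compan p)
    rwa [hX, map_pow, Polynomial.aeval_X] at this
  have h2 : (compan p ^ r) *ᵥ Pi.single ⟨0, hr⟩ 1 = p := by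
    obtain ⟨s, rfl⟩ := Nat.exists_eq_add_one_of_ne_zero hr.ne'
    rw [pow_succ', ← mulVec_mulVec, compan_pow_mulVec p hr s (by lia)]
    funext i
    have : ¬ (i : ℕ) = s + 1 := by lia
    simp [compan, this]
  rw [h1, zero_mulVec] at h2
  exact hp h2.symm

/-- Were `c` the only eigenvalue, the trace would be `(s + 1) c ≠ 0`, while the trace of a companion
matrix is its last entry, here zero. This is why the trace is removed before the leading matrix is
split. -/
lemma exists_mem_roots_compan_ne [IsAlgClosed K] [CharZero K] {s : ℕ} {p : Fin (s + 1) → K}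
    (hl : p (Fin.last s) = 0) {c : K} (hc : c ≠ 0) :
    ∃ c' ∈ (compan p).charpoly.roots, c' ≠ c := by
  by_contra! h
  have hs := IsAlgClosed.splits (compan p).charpoly
  have h2 : (compan p).charpoly.roots = Multiset.replicate (s + 1) c := by
    rw [Multiset.eq_replicate]
    refine ⟨?_, fun b hb => h b hb⟩
    rw [← hs.natDegree_eq_card_roots, charpoly_natDegree_eq_dim, Fintype.card_fin]
  have h3 := Matrix.trace_eq_sum_roots_charpoly (compan p)
  rw [trace_compan, hl, h2, Multiset.sum_replicate, nsmul_eq_mul] at h3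
  exact mul_ne_zero (by exact_mod_cast s.succ_ne_zero) hc h3.symm

lemma integral_cyclicMatrix {r : ℕ} {k : ℤ} (hk : 0 ≤ k) {a : Fin r → LS K}
    (ha : ∀ i : Fin r, x K (k * (r - (i : ℕ))) * a i ∈ ordGE K 0) :
    Integral (cyclicMatrix k a) := by
  intro i j
  rw [cyclicMatrix, Matrix.of_apply]
  refine Submodule.add_mem _ (Submodule.add_mem _ ?_ ?_) ?_
  · split_ifs
    · exact one_mem_ordGE
    · exact Submodule.zero_mem _
  · split_ifs
    · rw [← zsmul_eq_mul]
      exact zsmul_mem (ordGE_mono hk (x_mem_ordGE k)) _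
    · exact Submodule.zero_mem _
  · split_ifs
    · exact ha i
    · exact Submodule.zero_mem _

lemma leadMatrix_cyclicMatrix {r : ℕ} {k : ℤ} (hk : 0 < k) (a : Fin r → LS K) :
    leadMatrix (cyclicMatrix k a) =
      compan fun i : Fin r => coeff 0 (x K (k * (r - (i : ℕ))) * a i) := by
  ext i j
  simp only [leadMatrix, cyclicMatrix, compan, Matrix.map_apply, Matrix.of_apply, map_add]
  congr 1
  · have h1 : coeff 0 (if i = j then ((k * (j : ℕ) : ℤ) : LS K) * x K k else 0) = 0 := by
      split_ifs
      · rw [← zsmul_eq_mul, map_zsmul, coeff_x, if_neg hk.ne, smul_zero]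
      · simp
    rw [h1, add_zero]
    split_ifs <;> simp [coeff_one]
  · split_ifs <;> simp

variable {ι : Type} [Fintype ι]

/-- After ramification, a connection with an irregular cyclic vector is `X^(-k) A`, with `A(0)`
a companion matrix that is not nilpotent. -/
lemma exists_normal_form [CharZero K] {r : ℕ} {a : Fin r → LS K} (ha : ∃ j, a j ∉ ordGE K 0) :
    ∃ (q : ℕ+) (k : ℤ), 0 < k ∧
      Integral (cyclicMatrix k fun j : Fin r => ((q : ℕ) : K) ^ (r - j) • ram q (a j)) ∧
      ∃ p : Fin r → K, p ≠ 0 ∧ (∀ i, a i = 0 → p i = 0) ∧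
        leadMatrix (cyclicMatrix k fun j : Fin r => ((q : ℕ) : K) ^ (r - j) • ram q (a j)) =
          compan p := by
  classical
  -- If `n i` is the order of `a i`, the slopes are `-n i / (r - i)`, and `r!` clears all
  -- denominators `1 ≤ r - i ≤ r`. The integers `κ i` below are the slopes after ramification.
  let q : ℕ+ := ⟨r.factorial, r.factorial_pos⟩
  have hqpos : (0 : ℤ) < (q : ℕ) := by exact_mod_cast q.pos
  have hq : ((q : ℕ) : K) ≠ 0 := by exact_mod_cast q.ne_zero
  have hn : ∀ i, ∃ n, a i ≠ 0 → a i ∈ ordGE K n ∧ coeff n (a i) ≠ 0 := fun i => by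
    by_cases h : a i = 0
    · exact ⟨0, fun h' => absurd h h'⟩
    · exact (exists_coeff_ne_zero h).imp fun n hn _ => hn
  choose n hn using hn
  have hκ : ∀ i : Fin r, ∃ κ : ℤ, κ * (r - (i : ℕ)) = -((q : ℕ) * n i) := fun i => by
    have h1 : (r - (i : ℕ)) ∣ r.factorial := Nat.dvd_factorial (by lia) (by lia)
    obtain ⟨e, he⟩ := h1
    refine ⟨-(e * n i), ?_⟩
    have h2 : ((q : ℕ) : ℤ) = (r - (i : ℕ)) * e := by
      change ((r.factorial : ℕ) : ℤ) = _
      rw [he, Nat.cast_mul, Nat.cast_sub i.2.le]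
    rw [h2]; ring
  choose κ hκ using hκ
  obtain ⟨j, hj⟩ := ha
  have hj0 : a j ≠ 0 := fun h => hj (h ▸ Submodule.zero_mem _)
  -- Taking `k` to be the largest slope makes the last column integral, and its entry at `i₀` has a
  -- nonzero constant term.
  obtain ⟨i₀, hi₀, hmax⟩ := Finset.exists_max_image (Finset.univ.filter fun i => a i ≠ 0) κ
    ⟨j, by simp [hj0]⟩
  have hi₀' : a i₀ ≠ 0 := by simpa using hi₀
  have hpos : 0 < κ i₀ := by
    refine lt_of_lt_of_le ?_ (hmax j (by simp [hj0]))
    have hnj : n j < 0 := by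
      by_contra h
      exact hj (ordGE_mono (not_lt.mp h) (hn j hj0).1)
    have h1 : 0 < κ j * (r - (j : ℕ)) := by rw [hκ]; nlinarith
    have h2 : (0 : ℤ) ≤ r - (j : ℕ) := sub_nonneg.mpr (by exact_mod_cast j.2.le)
    exact pos_of_mul_pos_left h1 h2
  set k := κ i₀
  have hram : ∀ i, a i ≠ 0 → ((q : ℕ) : K) ^ (r - (i : ℕ)) • ram q (a i) ∈
      ordGE K ((q : ℕ) * n i) := fun i hi => Submodule.smul_mem _ _ (ram_mem_ordGE q (hn i hi).1)
  refine ⟨q, k, hpos, integral_cyclicMatrix hpos.le fun i => ?_,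
    _, ?_, ?_, leadMatrix_cyclicMatrix hpos _⟩
  · by_cases hi : a i = 0
    · rw [hi]; simp
    · refine ordGE_mono ?_ (x_mul_mem_ordGE (hram i hi))
      have h1 := hmax i (by simp [hi])
      have h2 := hκ i
      have h3 : (0 : ℤ) ≤ r - (i : ℕ) := sub_nonneg.mpr (by exact_mod_cast i.2.le)
      nlinarith
  · refine Function.ne_iff.mpr ⟨i₀, ?_⟩
    have h1 : (0 : ℤ) - k * (r - (i₀ : ℕ)) = (q : ℕ) * n i₀ := by
      have := hκ i₀; simp only [k]; lia
    simp only [coeff_x_mul, h1, map_smul, coeff_ram_mul, Pi.zero_apply]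
    exact smul_ne_zero (pow_ne_zero _ hq) (hn i₀ hi₀').2
  · intro i hi
    simp [hi]

end Companion

/-! ### Regular connections -/

section Regular

variable {K : Type} [Field K] {ι : Type} [Fintype ι]

lemma exists_seq_of_forall {α : Type*} {P : ℕ → α → Prop} {R : ℕ → α → α → Prop}
    (h0 : ∃ a, P 0 a) (h : ∀ n a, P n a → ∃ b, P (n + 1) b ∧ R n a b) :
    ∃ u : ℕ → α, ∀ n, P n (u n) ∧ R n (u n) (u (n + 1)) := by
  obtain ⟨a, ha⟩ := h0
  choose! f hf using h
  let u : ℕ → α := fun n => Nat.rec a (fun n b => f n b) n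
  have hu : ∀ n, P n (u n) := by
    intro n
    induction n with
    | zero => exact ha
    | succ n ih => exact (hf n _ ih).1
  exact ⟨u, fun n => ⟨hu n, (hf n _ (hu n)).2⟩⟩

lemma conn_mem_lat {A : Matrix ι ι (LS K)} (hA : Integral A) {m : ℤ} {v : ι → LS K}
    (hv : v ∈ lat ι m) : conn A v ∈ lat ι m := fun a =>
  (ordGE K m).add_mem (d_mem_ordGE (hv a)) (mulVec_mem_lat hA hv a)

lemma lead_mulVec {A : Matrix ι ι (LS K)} (hA : Integral A) {m : ℤ} {v : ι → LS K}
    (hv : v ∈ lat ι m) : lead m (A *ᵥ v) = leadMatrix A *ᵥ lead m v := by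
  funext a
  simp only [mulVec, dotProduct, map_sum, leadMatrix, map_apply, lead]
  refine Finset.sum_congr rfl fun b _ => ?_
  have := coeff_mul_of_mem_ordGE (hA a b) (hv b)
  rwa [zero_add] at this

lemma lead_conn {A : Matrix ι ι (LS K)} (hA : Integral A) {m : ℤ} {v : ι → LS K}
    (hv : v ∈ lat ι m) : lead m (conn A v) = (m : K) • lead m v + leadMatrix A *ᵥ lead m v := by
  rw [← lead_mulVec hA hv]
  funext a
  simp only [lead, conn_apply, map_add, coeff_d, Pi.add_apply, Pi.smul_apply, smul_eq_mul]

/-- A connection with a simple pole has an eigenvector with constant eigenvalue. -/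
lemma exists_eigenvector_of_integral [CharZero K] [IsAlgClosed K] [Nonempty ι]
    {A : Matrix ι ι (LS K)} (hA : Integral A) :
    ∃ (g : K) (v : ι → LS K), v ≠ 0 ∧ conn A v = algebraMap K (LS K) g • v := by
  classical
  obtain ⟨c, hc⟩ := IsAlgClosed.exists_root (leadMatrix A).charpoly (by
    rw [charpoly_degree_eq_dim]; exact_mod_cast Fintype.card_ne_zero)
  have hmem : ∀ b, b ∈ (leadMatrix A).charpoly.roots ↔ (leadMatrix A).charpoly.IsRoot b :=
    fun b => Polynomial.mem_roots (charpoly_monic _).ne_zero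
  -- Resonances are avoided by moving down from a root `c` by the largest integer `n₀` for which `c
  -- - n₀` is still a root; then `g = c - n₀` has no root of the form `g - j`, `j > 0`, below it.
  let T : Set ℕ := {n | c - (n : K) ∈ (leadMatrix A).charpoly.roots}
  have hT : T.Finite := by
    refine Set.Finite.of_finite_image (f := fun n : ℕ => c - (n : K)) ?_ ?_
    · refine ((leadMatrix A).charpoly.roots.toFinset.finite_toSet).subset ?_
      rintro _ ⟨n, hn, rfl⟩
      exact Multiset.mem_toFinset.mpr hn
    · intro m _ n _ h
      simpa using h
  obtain ⟨n₀, hn₀, hmax⟩ := Set.exists_max_image T id hT ⟨0, by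
    change c - ((0 : ℕ) : K) ∈ (leadMatrix A).charpoly.roots
    rw [Nat.cast_zero, sub_zero, hmem]; exact hc⟩
  obtain ⟨g, hg⟩ : ∃ g, g = c - (n₀ : K) := ⟨_, rfl⟩
  have hgj : ∀ j : ℕ, 0 < j → g - (j : K) ∉ (leadMatrix A).charpoly.roots := by
    intro j hj h
    have h1 : n₀ + j ∈ T := by
      change c - ((n₀ + j : ℕ) : K) ∈ (leadMatrix A).charpoly.roots
      rwa [Nat.cast_add, ← sub_sub, ← hg]
    have := hmax _ h1
    simp only [id] at this
    lia
  obtain ⟨u, hu, hug⟩ := exists_eigenvector_of_mem_roots hn₀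
  rw [← hg] at hug
  obtain ⟨G, hG⟩ : ∃ G, G = algebraMap K (LS K) g := ⟨_, rfl⟩
  have hG0 : G ∈ ordGE K 0 := hG ▸ algebraMap_mem_ordGE g
  let E : (ι → LS K) → (ι → LS K) := fun v => conn A v - G • v
  have hEsub : ∀ v w, E (v - w) = E v - E w := fun v w => by
    simp only [E, map_sub, smul_sub]; abel
  have hElat : ∀ {m : ℤ} {v : ι → LS K}, v ∈ lat ι m → E v ∈ lat ι m := fun {m v} hv =>
    Submodule.sub_mem _ (conn_mem_lat hA hv) (by
      have := smul_mem_lat hG0 hv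
      rwa [zero_add] at this)
  have hElead : ∀ {m : ℤ} {v : ι → LS K}, v ∈ lat ι m →
      lead m (E v) = (leadMatrix A - Matrix.scalar ι (g - (m : K))) *ᵥ lead m v := by
    intro m v hv
    have h1 : lead m (G • v) = g • lead m v := by
      funext a; simp [lead, hG, ← Algebra.smul_def]
    have h2 : lead m (E v) = lead m (conn A v) - lead m (G • v) := by
      funext a; simp [lead, E]
    rw [h2, h1, lead_conn hA hv, sub_mulVec]
    have h3 : Matrix.scalar ι (g - (m : K)) *ᵥ lead m v = (g - (m : K)) • lead m v := by simp
    rw [h3, sub_smul]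
    abel
  -- The eigenvector is built degree by degree with fixed leading term `u`. Correcting degree `m +
  -- 1` requires inverting `A(0) - (g - (m + 1))`, which the choice of `g` allows.
  obtain ⟨s, hs⟩ := exists_seq_of_forall
    (P := fun m (v : ι → LS K) => v ∈ lat ι 0 ∧ lead 0 v = u ∧ E v ∈ lat ι (m + 1))
    (R := fun m v w => w - v ∈ lat ι (m + 1)) (by
      refine ⟨fun a => algebraMap K (LS K) (u a), fun a => algebraMap_mem_ordGE _, ?_, ?_⟩
      · funext a; simp [lead, Algebra.algebraMap_eq_smul_one, coeff_one]
      · have h0 : (fun a => algebraMap K (LS K) (u a)) ∈ lat (K := K) ι 0 :=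
          fun a => algebraMap_mem_ordGE _
        have hl : lead 0 (fun a => algebraMap K (LS K) (u a)) = u := by
          funext a; simp [lead, Algebra.algebraMap_eq_smul_one, coeff_one]
        refine mem_lat_succ (m := ((0 : ℕ) : ℤ)) (hElat (by simpa using h0)) ?_
        rw [hElead (by simpa using h0)]
        simp only [Nat.cast_zero, Int.cast_zero, sub_zero]
        rw [hl, sub_mulVec, hug]
        simp) (by
      rintro m v ⟨hv, hl, hE⟩
      have hdet : IsUnit (leadMatrix A - Matrix.scalar ι (g - ((m + 1 : ℕ) : K))).det := by
        rw [isUnit_iff_ne_zero]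
        have h1 := mt (hmem _).mpr (hgj (m + 1) (by lia))
        rw [Polynomial.IsRoot, Matrix.eval_charpoly] at h1
        rw [← neg_sub, Matrix.det_neg]
        exact mul_ne_zero (pow_ne_zero _ (by simp)) h1
      set M := leadMatrix A - Matrix.scalar ι (g - ((m + 1 : ℕ) : K))
      let y : ι → K := M⁻¹ *ᵥ lead (m + 1) (E v)
      let w : ι → LS K := fun a => y a • x K (m + 1)
      have hw : w ∈ lat ι ((m : ℤ) + 1) := fun a => Submodule.smul_mem _ _ (x_mem_ordGE _)
      have hwl : lead ((m : ℤ) + 1) w = y := by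
        funext a; simp [lead, w, coeff_x]
      refine ⟨v - w, ⟨Submodule.sub_mem _ hv (lat_mono (by lia) hw), ?_, ?_⟩, ?_⟩
      · rw [← hl]
        funext a
        simp only [lead, Pi.sub_apply, map_sub]
        rw [hw a 0 (by lia), sub_zero]
      · have h1 : E (v - w) ∈ lat ι ((m : ℤ) + 1) := by
          rw [hEsub]
          exact Submodule.sub_mem _ hE (hElat hw)
        rw [Nat.cast_add, Nat.cast_one]
        refine mem_lat_succ h1 ?_
        have h2 : lead ((m : ℤ) + 1) (E (v - w)) =
            lead ((m : ℤ) + 1) (E v) - lead ((m : ℤ) + 1) (E w) := by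
          rw [hEsub]
          funext a
          simp only [lead, Pi.sub_apply, map_sub]
        have h3 : leadMatrix A - Matrix.scalar ι (g - (((m : ℤ) + 1 : ℤ) : K)) = M := by
          simp only [M]; push_cast; rfl
        rw [h2, hElead hw, hwl, h3, mulVec_mulVec, mul_nonsing_inv _ hdet, one_mulVec, sub_self]
      · rw [sub_sub_cancel_left]
        exact Submodule.neg_mem _ hw)
  obtain ⟨v, -, hv⟩ := exists_limit s (hs 0).1.1 fun m =>
    lat_mono (by lia) (hs m).2
  refine ⟨g, v, ?_, ?_⟩
  · rintro rfl
    have h1 := lead_eq_zero (m := 0) (hv 1)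
    apply hu
    rw [← (hs 1).1.2.1]
    funext a
    have := congrFun h1 a
    simpa [lead] using this
  · rw [← sub_eq_zero, ← hG]
    refine eq_zero_of_forall_mem_lat_nat fun m => ?_
    have h1 : E v = E (v - s m) + E (s m) := by rw [hEsub]; abel
    change E v ∈ _
    rw [h1]
    exact Submodule.add_mem _ (hElat (hv m)) (lat_mono (by lia) (hs m).1.2.2)

end Regular

end

section

open Matrix LS

/-! ### Twists by rank one connections -/

section Twist

variable {K : Type} [Field K] {ι : Type} [Fintype ι]

/-- The span of `v, Dv, …, D^(j-1)v`, where `D = X∂_X + B`. -/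
def krylov (B : Matrix ι ι (LS K)) (v : ι → LS K) (j : ℕ) : Submodule (LS K) (ι → LS K) :=
  Submodule.span (LS K) (Set.range fun i : Fin j => (conn B ^ (i : ℕ)) v)

lemma conn_pow_mem_krylov (B : Matrix ι ι (LS K)) (v : ι → LS K) {i j : ℕ} (h : i < j) :
    (conn B ^ i) v ∈ krylov B v j := Submodule.subset_span ⟨⟨i, h⟩, rfl⟩

lemma krylov_mono (B : Matrix ι ι (LS K)) (v : ι → LS K) {i j : ℕ} (h : i ≤ j) :
    krylov B v i ≤ krylov B v j := by
  rw [krylov, Submodule.span_le]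
  rintro _ ⟨k, rfl⟩
  exact conn_pow_mem_krylov B v (k.2.trans_le h)

lemma conn_mem_krylov (B : Matrix ι ι (LS K)) (v : ι → LS K) {j : ℕ} {w : ι → LS K}
    (hw : w ∈ krylov B v j) : conn B w ∈ krylov B v (j + 1) := by
  induction hw using Submodule.span_induction with
  | mem w h =>
    obtain ⟨i, rfl⟩ := h
    have := conn_pow_mem_krylov B v (i := i + 1) (j := j + 1) (by lia)
    rwa [pow_succ', Module.End.mul_apply] at this
  | zero => rw [map_zero]; exact Submodule.zero_mem _
  | add w w' _ _ h h' => rw [map_add]; exact Submodule.add_mem _ h h'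
  | smul f w hw h =>
    rw [conn_smul]
    exact Submodule.add_mem _ (Submodule.smul_mem _ _ (krylov_mono B v j.le_succ hw))
      (Submodule.smul_mem _ _ h)

variable [DecidableEq ι]

lemma conn_add_smul_one (B : Matrix ι ι (LS K)) (f : LS K) (v : ι → LS K) :
    conn (B + f • 1) v = conn B v + f • v := by
  funext a
  simp [conn_apply, add_mulVec, smul_mulVec, add_assoc]

/-- In `(D + f)^(j+1)` the derivatives of `f` affect only the terms below `D^j`, so the subleading
coefficient is the binomial one. This is the input of a Tschirnhaus transformation for cyclic
vectors. -/
lemma conn_twist_pow_succ (B : Matrix ι ι (LS K)) (f : LS K) (v : ι → LS K) (j : ℕ) :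
    (conn (B + f • 1) ^ (j + 1)) v - (conn B ^ (j + 1)) v - (((j + 1 : ℕ) : LS K) * f) •
      (conn B ^ j) v ∈ krylov B v j := by
  induction j with
  | zero => simp [conn_add_smul_one]
  | succ j ih =>
    set τ := (conn (B + f • 1) ^ (j + 1)) v - (conn B ^ (j + 1)) v - (((j + 1 : ℕ) : LS K) * f) •
      (conn B ^ j) v with hτ
    have h1 : (conn (B + f • 1) ^ (j + 1)) v =
        (conn B ^ (j + 1)) v + (((j + 1 : ℕ) : LS K) * f) • (conn B ^ j) v + τ := by
      rw [hτ]; abel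
    have h2 : (conn (B + f • 1) ^ (j + 1 + 1)) v - (conn B ^ (j + 1 + 1)) v -
        (((j + 1 + 1 : ℕ) : LS K) * f) • (conn B ^ (j + 1)) v =
        (((j + 1 : ℕ) : LS K) * (d f + f * f)) • (conn B ^ j) v + (conn B τ + f • τ) := by
      rw [pow_succ' (conn (B + f • 1)), Module.End.mul_apply, h1, conn_add_smul_one, map_add,
        map_add, conn_smul, pow_succ' (conn B) (j + 1), Module.End.mul_apply, pow_succ' (conn B) j,
        Module.End.mul_apply, d_mul, d_natCast]
      push_cast
      module
    rw [h2]
    exact Submodule.add_mem _ (Submodule.smul_mem _ _ (conn_pow_mem_krylov B v j.lt_succ_self))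
      (Submodule.add_mem _ (conn_mem_krylov B v ih)
        (Submodule.smul_mem _ _ (krylov_mono B v j.le_succ ih)))

lemma krylov_twist_le (B : Matrix ι ι (LS K)) (f : LS K) (v : ι → LS K) (j : ℕ) :
    krylov (B + f • 1) v j ≤ krylov B v j := by
  rw [krylov, Submodule.span_le]
  rintro _ ⟨⟨i, hi⟩, rfl⟩
  refine krylov_mono B v (Nat.succ_le_of_lt hi) ?_
  cases i with
  | zero => exact conn_pow_mem_krylov B v Nat.one_pos
  | succ i =>
    have h0 := conn_twist_pow_succ B f v i
    have h1 := krylov_mono B v (i.le_succ.trans (i + 1).le_succ) h0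
    have h2 : (conn B ^ (i + 1)) v ∈ krylov B v (i + 1 + 1) := conn_pow_mem_krylov B v (i + 1).lt_succ_self
    have h3 : (conn B ^ i) v ∈ krylov B v (i + 1 + 1) :=
      conn_pow_mem_krylov B v (i.lt_succ_self.trans (i + 1).lt_succ_self)
    have h4 := Submodule.add_mem _ (Submodule.add_mem _ h1
      (Submodule.smul_mem _ (((i + 1 : ℕ) : LS K) * f) h3)) h2
    rwa [sub_add_cancel, sub_add_cancel] at h4

lemma krylov_twist (B : Matrix ι ι (LS K)) (f : LS K) (v : ι → LS K) (j : ℕ) :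
    krylov (B + f • 1) v j = krylov B v j := by
  refine le_antisymm (krylov_twist_le B f v j) ?_
  have := krylov_twist_le (B + f • 1) (-f) v j
  rwa [neg_smul, add_neg_cancel_right] at this

/-- The trace of a cyclic connection can be removed by a twist. -/
lemma IsCyclic.exists_twist [CharZero K] {B : Matrix ι ι (LS K)} {v : ι → LS K} {s : ℕ}
    {a : Fin (s + 1) → LS K} (h : IsCyclic B v (s + 1) a) :
    ∃ (f : LS K) (a' : Fin (s + 1) → LS K),
      IsCyclic (B + f • 1) v (s + 1) a' ∧ a' (Fin.last s) = 0 := by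
  have hs : ((s + 1 : ℕ) : LS K) ≠ 0 := by
    rw [← map_natCast (algebraMap K (LS K)), map_ne_zero]
    exact_mod_cast s.succ_ne_zero
  -- The twist adds `(s + 1) f` to the coefficient of `D^s` when `(D + f)^(s+1) v` is expanded in
  -- powers of `D`; this value makes that coefficient vanish. The span of the lower iterates is the
  -- same before and after the twist, so the new relation has last coefficient zero.
  set f : LS K := -(a (Fin.last s)) / ((s + 1 : ℕ) : LS K) with hf
  have hf' : ((s + 1 : ℕ) : LS K) * f = -a (Fin.last s) := by rw [hf]; field_simp
  have hmem : (conn (B + f • 1) ^ (s + 1)) v ∈ krylov (B + f • 1) v s := by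
    rw [krylov_twist]
    have h1 := conn_twist_pow_succ B f v s
    have h2 : (conn B ^ (s + 1)) v - a (Fin.last s) • (conn B ^ s) v ∈ krylov B v s := by
      rw [h.rel, Fin.sum_univ_castSucc]
      simp only [Fin.val_last, add_sub_cancel_right]
      exact Submodule.sum_mem _ fun i _ => Submodule.smul_mem _ _
        (conn_pow_mem_krylov B v i.2)
    have h3 := Submodule.add_mem _ h1 h2
    rw [hf'] at h3
    convert! h3 using 1
    module
  obtain ⟨a', ha'⟩ := (Submodule.mem_span_range_iff_exists_fun _).mp hmem
  refine ⟨f, Fin.snoc a' 0, ⟨?_, ?_⟩, Fin.snoc_last _ _⟩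
  · rw [linearIndependent_iff_card_eq_finrank_span, Set.finrank]
    have h1 := linearIndependent_iff_card_eq_finrank_span.mp h.indep
    rw [Set.finrank] at h1
    have h2 := krylov_twist B f v (s + 1)
    rw [krylov, krylov] at h2
    rw [h2]
    exact h1
  · rw [Fin.sum_univ_castSucc]
    simp [← ha']

end Twist

/-! ### Existence of eigenvectors after ramification -/

section Eigenvector

variable {K : Type} [Field K] {ι κ : Type} [Fintype ι] [Fintype κ]

/-- After a ramification, the connection `X∂_X + B` has a subconnection of rank one. -/
def HasEigenvector (B : Matrix ι ι (LS K)) : Prop :=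
  ∃ (q : ℕ+) (h : LS K) (v : ι → LS K), v ≠ 0 ∧ conn (ramM q B) v = h • v

lemma HasEigenvector.of_isSub [DecidableEq κ] {B : Matrix ι ι (LS K)} {C : Matrix κ κ (LS K)}
    {G : Matrix ι κ (LS K)} (hG : IsSub B C G) (h : HasEigenvector C) : HasEigenvector B := by
  obtain ⟨q, h, v, hv, hh⟩ := h
  exact ⟨q, h, _, (hG.ram q).mulVec_ne_zero hv, by rw [(hG.ram q).conn_mulVec, hh, mulVec_smul]⟩

lemma HasEigenvector.of_ramM {B : Matrix ι ι (LS K)} (q : ℕ+) (h : HasEigenvector (ramM q B)) :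
    HasEigenvector B := by
  obtain ⟨q', h, v, hv, hh⟩ := h
  exact ⟨q * q', h, v, hv, by rw [← ramM_ramM, hh]⟩

lemma HasEigenvector.of_twist [DecidableEq ι] {B : Matrix ι ι (LS K)} (f : LS K)
    (h : HasEigenvector (B + f • 1)) : HasEigenvector B := by
  obtain ⟨q, h, v, hv, hh⟩ := h
  have h1 : ramM q (B + f • 1) = ramM q B + (((q : ℕ) : K) • ram q f) • (1 : Matrix ι ι (LS K)) := by
    ext1 a b
    simp only [ramM, Matrix.smul_apply, map_apply, Matrix.add_apply, map_add, smul_add, smul_eq_mul,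
      map_mul, Matrix.one_apply]
    split_ifs <;> simp
  refine ⟨q, h - ((q : ℕ) : K) • ram q f, v, hv, ?_⟩
  rw [h1, conn_add_smul_one] at hh
  rw [sub_smul, ← hh, add_sub_cancel_right]

/-- Strong induction on the rank. Pass to the subconnection of a cyclic vector and remove its trace
by a twist. If it is regular, the matrix has a simple pole and a power series solution exists. If
not, a ramification brings it to a companion leading matrix with a nonzero eigenvalue; zero trace
provides a second one, so a generalized eigenspace is a nonzero subconnection of smaller rank. -/
theorem hasEigenvector [CharZero K] [IsAlgClosed K] {n : ℕ} (hn : 0 < n)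
    (B : Matrix (Fin n) (Fin n) (LS K)) : HasEigenvector B := by
  classical
  induction n using Nat.strong_induction_on with
  | _ n ih =>
  obtain ⟨r, hr, hrn, a, ha⟩ := exists_isCyclic B (v := Pi.single ⟨0, hn⟩ 1) (by simp)
  rw [Fintype.card_fin] at hrn
  obtain ⟨s, rfl⟩ := Nat.exists_eq_add_one_of_ne_zero hr.ne'
  obtain ⟨f, a', ha', hlast⟩ := ha.exists_twist
  refine .of_twist f ?_
  by_cases hint : ∀ j, a' j ∈ ordGE K 0
  · refine .of_isSub (ha'.isSub 0) ?_
    rw [neg_zero, x_zero, one_smul]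
    obtain ⟨g, v, hv, h⟩ := exists_eigenvector_of_integral
      (integral_cyclicMatrix (k := 0) le_rfl (a := a') fun i => by
        rw [zero_mul, x_zero, one_mul]; exact hint i)
    refine .of_ramM 1 ⟨1, algebraMap K (LS K) g, v, hv, ?_⟩
    have h1 : ∀ B : Matrix (Fin (s + 1)) (Fin (s + 1)) (LS K), ramM 1 B = B := fun B => by
      ext a b n
      have := coeff_ram_mul 1 (B a b) n
      simpa [ramM] using this
    rw [h1, h1, h]
  · push Not at hint
    obtain ⟨q, k, hk, hint, p, hp, hp0, hlead⟩ := exists_normal_form hint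
    obtain ⟨c, hc, hc0⟩ := exists_ne_zero_mem_roots_compan hp
    obtain ⟨c', hc', hcc'⟩ := exists_mem_roots_compan_ne (hp0 _ hlast) hc0
    rw [← hlead] at hc hc'
    obtain ⟨u, hu, hcu⟩ := exists_eigenvector_of_mem_roots hc
    obtain ⟨u', hu', hcu'⟩ := exists_eigenvector_of_mem_roots hc'
    have hb := genEig_ne_bot hk hint hu hcu
    have hb' := genEig_ne_bot hk hint hu' hcu'
    have hdisj := (iSupIndep_genEig hk hint).pairwiseDisjoint hcc'
    have htop : genEig hk hint c ≠ ⊤ := fun h => by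
      rw [Function.onFun, h, disjoint_top] at hdisj
      exact hb' hdisj
    have hlt : Module.finrank (LS K) (genEig hk hint c) < s + 1 := by
      have := Submodule.finrank_lt htop
      simpa using this
    have hpos : 0 < Module.finrank (LS K) (genEig hk hint c) := by
      rw [Nat.pos_iff_ne_zero, Ne, Submodule.finrank_eq_zero]
      exact hb
    obtain ⟨C, G, hG, -⟩ := exists_isSub_of_stable _ (genEig hk hint c)
      fun v hv => conn_mem_genEig hk hint hv
    exact .of_ramM q (.of_isSub ((ha'.ram q).isSub k) (.of_isSub hG (ih _ (by lia) hpos C)))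

/-- A connection with an irregular cyclic vector has, after ramification, an eigenvector
with irregular eigenvalue. -/
theorem IsCyclic.exists_irregular_eigenvector [CharZero K] [IsAlgClosed K]
    {B : Matrix ι ι (LS K)} {v : ι → LS K} {r : ℕ} {a : Fin r → LS K} (ha : IsCyclic B v r a)
    (hirr : ∃ j, a j ∉ ordGE K 0) :
    ∃ (q : ℕ+) (h : LS K) (u : ι → LS K), u ≠ 0 ∧ conn (ramM q B) u = h • u ∧ h ∉ ordGE K 0 ∧
      u ∈ Submodule.span (LS K) (Set.range fun j : Fin r => ramV q ((conn B ^ (j : ℕ)) v)) := by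
  classical
  obtain ⟨q, k, hk, hint, p, hp, -, hlead⟩ := exists_normal_form hirr
  obtain ⟨c, hc, hc0⟩ := exists_ne_zero_mem_roots_compan hp
  rw [← hlead] at hc
  obtain ⟨u, hu, hcu⟩ := exists_eigenvector_of_mem_roots hc
  have hb := genEig_ne_bot hk hint hu hcu
  have hpos : 0 < Module.finrank (LS K) (genEig hk hint c) := by
    rw [Nat.pos_iff_ne_zero, Ne, Submodule.finrank_eq_zero]
    exact hb
  obtain ⟨C, G, hG, hGmem⟩ := exists_isSub_of_stable _ (genEig hk hint c)
    fun v hv => conn_mem_genEig hk hint hv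
  -- The eigenvector is sought inside the summand of `c ≠ 0`: there, after the ramification `q'`,
  -- any eigenvalue has leading term `q' c X^(-q'k)` and is therefore irregular.
  obtain ⟨q', h, y, hy, hh⟩ := hasEigenvector hpos C
  have hsub := ((ha.ram q).isSub k).ram q'
  have hGq := hG.ram q'
  have hqk : 0 < ((q' : ℕ) : ℤ) * k := mul_pos (by exact_mod_cast q'.pos) hk
  set y' := G.map (LS.ram q') *ᵥ y with hy'
  have hy'0 : y' ≠ 0 := hGq.mulVec_ne_zero hy
  have hy'h := hGq.conn_mulVec y
  rw [hh, mulVec_smul, ← hy'] at hy'h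
  have hy'mem : y' ∈ genEig hqk (integral_ramM q' hint) ((q' : ℕ) * c) := by
    rw [hy', mulVec_eq_sum_smul]
    exact Submodule.sum_mem _ fun j _ => Submodule.smul_mem _ _
      (ramV_mem_genEig q' hk hint hqk (hGmem j))
  refine ⟨q * q', h, _, hsub.mulVec_ne_zero hy'0, ?_, ?_, ?_⟩
  · rw [← ramM_ramM, hsub.conn_mulVec, hy'h, mulVec_smul]
  · intro hmem
    rw [ramM_smul_x] at hy'h
    have h1 := (eigenvalue_of_mem_genEig hqk _ hy'mem hy'0 hy'h).2
    rw [hmem _ (by lia)] at h1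
    exact mul_ne_zero (by exact_mod_cast q'.ne_zero) hc0 h1.symm
  · rw [mulVec_eq_sum_smul]
    refine Submodule.sum_mem _ fun j _ => Submodule.smul_mem _ _ ?_
    change ramV q' (x K (k * (j : ℕ)) • (conn (ramM q B) ^ (j : ℕ)) (ramV q v)) ∈ _
    rw [conn_pow_ramM, ramV_smul, ramV_smul_scalar, ramV_ramV]
    refine Submodule.smul_mem _ _ (Submodule.smul_of_tower_mem _ _ (Submodule.subset_span ⟨j, rfl⟩))

end Eigenvector

end

/-! ### Germs of holomorphic functions, and the derivation `z(t∂_t - q z∂_z)` -/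

section Germs

lemma coeff_coe_natCast (g : ℂ⟦X⟧⟦X⟧) (i : ℕ) :
    (HahnSeries.ofPowerSeries ℤ ℂ⟦X⟧ g).coeff (i : ℤ) = PowerSeries.coeff i g :=
  HahnSeries.ofPowerSeries_apply_coeff g i

lemma mem_Germs_iff {f : Amb} : f ∈ Germs ↔ (∀ n < 0, f.coeff n = 0) ∧ ∃ c ρ : ℝ, 0 ≤ ρ ∧
    ∀ i j : ℕ, ‖PowerSeries.coeff j (f.coeff i)‖ ≤ c * ρ ^ (i + j) := by
  constructor
  · rintro ⟨g, ⟨c, ρ, hρ, h⟩, rfl⟩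
    refine ⟨fun n hn => ?_, c, ρ, hρ, fun i j => ?_⟩
    · have := PowerSeries.coeff_coe g n
      rwa [if_pos hn] at this
    · rw [coeff_coe_natCast]; exact h i j
  · rintro ⟨h0, c, ρ, hρ, h⟩
    refine ⟨PowerSeries.mk fun n => f.coeff n, ⟨c, ρ, hρ, fun i j => ?_⟩, ?_⟩
    · rw [PowerSeries.coeff_mk]; exact h i j
    · ext1
      funext n
      have := PowerSeries.coeff_coe (PowerSeries.mk fun n => f.coeff (n : ℤ)) n
      refine this.trans ?_
      split_ifs with hn
      · exact (h0 n hn).symm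
      · rw [PowerSeries.coeff_mk, Int.natAbs_of_nonneg (not_lt.mp hn)]

lemma C_C_mem_Germs (a : ℂ) : (HahnSeries.C (PowerSeries.C a) : Amb) ∈ Germs :=
  ⟨PowerSeries.C (PowerSeries.C a), IsConvergent.C, by simp⟩

lemma C_X_mem_Germs : (HahnSeries.C (PowerSeries.X : ℂ⟦X⟧) : Amb) ∈ Germs := by
  refine ⟨PowerSeries.C PowerSeries.X, ⟨1, 1, zero_le_one, fun i j => ?_⟩, by simp⟩
  rw [PowerSeries.coeff_C]
  split_ifs
  · rw [PowerSeries.coeff_X]; split_ifs <;> simp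
  · simp

lemma C_zvar_mem_Germs (zo : ℂ) : (HahnSeries.C (zvar zo) : Amb) ∈ Germs := by
  rw [zvar, map_add]
  exact Germs.add_mem (C_C_mem_Germs _) C_X_mem_Germs

lemma single_mem_Germs (n : ℕ) : (HahnSeries.single (n : ℤ) 1 : Amb) ∈ Germs := by
  rw [mem_Germs_iff]
  refine ⟨fun m hm => ?_, 1, 1, zero_le_one, fun i j => ?_⟩
  · rw [HahnSeries.coeff_single_of_ne (by lia)]
  · rw [HahnSeries.coeff_single]
    split_ifs
    · rw [PowerSeries.coeff_one]; split_ifs <;> simp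
    · simp

lemma C_star_mem_Germs (zo β : ℂ) : (HahnSeries.C (star zo β) : Amb) ∈ Germs := by
  rw [star, map_add, map_mul, map_mul, map_add, map_pow, map_one]
  exact Germs.add_mem (Germs.mul_mem (C_C_mem_Germs _) (C_zvar_mem_Germs _))
    (Germs.mul_mem (C_C_mem_Germs _)
      (Germs.add_mem (Germs.pow_mem (C_zvar_mem_Germs _) _) Germs.one_mem))

/-- The operator `z(n - q z∂_z)`, at `z = 1`. -/
def epsCoeff (q : ℕ) (n : ℤ) : ℂ⟦X⟧ →+ ℂ⟦X⟧ where
  toFun a := zvar 1 * ((n : ℂ⟦X⟧) * a - (q : ℂ⟦X⟧) * zvar 1 * PowerSeries.derivative ℂ a)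
  map_zero' := by simp
  map_add' a b := by rw [map_add]; ring

lemma epsCoeff_apply (q : ℕ) (n : ℤ) (a : ℂ⟦X⟧) : epsCoeff q n a =
    zvar 1 * ((n : ℂ⟦X⟧) * a - (q : ℂ⟦X⟧) * zvar 1 * PowerSeries.derivative ℂ a) := rfl

/-- The derivation `z(t∂_t - q z∂_z)`, at `z = 1`. -/
def eps (q : ℕ) (f : Amb) : Amb where
  coeff n := epsCoeff q n (f.coeff n)
  isPWO_support' := f.isPWO_support.mono fun n hn h => hn (by
    change epsCoeff q n (f.coeff n) = 0
    rw [h, map_zero])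

lemma coeff_eps (q : ℕ) (f : Amb) (n : ℤ) : (eps q f).coeff n = epsCoeff q n (f.coeff n) := rfl

lemma eps_mul (q : ℕ) (f g : Amb) : eps q (f * g) = eps q f * g + f * eps q g :=
  leibniz_of_coeff (epsCoeff q) (fun i j a b => by
    simp only [epsCoeff_apply, Derivation.leibniz, smul_eq_mul]
    push_cast
    ring) (coeff_eps q) f g

lemma eps_add (q : ℕ) (f g : Amb) : eps q (f + g) = eps q f + eps q g := by
  ext1; funext n; simp [coeff_eps]

lemma eps_sub (q : ℕ) (f g : Amb) : eps q (f - g) = eps q f - eps q g := by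
  ext1; funext n; simp [coeff_eps]

lemma eps_zero (q : ℕ) : eps q 0 = 0 := by
  ext1; funext n; simp [coeff_eps]

lemma eps_sum {ι : Type*} (q : ℕ) (s : Finset ι) (f : ι → Amb) :
    eps q (∑ i ∈ s, f i) = ∑ i ∈ s, eps q (f i) := by
  classical
  induction s using Finset.induction_on with
  | empty => simp [eps_zero]
  | insert a s ha ih => rw [Finset.sum_insert ha, Finset.sum_insert ha, eps_add, ih]

lemma eps_euler (q : ℕ) (f : Amb) : eps q (euler f) = euler (eps q f) := by
  ext1; funext n
  rw [coeff_eps, coeff_euler, coeff_euler, coeff_eps, epsCoeff_apply, epsCoeff_apply,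
    Derivation.leibniz, Derivation.map_intCast]
  simp only [smul_eq_mul]
  ring

lemma eps_single_C (q : ℕ) (n : ℤ) (a : ℂ) : eps q (HahnSeries.single n (PowerSeries.C a)) =
    HahnSeries.C (zvar 1) * euler (HahnSeries.single n (PowerSeries.C a)) := by
  ext1; funext m
  rw [coeff_eps, HahnSeries.C_mul_eq_smul, HahnSeries.coeff_smul, coeff_euler, epsCoeff_apply,
    HahnSeries.coeff_single]
  split_ifs <;> simp

lemma eps_single_one (q : ℕ) (n : ℤ) : eps q (HahnSeries.single n 1) =
    HahnSeries.C (zvar 1) * ((n : Amb) * HahnSeries.single n 1) := by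
  have := eps_single_C q n 1
  rw [map_one, euler_single] at this
  rw [this]
  congr 1
  ext1; funext m
  rw [← map_intCast (HahnSeries.C : ℂ⟦X⟧ →+* Amb), HahnSeries.C_mul_eq_smul,
    HahnSeries.coeff_smul, HahnSeries.coeff_single, HahnSeries.coeff_single]
  split_ifs <;> simp

lemma eps_natCast (q n : ℕ) : eps q (n : Amb) = 0 := by
  ext1; funext m
  rw [coeff_eps, epsCoeff_apply, ← map_natCast (HahnSeries.C : ℂ⟦X⟧ →+* Amb), HahnSeries.C_apply,
    HahnSeries.coeff_single]
  split_ifs with h <;> simp [h]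

lemma derivative_zvar (zo : ℂ) : PowerSeries.derivative ℂ (zvar zo) = 1 := by
  simp [zvar]

lemma eps_C_zvar (q : ℕ) : eps q (HahnSeries.C (zvar 1)) =
    -((q : Amb) * HahnSeries.C (zvar 1) * HahnSeries.C (zvar 1)) := by
  ext1; funext m
  rw [coeff_eps, epsCoeff_apply, ← map_natCast (HahnSeries.C : ℂ⟦X⟧ →+* Amb), ← map_mul, ← map_mul,
    ← map_neg, HahnSeries.C_apply, HahnSeries.C_apply, HahnSeries.coeff_single,
    HahnSeries.coeff_single]
  split_ifs with h
  · rw [derivative_zvar, h]; push_cast; ring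
  · simp

/-- A function of `t^q z` is constant along `t∂_t - q z∂_z`. This is what the pull-back by `μ`
contributes to the commutation relation. -/
lemma eps_rescaleSeries (q : ℕ) (F : ℂ⟦X⟧) :
    eps q (HahnSeries.ofPowerSeries ℤ ℂ⟦X⟧ (rescaleSeries q 1 F)) = 0 := by
  ext1; funext n
  rw [coeff_eps]
  rcases lt_or_ge n 0 with hn | hn
  · have := PowerSeries.coeff_coe (rescaleSeries q 1 F) n
    rw [if_pos hn] at this
    rw [this, map_zero]; simp
  · lift n to ℕ using hn
    rw [coeff_coe_natCast, rescaleSeries, PowerSeries.coeff_mk, HahnSeries.coeff_zero]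
    split_ifs with h
    · obtain ⟨m, rfl⟩ := h
      rcases Nat.eq_zero_or_pos q with hq | hq
      · subst hq; simp [epsCoeff_apply]
      rw [Nat.mul_div_cancel_left _ hq, epsCoeff_apply, Derivation.leibniz, PowerSeries.derivative_C,
        Derivation.leibniz_pow, derivative_zvar]
      rcases m with _ | m
      · simp
      · simp only [smul_eq_mul, Nat.add_sub_cancel, nsmul_eq_mul]
        push_cast
        ring
    · simp

/-- Differentiation multiplies coefficients by at most linear factors, which are absorbed by
doubling `ρ` in the bound. -/
lemma eps_mem_Germs (q : ℕ) {f : Amb} (hf : f ∈ Germs) : eps q f ∈ Germs := by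
  obtain ⟨h0, c, ρ, hρ, h⟩ := mem_Germs_iff.mp hf
  have hc : 0 ≤ c := by simpa using (norm_nonneg _).trans (h 0 0)
  have h1 : euler f ∈ Germs := by
    refine mem_Germs_iff.mpr ⟨fun n hn => ?_, c, 2 * ρ, by positivity, fun i j => ?_⟩
    · rw [coeff_euler, h0 n hn, mul_zero]
    · rw [coeff_euler, Int.cast_natCast, ← nsmul_eq_mul, map_nsmul, nsmul_eq_mul, norm_mul,
        Complex.norm_natCast]
      have hi : (i : ℝ) ≤ 2 ^ (i + j) := by
        exact_mod_cast (i.lt_two_pow_self.le).trans (Nat.pow_le_pow_right (by lia) (by lia))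
      calc (i : ℝ) * _ ≤ 2 ^ (i + j) * (c * ρ ^ (i + j)) := by
            gcongr
            exact h i j
        _ = _ := by rw [mul_pow]; ring
  have h2 : HahnSeries.map f (PowerSeries.derivative ℂ : ℂ⟦X⟧ →ₗ[ℂ] ℂ⟦X⟧) ∈ Germs := by
    refine mem_Germs_iff.mpr ⟨fun n hn => ?_, c * ρ, 2 * ρ, by positivity, fun i j => ?_⟩
    · rw [HahnSeries.map_coeff, h0 n hn, map_zero]
    · rw [HahnSeries.map_coeff]
      change ‖PowerSeries.coeff j (PowerSeries.derivative ℂ (f.coeff i))‖ ≤ _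
      rw [PowerSeries.coeff_derivative, norm_mul]
      have hj : ‖((j : ℂ) + 1)‖ ≤ 2 ^ (i + j) := by
        have h3 : ‖((j : ℂ) + 1)‖ = ((j + 1 : ℕ) : ℝ) := by
          rw [← Complex.norm_natCast]; push_cast; rfl
        rw [h3]
        exact_mod_cast (j.lt_two_pow_self).trans_le (Nat.pow_le_pow_right (by lia) (by lia))
      calc _ ≤ (c * ρ ^ (i + (j + 1))) * 2 ^ (i + j) := by
            gcongr
            exact h i (j + 1)
        _ = _ := by rw [mul_pow]; ring
  have h3 : eps q f = HahnSeries.C (zvar 1) * (euler f - HahnSeries.C (PowerSeries.C (q : ℂ)) *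
      HahnSeries.C (zvar 1) * HahnSeries.map f (PowerSeries.derivative ℂ : ℂ⟦X⟧ →ₗ[ℂ] ℂ⟦X⟧)) := by
    ext1; funext n
    rw [coeff_eps, epsCoeff_apply, ← map_mul, HahnSeries.C_mul_eq_smul, HahnSeries.coeff_smul,
      HahnSeries.coeff_sub, coeff_euler, HahnSeries.C_mul_eq_smul, HahnSeries.coeff_smul,
      HahnSeries.map_coeff]
    simp only [smul_eq_mul, map_natCast]
    rfl
  rw [h3]
  exact Germs.mul_mem (C_zvar_mem_Germs _) (Germs.sub_mem h1
    (Germs.mul_mem (Germs.mul_mem (C_C_mem_Germs _) (C_zvar_mem_Germs _)) h2))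

end Germs

/-! ### The operators on the rescaled module -/

section Operators

variable {d : ℕ} (A : Matrix (Fin d) (Fin d) ℂ⟦X⟧) (q : ℕ) (p : Polynomial ℂ)

lemma tDt_smul (f : Amb) (m : Fin d → Amb) :
    tDt A q p 1 (f • m) = (HahnSeries.C (zvar 1) * euler f) • m + f • tDt A q p 1 m := by
  funext a
  have h : ∀ b, HahnSeries.ofPowerSeries ℤ ℂ⟦X⟧ (rescaleSeries q 1 (A a b)) * (f * m b) =
      f * (HahnSeries.ofPowerSeries ℤ ℂ⟦X⟧ (rescaleSeries q 1 (A a b)) * m b) := fun b => by ring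
  simp only [tDt, Pi.add_apply, Pi.smul_apply, smul_eq_mul, euler_mul, h, ← Finset.mul_sum]
  ring

lemma tDt_C_smul (f : ℂ⟦X⟧) (m : Fin d → Amb) :
    tDt A q p 1 ((HahnSeries.C f : Amb) • m) = (HahnSeries.C f : Amb) • tDt A q p 1 m := by
  rw [tDt_smul, euler_C, mul_zero, zero_smul, zero_add]

lemma tDt_sub (m m' : Fin d → Amb) :
    tDt A q p 1 (m - m') = tDt A q p 1 m - tDt A q p 1 m' := by
  funext a
  simp only [tDt, Pi.sub_apply, euler_sub, mul_sub, Finset.sum_sub_distrib]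
  ring

/-- The operator `z(t∂_t - q z∂_z) - (t∂_t + q)φ`, where `φ(t) = p(1/t)`. -/
def scaling (m : Fin d → Amb) : Fin d → Amb := fun a =>
  eps q (m a) - (euler (polar ℂ⟦X⟧ p) + (q : Amb) * polar ℂ⟦X⟧ p) * m a

lemma scaling_add (m m' : Fin d → Amb) : scaling q p (m + m') = scaling q p m + scaling q p m' := by
  funext a
  simp only [scaling, Pi.add_apply, eps_add]
  ring

lemma scaling_sub (m m' : Fin d → Amb) : scaling q p (m - m') = scaling q p m - scaling q p m' := by
  funext a
  simp only [scaling, Pi.sub_apply, eps_sub]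
  ring

lemma scaling_smul (f : Amb) (m : Fin d → Amb) :
    scaling q p (f • m) = eps q f • m + f • scaling q p m := by
  funext a
  simp only [scaling, Pi.add_apply, Pi.smul_apply, smul_eq_mul, eps_mul]
  ring

lemma eps_polar : eps q (polar ℂ⟦X⟧ p) = HahnSeries.C (zvar 1) * euler (polar ℂ⟦X⟧ p) := by
  rw [polar, Polynomial.sum, eps_sum, euler_sum, Finset.mul_sum]
  exact Finset.sum_congr rfl fun j _ => eps_single_C q _ _

/-- Applied to `e^(-φ/z)`, the field `z(t∂_t - q z∂_z)` produces the factor `-(t∂_t + q)φ`, so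
`scaling` is its lift to the twisted module. It would commute with `tð_t = z · t∂_t` but for the two
factors `z`; since `t∂_t - q z∂_z` sends `z` to `-q z`, the commutator is `-q z · tð_t`. -/
lemma scaling_tDt (m : Fin d → Amb) : scaling q p (tDt A q p 1 m) =
    tDt A q p 1 (scaling q p m) - ((q : Amb) * HahnSeries.C (zvar 1)) • tDt A q p 1 m := by
  funext a
  have h1 : ∀ b, eps q (HahnSeries.ofPowerSeries ℤ ℂ⟦X⟧ (rescaleSeries q 1 (A a b)) * m b) =
      HahnSeries.ofPowerSeries ℤ ℂ⟦X⟧ (rescaleSeries q 1 (A a b)) * eps q (m b) := fun b => by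
    rw [eps_mul, eps_rescaleSeries, zero_mul, zero_add]
  set φ := polar ℂ⟦X⟧ p with hφ
  have h2 : ∀ b, HahnSeries.ofPowerSeries ℤ ℂ⟦X⟧ (rescaleSeries q 1 (A a b)) *
      (eps q (m b) - (euler φ + (q : Amb) * φ) * m b) =
      HahnSeries.ofPowerSeries ℤ ℂ⟦X⟧ (rescaleSeries q 1 (A a b)) * eps q (m b) -
      (euler φ + (q : Amb) * φ) *
        (HahnSeries.ofPowerSeries ℤ ℂ⟦X⟧ (rescaleSeries q 1 (A a b)) * m b) := fun b => by ring
  have h3 : eps q φ = HahnSeries.C (zvar 1) * euler φ := eps_polar q p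
  simp only [scaling, tDt, Pi.sub_apply, Pi.smul_apply, smul_eq_mul, eps_sub, eps_add, eps_mul,
    eps_sum, h1, h2, euler_sub, euler_mul, euler_add, Finset.sum_sub_distrib, ← Finset.mul_sum,
    eps_single_one, eps_natCast, euler_natCast, eps_C_zvar, eps_euler, ← hφ, h3]
  push_cast
  simp only [euler_C, zero_mul, zero_add]
  ring

end Operators

/-! ### Strict specializability of the rescaled module -/

section Star

lemma coeff_star (β : ℂ) : PowerSeries.coeff 2 (star 1 β) = Complex.I * β.im / 2 ∧
    PowerSeries.constantCoeff (star 1 β) = β.re + Complex.I * β.im := by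
  constructor
  · have h : star 1 β = PowerSeries.C ((β.re : ℂ) + Complex.I * β.im) +
        PowerSeries.C ((β.re : ℂ) + Complex.I * β.im) * PowerSeries.X +
        PowerSeries.C (Complex.I * β.im / 2) * PowerSeries.X ^ 2 := by
      have h2 : (PowerSeries.C (Complex.I * β.im) : ℂ⟦X⟧) =
          2 * PowerSeries.C (Complex.I * β.im / 2) := by
        rw [two_mul, ← map_add]; congr 1; ring
      rw [star, zvar, map_add, map_one, h2]
      ring
    rw [h, map_add, map_add, PowerSeries.coeff_C, PowerSeries.coeff_C_mul, PowerSeries.coeff_C_mul,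
      PowerSeries.coeff_X, PowerSeries.coeff_X_pow]
    simp
  · simp [star, zvar]
    ring

/-- The coefficient of `w²` determines the imaginary part, and then the constant term determines the
real part. Distinct roots thus differ by a nonzero germ, which strictness allows to cancel. -/
lemma star_injective : Function.Injective (star 1) := by
  intro β γ h
  have h1 := congrArg (PowerSeries.coeff 2) h
  rw [(coeff_star β).1, (coeff_star γ).1] at h1
  have h2 := congrArg PowerSeries.constantCoeff h
  rw [(coeff_star β).2, (coeff_star γ).2] at h2
  have h3 : Complex.I * β.im = Complex.I * γ.im := by linear_combination 2 * h1
  have h4 : (β.re : ℂ) = γ.re := by linear_combination h2 - h3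
  exact Complex.ext (by exact_mod_cast h4)
    (by exact_mod_cast mul_left_cancel₀ Complex.I_ne_zero h3)

end Star

/-! ### Products of Bernstein operators with disjoint roots. -/

section Bernstein

variable {d : ℕ} {A : Matrix (Fin d) (Fin d) ℂ⟦X⟧} {q : ℕ} {p : Polynomial ℂ}

/-- The product of the operators `tð_t - β ⋆ z`, for `β` in a list. -/
def bern (A : Matrix (Fin d) (Fin d) ℂ⟦X⟧) (q : ℕ) (p : Polynomial ℂ) (B : List ℂ)
    (m : Fin d → Amb) : Fin d → Amb :=
  B.foldr (fun β x => tDt A q p 1 x - (HahnSeries.C (star 1 β) : Amb) • x) m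

lemma bern_nil (m : Fin d → Amb) : bern A q p [] m = m := rfl

lemma bern_cons (β : ℂ) (B : List ℂ) (m : Fin d → Amb) : bern A q p (β :: B) m =
    tDt A q p 1 (bern A q p B m) - (HahnSeries.C (star 1 β) : Amb) • bern A q p B m := rfl

lemma bern_append (B B' : List ℂ) (m : Fin d → Amb) :
    bern A q p (B ++ B') m = bern A q p B (bern A q p B' m) := List.foldr_append

lemma bern_sub (B : List ℂ) (m m' : Fin d → Amb) :
    bern A q p B (m - m') = bern A q p B m - bern A q p B m' := by
  induction B with
  | nil => rfl
  | cons β B ih => rw [bern_cons, bern_cons, bern_cons, ih, tDt_sub, smul_sub]; abel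

lemma bern_tDt (B : List ℂ) (m : Fin d → Amb) :
    bern A q p B (tDt A q p 1 m) = tDt A q p 1 (bern A q p B m) := by
  induction B with
  | nil => rfl
  | cons β B ih => rw [bern_cons, bern_cons, ih, tDt_sub, tDt_C_smul]

lemma bern_C_smul (B : List ℂ) (f : ℂ⟦X⟧) (m : Fin d → Amb) :
    bern A q p B ((HahnSeries.C f : Amb) • m) = (HahnSeries.C f : Amb) • bern A q p B m := by
  induction B with
  | nil => rfl
  | cons β B ih => rw [bern_cons, bern_cons, ih, tDt_C_smul, smul_sub, smul_comm]

lemma smul_mem_of_mem_Germs {N : Submodule Germs (Fin d → Amb)} {f : Amb} (hf : f ∈ Germs)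
    {m : Fin d → Amb} (hm : m ∈ N) : f • m ∈ N := N.smul_mem ⟨f, hf⟩ hm

lemma bern_mem {N : Submodule Germs (Fin d → Amb)} (hN : ∀ m ∈ N, tDt A q p 1 m ∈ N) (B : List ℂ)
    {m : Fin d → Amb} (hm : m ∈ N) : bern A q p B m ∈ N := by
  induction B with
  | nil => exact hm
  | cons β B ih => exact N.sub_mem (hN _ ih) (smul_mem_of_mem_Germs (C_star_mem_Germs _ _) ih)

/-- There is no torsion over the ring of germs of functions of `z` in `M / N`. -/
def StrictQuot (M N : Submodule Germs (Fin d → Amb)) : Prop :=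
  ∀ f : ℂ⟦X⟧, f ≠ 0 → (HahnSeries.C f : Amb) ∈ Germs →
    ∀ m ∈ M, (HahnSeries.C f : Amb) • m ∈ N → m ∈ N

/-- A substitute for Bézout, removing the roots in `B` one at a time. If `tð_t - β ⋆ z` kills `u`
modulo `N`, the product over `C` acts on `u` as multiplication by the product of the germs `β ⋆ z -
γ ⋆ z`. It is nonzero as `β ∉ C`, and `M / N` has no torsion. -/
lemma mem_of_bern_mem_of_disjoint {M N : Submodule Germs (Fin d → Amb)}
    (hM : ∀ m ∈ M, tDt A q p 1 m ∈ M) (hN : ∀ m ∈ N, tDt A q p 1 m ∈ N) (hs : StrictQuot M N)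
    (B C : List ℂ) (hBC : ∀ β ∈ B, β ∉ C) {y : Fin d → Amb} (hy : y ∈ M)
    (hB : bern A q p B y ∈ N) (hC : bern A q p C y ∈ N) : y ∈ N := by
  induction B with
  | nil => exact hB
  | cons β B ih =>
    refine ih (fun γ hγ => hBC γ (List.mem_cons_of_mem _ hγ)) ?_
    have hy' := bern_mem hM B hy
    have hC' : bern A q p C (bern A q p B y) ∈ N := by
      rw [← bern_append]
      have : bern A q p (C ++ B) y = bern A q p B (bern A q p C y) := by
        rw [bern_append]
        clear hB hC hBC ih
        induction B with
        | nil => rfl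
        | cons γ B ih =>
          rw [bern_cons, bern_cons, bern_sub, bern_tDt, bern_C_smul, ih (bern_mem hM B hy)]
      rw [this]
      exact bern_mem hN B hC
    rw [bern_cons] at hB
    set u := bern A q p B y
    have hβ : β ∉ C := hBC β (List.mem_cons_self ..)
    have key : ∀ C : List ℂ, β ∉ C → ∃ g : ℂ⟦X⟧, g ≠ 0 ∧ (HahnSeries.C g : Amb) ∈ Germs ∧
        bern A q p C u - (HahnSeries.C g : Amb) • u ∈ N := by
      intro C hβ
      induction C with
      | nil => exact ⟨1, one_ne_zero, by rw [map_one]; exact Germs.one_mem, by simp [bern_nil]⟩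
      | cons γ C ih =>
        obtain ⟨g, hg, hgG, hgN⟩ := ih (fun h => hβ (List.mem_cons_of_mem _ h))
        have hne : star 1 β - star 1 γ ≠ 0 := sub_ne_zero.mpr fun h =>
          hβ (star_injective h ▸ List.mem_cons_self ..)
        refine ⟨g * (star 1 β - star 1 γ), mul_ne_zero hg hne, ?_, ?_⟩
        · rw [map_mul, map_sub]
          exact Germs.mul_mem hgG (Germs.sub_mem (C_star_mem_Germs _ _) (C_star_mem_Germs _ _))
        · have e : bern A q p (γ :: C) u - (HahnSeries.C (g * (star 1 β - star 1 γ)) : Amb) • u =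
              tDt A q p 1 (bern A q p C u - (HahnSeries.C g : Amb) • u) -
              (HahnSeries.C (star 1 γ) : Amb) • (bern A q p C u - (HahnSeries.C g : Amb) • u) +
              (HahnSeries.C g : Amb) •
                (tDt A q p 1 u - (HahnSeries.C (star 1 β) : Amb) • u) := by
            rw [bern_cons, tDt_sub, tDt_C_smul, map_mul, map_sub]
            funext a
            simp only [Pi.sub_apply, Pi.add_apply, Pi.smul_apply, smul_eq_mul]
            ring
          rw [e]
          exact N.add_mem (N.sub_mem (hN _ hgN)
            (smul_mem_of_mem_Germs (C_star_mem_Germs _ _) hgN)) (smul_mem_of_mem_Germs hgG hB)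
    obtain ⟨g, hg, hgG, hgN⟩ := key C hβ
    exact hs g hg hgG u hy' ((N.sub_mem_iff_right hC').mp hgN)

end Bernstein

/-! ### Passage from real to integral indices in the `V`-filtration. -/

section Filtration

variable {d : ℕ} {A : Matrix (Fin d) (Fin d) ℂ⟦X⟧} {q : ℕ} {p : Polynomial ℂ}
  {V : ℝ → Submodule Germs (Fin d → Amb)}

lemma ell_one (β : ℂ) : ell 1 β = β.re := by simp [ell]

/-- The graded pieces of the filtration indexed by the integers. -/
lemma IsStrictVFiltration.exists_bern (hV : IsStrictVFiltration (tDt A q p 1) 1 V) (n : ℤ) :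
    StrictQuot (V n) (V (n + 1 : ℤ)) ∧
    ∃ B : List ℂ, (∀ β ∈ B, ⌊β.re⌋ = n) ∧ ∀ m ∈ V n, bern A q p B m ∈ V (n + 1 : ℤ) := by
  classical
  obtain ⟨S, hS⟩ := hV.jumps
  have hfin : ∃ J : Finset ℝ, ∀ b, b ∈ J ↔ (n ≤ b ∧ b < (n + 1 : ℤ)) ∧ ∃ s ∈ S, ∃ k : ℤ, s + k = b := by
    refine ⟨(S.image fun s => s + ((n - ⌊s⌋ : ℤ) : ℝ)).filter
      fun b => (n : ℝ) ≤ b ∧ b < (n + 1 : ℤ), ?_⟩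
    intro b
    rw [Finset.mem_filter, and_comm]
    refine and_congr_right fun hb => ?_
    constructor
    · intro h
      obtain ⟨s, hs, rfl⟩ := Finset.mem_image.mp h
      exact ⟨s, hs, _, rfl⟩
    · rintro ⟨s, hs, k, rfl⟩
      rw [Finset.mem_image]
      refine ⟨s, hs, ?_⟩
      have : ⌊s + k⌋ = n := Int.floor_eq_iff.mpr ⟨hb.1, by exact_mod_cast hb.2⟩
      rw [Int.floor_add_intCast] at this
      have h2 : k = n - ⌊s⌋ := by lia
      rw [h2]
  obtain ⟨J, hJ⟩ := hfin
  -- The quotient `V^a / V^(n+1)` is a successive extension of the graded pieces at the jumps in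
  -- `[a, n + 1)`, so one inducts on their number. At `z = 1`, `ℓ(β)` is the real part of `β`, which
  -- places all the roots in `[n, n + 1)`.
  suffices h : ∀ (k : ℕ) (a : ℝ), n ≤ a → a ≤ (n + 1 : ℤ) → (J.filter (a ≤ ·)).card = k →
      StrictQuot (V a) (V (n + 1 : ℤ)) ∧
      ∃ B : List ℂ, (∀ β ∈ B, ⌊β.re⌋ = n) ∧ ∀ m ∈ V a, bern A q p B m ∈ V (n + 1 : ℤ) from
    h _ n le_rfl (by exact_mod_cast (Int.lt_succ n).le) rfl
  intro k
  induction k using Nat.strong_induction_on with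
  | _ k ih =>
  intro a hna han hk
  rcases (J.filter (a ≤ ·)).eq_empty_or_nonempty with hempty | hne
  · have hVa : V a = V (n + 1 : ℤ) := by
      rcases han.eq_or_lt with h | h
      · rw [h]
      · refine hS _ _ h fun s hs k hk => ?_
        have : s + k ∈ J.filter (a ≤ ·) := by
          rw [Finset.mem_filter, hJ]
          exact ⟨⟨⟨hna.trans hk.1, hk.2⟩, s, hs, k, rfl⟩, hk.1⟩
        rw [hempty] at this
        exact absurd this (Finset.notMem_empty _)
    rw [hVa]
    exact ⟨fun f _ _ m hm _ => hm, [], by simp, fun m hm => hm⟩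
  · set b := (J.filter (a ≤ ·)).min' hne with hb
    have hbmem := Finset.min'_mem _ hne
    rw [← hb, Finset.mem_filter, hJ] at hbmem
    have hVa : V a = V b := by
      rcases hbmem.2.eq_or_lt with h | h
      · rw [← h]
      · refine hS _ _ h fun s hs k hk => ?_
        have : s + k ∈ J.filter (a ≤ ·) := by
          rw [Finset.mem_filter, hJ]
          exact ⟨⟨⟨hna.trans hk.1, hk.2.trans hbmem.1.1.2⟩, s, hs, k, rfl⟩, hk.1⟩
        exact absurd hk.2 (not_lt.mpr (Finset.min'_le _ _ this))
    -- The next jump after `b`, or `n + 1` if there is none before it; then `V^{>b}` is the step at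
    -- this index.
    set T := insert (((n + 1 : ℤ) : ℝ)) (J.filter (b < ·)) with hT
    have hTne : T.Nonempty := Finset.insert_nonempty _ _
    set b' := T.min' hTne with hb'
    have hb'mem := Finset.min'_mem _ hTne
    rw [← hb', hT, Finset.mem_insert, Finset.mem_filter] at hb'mem
    have hbb' : b < b' := by
      rcases hb'mem with h | h
      · rw [h]; exact hbmem.1.1.2
      · exact h.2
    have hb'n : b' ≤ (n + 1 : ℤ) := Finset.min'_le _ _ (Finset.mem_insert_self _ _)
    have hgt : Vgt V b = V b' := by
      refine le_antisymm (iSup_le fun c => ?_) (le_iSup (fun c : Set.Ioi b => V c) ⟨b', hbb'⟩)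
      rcases lt_or_ge (c : ℝ) b' with h | h
      · refine (hS _ _ h fun s hs k hk => ?_).le
        have h1 : s + k ∈ T := by
          refine Finset.mem_insert_of_mem ?_
          rw [Finset.mem_filter, hJ]
          have hbs : b < s + k := lt_of_lt_of_le c.2 hk.1
          exact ⟨⟨⟨hbmem.1.1.1.trans hbs.le, hk.2.trans_le hb'n⟩, s, hs, k, rfl⟩, hbs⟩
        exact absurd hk.2 (not_lt.mpr (Finset.min'_le _ _ h1))
      · exact hV.antitone h
    have hcard : (J.filter (b' ≤ ·)).card < k := by
      rw [← hk]
      refine Finset.card_lt_card ⟨fun c hc => ?_, fun h => ?_⟩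
      · rw [Finset.mem_filter] at hc ⊢
        exact ⟨hc.1, hbmem.2.trans (hbb'.le.trans hc.2)⟩
      · have := h (Finset.min'_mem _ hne)
        rw [← hb, Finset.mem_filter] at this
        exact absurd hbb' (not_lt.mpr this.2)
    obtain ⟨hs', B', hB', hB'm⟩ := ih _ hcard b' (hbmem.1.1.1.trans hbb'.le) hb'n rfl
    obtain ⟨B, hB, hBm⟩ := hV.bernstein b
    rw [hVa]
    refine ⟨fun f hf hfG m hm hfm => ?_, B' ++ B, fun β hβ => ?_, fun m hm => ?_⟩
    · have h1 := hV.strict b f hf hfG m hm (by rw [hgt]; exact hV.antitone hb'n hfm)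
      rw [hgt] at h1
      exact hs' f hf hfG m h1 hfm
    · rcases List.mem_append.mp hβ with h | h
      · exact hB' β h
      · have h1 := hB β h
        rw [ell_one] at h1
        rw [h1]
        exact Int.floor_eq_iff.mpr ⟨hbmem.1.1.1, by exact_mod_cast hbmem.1.1.2⟩
    · rw [bern_append]
      refine hB'm _ ?_
      rw [← hgt]
      exact hBm m hm

end Filtration

/-! ### The polar term contributed by the exponential twist. -/

section Twisting

lemma single_mul_single_one (m n : ℤ) (f : ℂ⟦X⟧) :
    (HahnSeries.single m 1 : Amb) * HahnSeries.single n f = HahnSeries.single (m + n) f := by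
  rw [HahnSeries.single_mul_single, one_mul]

lemma tvar_pow (n : ℕ) : tvar ^ n = HahnSeries.single (n : ℤ) 1 := by
  rw [tvar, HahnSeries.single_pow]; simp

lemma single_C_mem_Germs {n : ℤ} (hn : 0 ≤ n) (a : ℂ) :
    (HahnSeries.single n (PowerSeries.C a) : Amb) ∈ Germs := by
  lift n to ℕ using hn
  have : (HahnSeries.single (n : ℤ) (PowerSeries.C a) : Amb) =
      HahnSeries.single (n : ℤ) 1 * HahnSeries.C (PowerSeries.C a) := by
    rw [HahnSeries.C_apply, single_mul_single_one, add_zero]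
  rw [this]
  exact Germs.mul_mem (single_mem_Germs n) (C_C_mem_Germs a)

/-- The term of degree `-q` drops out. It is the one invisible to scaling: for `φ = α t^(-q)`, the
exponent `φ/z = α/(t^q z)` is itself a function of `t^q z`. -/
lemma euler_polar_add (q : ℕ) (p : Polynomial ℂ) :
    euler (polar ℂ⟦X⟧ p) + (q : Amb) * polar ℂ⟦X⟧ p =
      ∑ j ∈ p.support, HahnSeries.single (-(j : ℤ)) (PowerSeries.C (((q : ℂ) - j) * p.coeff j)) := by
  have hadd : ∀ (n : ℤ) (a b : ℂ⟦X⟧), (HahnSeries.single n a : Amb) + HahnSeries.single n b =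
      HahnSeries.single n (a + b) := fun n a b => by
    ext1; funext m
    rw [HahnSeries.coeff_add, HahnSeries.coeff_single, HahnSeries.coeff_single,
      HahnSeries.coeff_single]
    split_ifs <;> simp
  rw [polar, Polynomial.sum, euler_sum, Finset.mul_sum, ← Finset.sum_add_distrib]
  refine Finset.sum_congr rfl fun j _ => ?_
  rw [euler_single, ← map_natCast (HahnSeries.C : ℂ⟦X⟧ →+* Amb), HahnSeries.C_apply,
    HahnSeries.single_mul_single, zero_add, hadd]
  congr 1
  change _ * PowerSeries.C _ + _ * PowerSeries.C _ = _
  rw [map_mul, map_sub, map_natCast, map_natCast]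
  push_cast
  ring

end Twisting

/-! ### Stability of the `V`-filtration under scaling, and its consequence for inhomogeneous twists.
-/

section Filtration

variable {d : ℕ} {A : Matrix (Fin d) (Fin d) ℂ⟦X⟧} {q : ℕ} {p : Polynomial ℂ}
  {V : ℝ → Submodule Germs (Fin d → Amb)}

lemma scaling_mem_stalk {m : Fin d → Amb} (hm : m ∈ stalk d) : scaling q p m ∈ stalk d := by
  obtain ⟨n, hn⟩ := hm
  refine ⟨n + p.natDegree, fun a => ?_⟩
  have h1 : tvar ^ n * eps q (m a) = eps q (tvar ^ n * m a) -
      HahnSeries.C (zvar 1) * ((n : Amb) * (tvar ^ n * m a)) := by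
    rw [eps_mul, tvar_pow, eps_single_one]
    push_cast
    ring
  have h2 : tvar ^ p.natDegree * (euler (polar ℂ⟦X⟧ p) + (q : Amb) * polar ℂ⟦X⟧ p) ∈ Germs := by
    rw [euler_polar_add, Finset.mul_sum]
    refine Germs.sum_mem fun j hj => ?_
    rw [tvar_pow, single_mul_single_one]
    have := Polynomial.le_natDegree_of_mem_supp j hj
    exact single_C_mem_Germs (by lia) _
  have h3 : tvar ^ p.natDegree ∈ Germs := tvar_pow p.natDegree ▸ single_mem_Germs _
  have h4 : tvar ^ (n + p.natDegree) * scaling q p m a =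
      tvar ^ p.natDegree * (eps q (tvar ^ n * m a) -
        HahnSeries.C (zvar 1) * ((n : Amb) * (tvar ^ n * m a))) -
      (tvar ^ p.natDegree * (euler (polar ℂ⟦X⟧ p) + (q : Amb) * polar ℂ⟦X⟧ p)) *
        (tvar ^ n * m a) := by
    rw [← h1, scaling]; ring
  rw [h4]
  exact Germs.sub_mem (Germs.mul_mem h3 (Germs.sub_mem (eps_mem_Germs q (hn a))
    (Germs.mul_mem (C_zvar_mem_Germs _) (Germs.mul_mem (natCast_mem Germs n) (hn a)))))
    (Germs.mul_mem h2 (hn a))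

lemma IsStrictVFiltration.single_smul_mem (hV : IsStrictVFiltration (tDt A q p 1) 1 V) (n : ℤ)
    {b : ℝ} {m : Fin d → Amb} (hm : m ∈ V b) : (HahnSeries.single n 1 : Amb) • m ∈ V (b + n) := by
  induction n with
  | zero =>
    have : (HahnSeries.single 0 1 : Amb) = 1 := rfl
    rwa [this, one_smul, Int.cast_zero, add_zero]
  | succ n ih =>
    have h := (hV.shift _ _).mp ih
    rw [smul_smul, tvar, single_mul_single_one, add_assoc] at h
    push_cast at h ⊢
    rwa [add_comm (n : ℤ) 1]
  | pred n ih =>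
    rw [hV.shift, smul_smul, tvar, single_mul_single_one]
    push_cast at ih ⊢
    have e : b + (-(n : ℝ) - 1) + 1 = b + -n := by ring
    have e' : (1 : ℤ) + (-(n : ℤ) - 1) = -n := by ring
    rwa [e, e']

/-- The finitely many generators of `V^0` are sent into some `V^(-N)`. The commutation with `tð_t`
and the Leibniz rule extend this to `V^0`, and multiplication by powers of `t` carries it to all `n`
with the same `N`. -/
lemma IsStrictVFiltration.exists_scaling_mem (hV : IsStrictVFiltration (tDt A q p 1) 1 V) :
    ∃ N : ℕ, ∀ n : ℤ, ∀ m ∈ V n, scaling q p m ∈ V (n - N : ℤ) := by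
  classical
  obtain ⟨G, hG⟩ := hV.finite_type 0
  have hG0 : ∀ x ∈ G, x ∈ V 0 := fun x hx => by
    rw [hG]; exact Submodule.subset_span ⟨x, hx, 0, rfl⟩
  have hb : ∀ x : G, ∃ b, scaling q p (x : Fin d → Amb) ∈ V b := fun x =>
    (hV.exhaustive _).mp (scaling_mem_stalk ((hV.exhaustive _).mpr ⟨0, hG0 x x.2⟩))
  choose b hb using hb
  obtain ⟨N, hN⟩ : ∃ N : ℕ, ∀ x : G, -(N : ℝ) ≤ b x := by
    obtain ⟨M, hM⟩ := (Set.finite_range fun x => -b x).bddAbove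
    obtain ⟨N, hN⟩ := exists_nat_ge M
    exact ⟨N, fun x => by linarith [hM ⟨x, rfl⟩]⟩
  have h0N : V 0 ≤ V (-(N : ℝ)) := hV.antitone (by simp)
  have hqz : (q : Amb) * HahnSeries.C (zvar 1) ∈ Germs :=
    Germs.mul_mem (natCast_mem Germs q) (C_zvar_mem_Germs 1)
  have key : ∀ m ∈ V 0, scaling q p m ∈ V (-(N : ℝ)) := by
    intro m hm
    rw [hG] at hm
    induction hm using Submodule.span_induction with
    | mem m h =>
      obtain ⟨x, hx, k, rfl⟩ := h
      have : ∀ k, (tDt A q p 1)^[k] x ∈ V 0 ∧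
          scaling q p ((tDt A q p 1)^[k] x) ∈ V (-(N : ℝ)) := by
        intro k
        induction k with
        | zero => exact ⟨hG0 x hx, hV.antitone (hN ⟨x, hx⟩) (hb ⟨x, hx⟩)⟩
        | succ k ih =>
          rw [Function.iterate_succ_apply', scaling_tDt]
          have h1 := hV.stable _ _ ih.1
          exact ⟨h1, Submodule.sub_mem _ (hV.stable _ _ ih.2)
            (smul_mem_of_mem_Germs hqz (h0N h1))⟩
      exact (this k).2
    | zero =>
      have : scaling q p (0 : Fin d → Amb) = 0 := by
        have := scaling_sub q p (0 : Fin d → Amb) 0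
        rwa [sub_self, sub_self] at this
      rw [this]; exact Submodule.zero_mem _
    | add m m' _ _ h h' => rw [scaling_add]; exact Submodule.add_mem _ h h'
    | smul f m hm h =>
      rw [Subring.smul_def, scaling_smul]
      rw [← hG] at hm
      exact Submodule.add_mem _ (smul_mem_of_mem_Germs (eps_mem_Germs q f.2) (h0N hm))
        (smul_mem_of_mem_Germs f.2 h)
  refine ⟨N, fun n m hm => ?_⟩
  have h1 := hV.single_smul_mem (-n) hm
  rw [Int.cast_neg, add_neg_cancel] at h1
  have h2 := hV.single_smul_mem n (key _ h1)
  have e : m = (HahnSeries.single n 1 : Amb) • (HahnSeries.single (-n) 1 : Amb) • m := by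
    rw [smul_smul, single_mul_single_one, add_neg_cancel]
    exact (one_smul _ _).symm
  have h3 : -(N : ℝ) + n = ((n - N : ℤ) : ℝ) := by push_cast; ring
  rw [h3] at h2
  set m' := (HahnSeries.single (-n) 1 : Amb) • m
  have h4 : V n ≤ V (n - N : ℤ) := hV.antitone (by push_cast; linarith [Nat.cast_nonneg (α := ℝ) N])
  rw [e, scaling_smul]
  refine Submodule.add_mem _ ?_ h2
  have h5 : eps q (HahnSeries.single n 1) • m' = (HahnSeries.C (zvar 1) * (n : Amb)) • m := by
    rw [eps_single_one, e]
    funext a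
    simp only [Pi.smul_apply, smul_eq_mul]
    ring
  rw [h5]
  exact smul_mem_of_mem_Germs (Germs.mul_mem (C_zvar_mem_Germs 1) (intCast_mem Germs n)) (h4 hm)

/-- The scaling operator preserves the filtration. -/
theorem IsStrictVFiltration.scaling_mem (hV : IsStrictVFiltration (tDt A q p 1) 1 V) (n : ℤ)
    {m : Fin d → Amb} (hm : m ∈ V n) : scaling q p m ∈ V n := by
  obtain ⟨N, hN⟩ := hV.exists_scaling_mem
  -- Descent on the loss `N`: a loss of `N + 1` valid for all `n` is improved to `N`.
  induction N generalizing n m with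
  | zero => simpa using hN n m hm
  | succ N ih =>
    refine ih n hm ?_
    clear hm
    intro n m hm
    have e : (n : ℤ) - ((N + 1 : ℕ) : ℤ) + 1 = n - N := by push_cast; ring
    obtain ⟨hs, C, hC, hCm⟩ := hV.exists_bern (n - (N + 1 : ℕ))
    obtain ⟨-, B, hB, hBm⟩ := hV.exists_bern n
    rw [e] at hs hCm
    have hle : V n ≤ V (n - N : ℤ) :=
      hV.antitone (by push_cast; linarith [Nat.cast_nonneg (α := ℝ) N])
    have hqz : (q : Amb) * HahnSeries.C (zvar 1) ∈ Germs :=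
      Germs.mul_mem (natCast_mem Germs q) (C_zvar_mem_Germs 1)
    -- The commutators of `scaling` with `tð_t` and with `β ⋆ z` preserve `V^n`, so they are
    -- negligible modulo `V^(n-N)`.
    have hcomm : ∀ B : List ℂ,
        bern A q p B (scaling q p m) - scaling q p (bern A q p B m) ∈ V (n - N : ℤ) := by
      intro B
      induction B with
      | nil => simp [bern_nil]
      | cons β B ihB =>
        have hmB := bern_mem (hV.stable n) B hm
        have h1 : bern A q p (β :: B) (scaling q p m) - scaling q p (bern A q p (β :: B) m) =
            tDt A q p 1 (bern A q p B (scaling q p m) - scaling q p (bern A q p B m)) -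
            (HahnSeries.C (star 1 β) : Amb) •
              (bern A q p B (scaling q p m) - scaling q p (bern A q p B m)) +
            (((q : Amb) * HahnSeries.C (zvar 1)) • tDt A q p 1 (bern A q p B m) +
            eps q (HahnSeries.C (star 1 β)) • bern A q p B m) := by
          rw [bern_cons, bern_cons, scaling_sub, scaling_tDt, scaling_smul, tDt_sub, smul_sub]
          abel
        rw [h1]
        exact Submodule.add_mem _ (Submodule.sub_mem _ (hV.stable _ _ ihB)
          (smul_mem_of_mem_Germs (C_star_mem_Germs _ _) ihB)) (hle (Submodule.add_mem _
            (smul_mem_of_mem_Germs hqz (hV.stable _ _ hmB))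
            (smul_mem_of_mem_Germs (eps_mem_Germs q (C_star_mem_Germs _ _)) hmB)))
    have h2 : scaling q p (bern A q p B m) ∈ V (n - N : ℤ) := by
      have := hN _ _ (hBm m hm)
      have e' : (n + 1 : ℤ) - ((N + 1 : ℕ) : ℤ) = n - N := by push_cast; ring
      rwa [e'] at this
    -- Modulo `V^(n-N)`, the image of `m` is killed by the roots of index `n`, because these send
    -- `m` into `V^(n+1)`, and by the roots of index `n - N - 1`, because it lies in `V^(n-N-1)`.
    -- The integer parts of the real parts differ, so the two lists are disjoint.
    refine mem_of_bern_mem_of_disjoint (hV.stable _) (hV.stable _) hs B C ?_ (hN n m hm)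
      ((Submodule.sub_mem_iff_left _ h2).mp (hcomm B)) (hCm _ (hN n m hm))
    intro β hβ hβ'
    have h3 := hB β hβ
    rw [hC β hβ'] at h3
    lia

lemma scaling_single_smul_single (M : ℤ) (i : Fin d) :
    scaling q p ((HahnSeries.single M 1 : Amb) • Pi.single i 1) =
      (HahnSeries.C (zvar 1) * (M : Amb)) • (HahnSeries.single M 1 : Amb) • Pi.single i 1 -
      ∑ j ∈ p.support, (HahnSeries.C (PowerSeries.C (((q : ℂ) - j) * p.coeff j)) : Amb) •
        (HahnSeries.single (M - j) 1 : Amb) • Pi.single i 1 := by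
  have h1 : scaling q p (Pi.single i 1 : Fin d → Amb) =
      -(euler (polar ℂ⟦X⟧ p) + (q : Amb) * polar ℂ⟦X⟧ p) • (Pi.single i 1 : Fin d → Amb) := by
    funext a
    have h2 : eps q ((Pi.single i 1 : Fin d → Amb) a) = 0 := by
      rw [Pi.single_apply]
      split_ifs
      · simpa using eps_natCast q 1
      · exact eps_zero q
    rw [scaling, h2, zero_sub, Pi.smul_apply, smul_eq_mul, neg_mul]
  have h3 : ∑ j ∈ p.support, (HahnSeries.C (PowerSeries.C (((q : ℂ) - j) * p.coeff j)) : Amb) •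
      (HahnSeries.single (M - j) 1 : Amb) • (Pi.single i 1 : Fin d → Amb) =
      (HahnSeries.single M 1 * (euler (polar ℂ⟦X⟧ p) + (q : Amb) * polar ℂ⟦X⟧ p) : Amb) •
        (Pi.single i 1 : Fin d → Amb) := by
    funext a
    simp only [euler_polar_add, Finset.sum_apply, Pi.smul_apply, smul_eq_mul, Finset.mul_sum,
      Finset.sum_mul]
    refine Finset.sum_congr rfl fun j _ => ?_
    rw [single_mul_single_one, ← mul_assoc, HahnSeries.C_apply, HahnSeries.single_mul_single,
      mul_one, zero_add, sub_eq_add_neg]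
  rw [scaling_smul, h1, eps_single_one, h3]
  funext a
  simp only [Pi.smul_apply, Pi.add_apply, Pi.sub_apply, smul_eq_mul]
  ring

/-- If `φ` is not homogeneous of degree `-q`, the filtration is constant. -/
theorem IsStrictVFiltration.eq_stalk (hV : IsStrictVFiltration (tDt A q p 1) 1 V)
    (hp0 : p.coeff 0 = 0) (hp : ∃ j, j ≠ q ∧ p.coeff j ≠ 0) : V 0 = stalk d := by
  classical
  set e : Fin d → ℤ → Fin d → Amb := fun i M => (HahnSeries.single M 1 : Amb) • Pi.single i 1
    with he
  have hmul : ∀ i M n, (HahnSeries.single n 1 : Amb) • e i M = e i (n + M) := fun i M n => by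
    simp only [he, smul_smul, single_mul_single_one]
  -- `J` is the order of the pole of `(t∂_t + q)φ`: the largest exponent of `φ` other than `q`.
  obtain ⟨J, hJ, hJmax⟩ := Finset.exists_max_image (p.support.filter fun j => j ≠ q) id (by
    obtain ⟨j, hj, hpj⟩ := hp
    exact ⟨j, Finset.mem_filter.mpr ⟨Polynomial.mem_support_iff.mpr hpj, hj⟩⟩)
  rw [Finset.mem_filter, Polynomial.mem_support_iff] at hJ
  have hJpos : 0 < J := by
    rw [Nat.pos_iff_ne_zero]
    rintro rfl
    exact hJ.1 hp0
  have hcJ : ((q : ℂ) - J) * p.coeff J ≠ 0 :=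
    mul_ne_zero (sub_ne_zero.mpr (by exact_mod_cast hJ.2.symm)) hJ.1
  have hmono : ∀ i M M', M ≤ M' → e i M ∈ V 0 → e i M' ∈ V 0 := fun i M M' h hM => by
    obtain ⟨n, hn⟩ := Int.eq_ofNat_of_zero_le (sub_nonneg.mpr h)
    have := smul_mem_of_mem_Germs (single_mem_Germs n) hM
    rw [hmul] at this
    rwa [show M' = n + M by lia]
  -- Applied to `t^(M-1+J) e_i`, `scaling` gives a nonzero constant times `t^(M-1) e_i`, plus terms
  -- with exponent at least `M`, already in `V^0`. So the exponent can be lowered by one.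
  have hdown : ∀ i M, e i M ∈ V 0 → e i (M - 1) ∈ V 0 := by
    intro i M hM
    have hL := hmono i M (M - 1 + J) (by lia) hM
    have h1 := hV.scaling_mem 0 (m := e i (M - 1 + J)) (by simpa using hL)
    rw [Int.cast_zero] at h1
    simp only [he] at h1
    rw [scaling_single_smul_single] at h1
    have h2 := (Submodule.sub_mem_iff_right _ (smul_mem_of_mem_Germs (Germs.mul_mem
      (C_zvar_mem_Germs 1) (intCast_mem Germs _)) hL)).mp h1
    rw [← Finset.add_sum_erase _ _ (Polynomial.mem_support_iff.mpr hJ.1)] at h2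
    have h3 := (Submodule.add_mem_iff_left _ (Submodule.sum_mem _ fun j hj => ?_)).mp h2
    · have h4 := smul_mem_of_mem_Germs (C_C_mem_Germs (((q : ℂ) - J) * p.coeff J)⁻¹) h3
      rw [smul_smul, ← map_mul, ← map_mul, inv_mul_cancel₀ hcJ, map_one, map_one, one_smul] at h4
      rwa [show M - 1 + (J : ℤ) - J = M - 1 by ring] at h4
    · rw [Finset.mem_erase] at hj
      by_cases hjq : j = q
      · rw [hjq, sub_self, zero_mul, map_zero, map_zero, zero_smul]
        exact Submodule.zero_mem _
      · have h5 := hJmax j (Finset.mem_filter.mpr ⟨hj.2, hjq⟩)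
        simp only [id] at h5
        have h6 := hj.1
        exact smul_mem_of_mem_Germs (C_C_mem_Germs _) (hmono i M _ (by lia) hM)
  have hall : ∀ i M, e i M ∈ V 0 := by
    intro i M
    have hst : (Pi.single i 1 : Fin d → Amb) ∈ stalk d := ⟨0, fun a => by
      rw [pow_zero, one_mul, Pi.single_apply]
      split_ifs
      · exact Germs.one_mem
      · exact Germs.zero_mem⟩
    obtain ⟨b, hb⟩ := (hV.exhaustive _).mp hst
    obtain ⟨n, hn⟩ := exists_int_ge (-b)
    have h1 := hV.antitone (show (0 : ℝ) ≤ b + n by linarith) (hV.single_smul_mem n hb)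
    have h2 : ∀ k : ℕ, e i (n - k) ∈ V 0 := by
      intro k
      induction k with
      | zero => simpa using h1
      | succ k ih =>
        have := hdown i _ ih
        rwa [show n - (k : ℤ) - 1 = n - ((k + 1 : ℕ) : ℤ) by push_cast; ring] at this
    exact hmono i _ M (by lia) (h2 (n - M).toNat)
  refine le_antisymm (fun m hm => (hV.exhaustive m).mpr ⟨0, hm⟩) ?_
  rintro m ⟨n, hn⟩
  have : m = ∑ i, (tvar ^ n * m i) • e i (-n) := by
    funext a
    simp only [he, Finset.sum_apply, Pi.smul_apply, Pi.single_apply, smul_eq_mul, mul_ite, mul_one,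
      mul_zero, Finset.sum_ite_eq, Finset.mem_univ, if_true]
    have h1 : (HahnSeries.single (n : ℤ) 1 : Amb) * HahnSeries.single (-(n : ℤ)) 1 = 1 := by
      rw [single_mul_single_one, add_neg_cancel]; rfl
    rw [tvar_pow]
    linear_combination (-m a) * h1
  rw [this]
  exact Submodule.sum_mem _ fun i _ => smul_mem_of_mem_Germs (hn i) (hall i _)

end Filtration

section

open Matrix LS

/-! ### Restriction to `z = 1` -/

section Restriction

/-- The restriction to `z = 1`. -/
def red : Amb →+* LS ℂ where
  toFun f := of (f.map (PowerSeries.constantCoeff : ℂ⟦X⟧ →+* ℂ))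
  map_one' := by
    ext n
    rw [coeff_of, HahnSeries.map_coeff, coeff_one, HahnSeries.coeff_one]
    split_ifs <;> simp
  map_mul' f g := HahnSeries.map_mul
    ((PowerSeries.constantCoeff : ℂ⟦X⟧ →+* ℂ) : ℂ⟦X⟧ →ₙ+* ℂ)
  map_zero' := by
    ext n
    rw [coeff_of, HahnSeries.map_coeff]
    simp
  map_add' f g := by
    ext n
    rw [map_add, coeff_of, coeff_of, coeff_of, HahnSeries.map_coeff, HahnSeries.map_coeff,
      HahnSeries.map_coeff, HahnSeries.coeff_add, map_add]

lemma coeff_red (f : Amb) (n : ℤ) :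
    coeff n (red f) = PowerSeries.constantCoeff (f.coeff n) := rfl

lemma red_euler (f : Amb) : red (euler f) = LS.d (red f) := by
  ext n
  rw [coeff_d, coeff_red, coeff_red, coeff_euler, map_mul, map_intCast]

lemma red_single (n : ℤ) (f : ℂ⟦X⟧) :
    red (HahnSeries.single n f) = of (HahnSeries.single n (PowerSeries.constantCoeff f)) := by
  ext m
  rw [coeff_red, coeff_of, HahnSeries.coeff_single, HahnSeries.coeff_single]
  split_ifs <;> simp

lemma red_polar (p : Polynomial ℂ) : red (polar ℂ⟦X⟧ p) = of (polar ℂ p) := by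
  rw [polar, polar, Polynomial.sum, Polynomial.sum, map_sum, map_sum]
  refine Finset.sum_congr rfl fun j _ => ?_
  rw [red_single]
  congr 2

lemma red_rescaleSeries (q : ℕ+) (F : ℂ⟦X⟧) :
    red (HahnSeries.ofPowerSeries ℤ ℂ⟦X⟧ (rescaleSeries q 1 F)) =
      ram q (of (HahnSeries.ofPowerSeries ℤ ℂ F)) := by
  ext n
  rw [coeff_red]
  rcases lt_or_ge n 0 with hn | hn
  · have h1 := PowerSeries.coeff_coe (rescaleSeries q 1 F) n
    rw [if_pos hn] at h1
    rw [h1, map_zero]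
    have := ram_mem_ordGE q (ofPowerSeries_mem_ordGE F)
    rw [mul_zero] at this
    exact (this n hn).symm
  · lift n to ℕ using hn
    rw [coeff_coe_natCast, rescaleSeries, PowerSeries.coeff_mk]
    split_ifs with h
    · obtain ⟨m, rfl⟩ := h
      rw [Nat.mul_div_cancel_left _ q.pos, Nat.cast_mul, coeff_ram_mul, coeff_ofPowerSeries,
        if_neg (by lia)]
      simp [zvar]
    · rw [coeff_ram_of_not_dvd _ _ (by exact_mod_cast h), map_zero]

lemma red_mem_ordGE {f : Amb} (hf : f ∈ Germs) : red f ∈ ordGE ℂ 0 := fun n hn => by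
  rw [coeff_red, (mem_Germs_iff.mp hf).1 n hn, map_zero]

variable {d : ℕ}

/-- A matrix of power series, as a matrix of Laurent series. -/
def toLS (A : Matrix (Fin d) (Fin d) ℂ⟦X⟧) : Matrix (Fin d) (Fin d) (LS ℂ) :=
  A.map fun f => of (HahnSeries.ofPowerSeries ℤ ℂ f)

lemma integral_toLS (A : Matrix (Fin d) (Fin d) ℂ⟦X⟧) : Integral (toLS A) :=
  fun a b => ofPowerSeries_mem_ordGE (A a b)

lemma d_dotProduct {K : Type} [Field K] {ι : Type} [Fintype ι] (u v : ι → LS K) :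
    LS.d (u ⬝ᵥ v) = (fun a => LS.d (u a)) ⬝ᵥ v + u ⬝ᵥ fun a => LS.d (v a) := by
  simp only [dotProduct, map_sum, d_mul, Finset.sum_add_distrib]

lemma red_tDt (A : Matrix (Fin d) (Fin d) ℂ⟦X⟧) (q : ℕ+) (p : Polynomial ℂ) (m : Fin d → Amb) :
    (fun a => red (tDt A q p 1 m a)) = conn (ramM q (x ℂ (-1) • toLS A)) (fun a => red (m a)) -
      LS.d (of (polar ℂ p)) • fun a => red (m a) := by
  funext a
  have h1 : red (HahnSeries.C (zvar 1)) = 1 := by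
    rw [HahnSeries.C_apply, red_single]
    simp [zvar]
  have h2 : red (HahnSeries.single (-((q : ℕ) : ℤ)) 1) = x ℂ (-((q : ℕ) : ℤ)) := by
    rw [red_single, map_one]; rfl
  rw [ramM_smul_x, mul_one, Pi.sub_apply, conn_apply, smul_mulVec, Pi.smul_apply, Pi.smul_apply,
    tDt, map_sub, map_add, map_mul, map_mul, map_mul, map_mul, map_natCast, h1, h2, one_mul,
    red_euler, red_euler, red_polar, map_sum, ramM, smul_mulVec, Pi.smul_apply, smul_eq_mul,
    smul_eq_mul]
  congr 2
  rw [mul_smul_comm, Algebra.smul_def, map_natCast, mulVec, dotProduct, mul_assoc]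
  congr 2
  refine Finset.sum_congr rfl fun b _ => ?_
  rw [map_mul, red_rescaleSeries]
  rfl

/-- If `φ` is not homogeneous of degree `-q`, strict specializability prevents the
connection dual to the rescaled one from having horizontal sections with eigenvalue having the
polar part `-t∂_tφ`. -/
theorem IsStrictVFiltration.eq_zero_of_conn_eq_smul {A : Matrix (Fin d) (Fin d) ℂ⟦X⟧} {q : ℕ+}
    {p : Polynomial ℂ} {V : ℝ → Submodule Germs (Fin d → Amb)}
    (hV : IsStrictVFiltration (tDt A q p 1) 1 V) (hp0 : p.coeff 0 = 0)
    (hp : ∃ j, j ≠ (q : ℕ) ∧ p.coeff j ≠ 0) {u : Fin d → LS ℂ} {h : LS ℂ} (hh : h ∈ ordGE ℂ 0)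
    (hu : conn (ramM q (x ℂ (-1) • -(toLS A)ᵀ)) u = (h - LS.d (of (polar ℂ p))) • u) :
    u = 0 := by
  classical
  set B := ramM q (x ℂ (-1) • toLS A) with hB
  have hBt : ramM q (x ℂ (-1) • -(toLS A)ᵀ) = -Bᵀ := by
    ext1 a b
    simp only [hB, ramM, Matrix.smul_apply, map_apply, Matrix.neg_apply, transpose_apply, smul_neg,
      map_neg]
  have hdu : (fun a => LS.d (u a)) = (h - LS.d (of (polar ℂ p))) • u + Bᵀ *ᵥ u := by
    rw [← hu, hBt]
    funext a
    rw [Pi.add_apply, conn_apply, neg_mulVec, Pi.neg_apply, neg_add_cancel_right]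
  -- Pairing at `z = 1` with the dual eigenvector: the term `t∂_tφ` in its eigenvalue cancels the
  -- twist, so `tð_t` becomes `t∂_t - h` with `h` without pole.
  set ψ : (Fin d → Amb) → LS ℂ := fun m => u ⬝ᵥ fun a => red (m a) with hψ
  have hψD : ∀ m, ψ (tDt A q p 1 m) = LS.d (ψ m) - h * ψ m := by
    intro m
    simp only [hψ]
    rw [red_tDt, ← hB, d_dotProduct, hdu, dotProduct_sub, dotProduct_smul, add_dotProduct,
      smul_dotProduct, mulVec_transpose, ← dotProduct_mulVec]
    have h1 : conn B (fun a => red (m a)) = (fun a => LS.d (red (m a))) +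
        B *ᵥ fun a => red (m a) := rfl
    rw [h1, dotProduct_add, smul_eq_mul, smul_eq_mul]
    ring
  have hψadd : ∀ m m', ψ (m + m') = ψ m + ψ m' := fun m m' => by
    simp only [hψ, dotProduct, Pi.add_apply, map_add, mul_add, Finset.sum_add_distrib]
  have hψsmul : ∀ (f : Amb) m, ψ (f • m) = red f * ψ m := fun f m => by
    simp only [hψ, dotProduct, Pi.smul_apply, smul_eq_mul, map_mul, Finset.mul_sum]
    exact Finset.sum_congr rfl fun a _ => by ring
  obtain ⟨G, hG⟩ := hV.finite_type 0
  obtain ⟨M, hM⟩ := exists_forall_mem_ordGE fun x : G => ψ x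
  -- `t∂_t - h` and germs at `z = 1` create no poles, so the worst pole among finitely many
  -- generators bounds them all.
  have key : ∀ m ∈ V 0, ψ m ∈ ordGE ℂ M := by
    intro m hm
    rw [hG] at hm
    induction hm using Submodule.span_induction with
    | mem m hm =>
      obtain ⟨y, hy, k, rfl⟩ := hm
      induction k with
      | zero => exact hM ⟨y, hy⟩
      | succ k ih =>
        rw [Function.iterate_succ_apply', hψD]
        exact Submodule.sub_mem _ (d_mem_ordGE ih) (mul_mem_ordGE_of_left hh ih)
    | zero => simp [hψ]
    | add m m' _ _ h h' => rw [hψadd]; exact Submodule.add_mem _ h h'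
    | smul f m _ h =>
      rw [Subring.smul_def, hψsmul]
      exact mul_mem_ordGE_of_left (red_mem_ordGE f.2) h
  rw [hV.eq_stalk hp0 hp] at key
  funext i
  refine eq_zero_of_forall_mem_ordGE fun n => ?_
  -- All `t^(-k) e_i` lie in `V^0`, so `t^(-k) u_i` has a pole bounded independently of `k`; hence
  -- `u_i = 0`.
  have hmem : (HahnSeries.single (-((n - M).toNat : ℤ)) 1 : Amb) • (Pi.single i 1 : Fin d → Amb) ∈
      stalk d := ⟨(n - M).toNat, fun a => by
    rw [Pi.smul_apply, smul_eq_mul, ← mul_assoc, tvar_pow, single_mul_single_one, add_neg_cancel,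
      Pi.single_apply]
    split_ifs
    · rw [mul_one]; exact Germs.one_mem
    · rw [mul_zero]; exact Germs.zero_mem⟩
  have h1 := key _ hmem
  have h2 : ψ (Pi.single i 1) = u i := by
    have : (fun a => red ((Pi.single i 1 : Fin d → Amb) a)) = Pi.single i 1 := by
      funext a
      rw [Pi.single_apply, Pi.single_apply]
      split_ifs <;> simp
    simp only [hψ]
    rw [this, dotProduct_single, mul_one]
  rw [hψsmul, h2, red_single, map_one] at h1
  have h3 := x_mul_mem_ordGE (m := ((n - M).toNat : ℤ)) h1
  rw [← mul_assoc] at h3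
  change x ℂ _ * x ℂ _ * u i ∈ _ at h3
  rw [x_mul_x_neg, one_mul] at h3
  exact ordGE_mono (by lia) h3

end Restriction

end

section

open Matrix LS

/-! ### Duality -/

section Duality

variable {K : Type} [Field K] {ι : Type} [Fintype ι]

lemma dotProduct_mem_ordGE {m n : ℤ} {u v : ι → LS K} (hu : u ∈ lat ι m) (hv : v ∈ lat ι n) :
    u ⬝ᵥ v ∈ ordGE K (m + n) :=
  Submodule.sum_mem _ fun a _ => mul_mem_ordGE (hu a) (hv a)

lemma d_dotProduct_eq_conn (B : Matrix ι ι (LS K)) (u v : ι → LS K) :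
    LS.d (u ⬝ᵥ v) = conn (-Bᵀ) u ⬝ᵥ v + u ⬝ᵥ conn B v := by
  have h1 : conn (-Bᵀ) u = (fun a => LS.d (u a)) + (-Bᵀ) *ᵥ u := rfl
  have h2 : conn B v = (fun a => LS.d (v a)) + B *ᵥ v := rfl
  rw [h1, h2, d_dotProduct, add_dotProduct, dotProduct_add, neg_mulVec, neg_dotProduct,
    mulVec_transpose, ← dotProduct_mulVec]
  ring

/-- The derivative term has larger order than `f`, so the leading term of the whole expression is
that of `-c f`. -/
lemma mem_ordGE_of_x_mul_d_sub_mem {k : ℤ} (hk : 0 < k) {c : K} (hc : c ≠ 0) {m : ℤ} {f : LS K}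
    (h : x K k * LS.d f - c • f ∈ ordGE K m) : f ∈ ordGE K m := by
  by_cases hf : f = 0
  · rw [hf]; exact Submodule.zero_mem _
  obtain ⟨n, hn, hn0⟩ := exists_coeff_ne_zero hf
  refine ordGE_mono ?_ hn
  by_contra hlt
  have h1 := h n (not_le.mp hlt)
  rw [map_sub, map_smul, coeff_x_mul, coeff_d, hn (n - k) (by lia), mul_zero, zero_sub,
    neg_eq_zero, smul_eq_mul] at h1
  exact mul_ne_zero hc hn0 h1

lemma integral_neg_transpose {A : Matrix ι ι (LS K)} (hA : Integral A) : Integral (-Aᵀ) :=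
  fun a b => (ordGE K 0).neg_mem (hA b a)

variable {k : ℤ} {A : Matrix ι ι (LS K)}

lemma x_mul_d_dotProduct_sub (c c' : K) (u v : ι → LS K) :
    x K k * LS.d (u ⬝ᵥ v) - (c + c') • (u ⬝ᵥ v) =
      deltaSub k (-Aᵀ) c u ⬝ᵥ v + u ⬝ᵥ deltaSub k A c' v := by
  have h := d_dotProduct_eq_conn (x K (-k) • A) u v
  rw [transpose_smul, ← smul_neg] at h
  rw [h, deltaSub_apply, deltaSub_apply, delta_eq_smul_conn, delta_eq_smul_conn, sub_dotProduct,
    dotProduct_sub, smul_dotProduct, smul_dotProduct, dotProduct_smul, dotProduct_smul, smul_eq_mul,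
    smul_eq_mul, add_smul]
  ring

/-- The generalized eigenspaces of dual connections are orthogonal. -/
lemma dotProduct_eq_zero_of_mem_genEig (hk : 0 < k) (hA : Integral A) {c c' : K} (hc : c + c' ≠ 0)
    {u v : ι → LS K} (hu : u ∈ genEig hk (integral_neg_transpose hA) c)
    (hv : v ∈ genEig hk hA c') : u ⬝ᵥ v = 0 := by
  obtain ⟨l, hl⟩ := exists_mem_lat u
  obtain ⟨l', hl'⟩ := exists_mem_lat v
  refine eq_zero_of_forall_mem_ordGE fun m => ?_
  obtain ⟨a, ha⟩ := hu (m - l')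
  obtain ⟨b, hb⟩ := hv (m - l)
  obtain ⟨n, hn⟩ : ∃ n, n = a + b := ⟨_, rfl⟩
  clear hu hv
  induction n generalizing u v a b with
  | zero =>
    obtain rfl : a = 0 := by lia
    have := dotProduct_mem_ordGE ha hl'
    rwa [sub_add_cancel] at this
  | succ n ih =>
    rcases a with _ | a
    · have := dotProduct_mem_ordGE ha hl'
      rwa [sub_add_cancel] at this
    rcases b with _ | b
    · have := dotProduct_mem_ordGE hl hb
      rwa [add_sub_cancel] at this
    -- Since `c + c' ≠ 0`, the order of the pairing is controlled by that of `(δ - c)u · v + u · (δ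
    -- - c')v`, where one of the two exponents of nilpotence has dropped; hence the induction on `a
    -- + b`.
    refine mem_ordGE_of_x_mul_d_sub_mem hk hc ?_
    rw [x_mul_d_dotProduct_sub (A := A)]
    have hu' := deltaSub_pow_mem_lat hk (integral_neg_transpose hA) c 1 hl
    have hv' := deltaSub_pow_mem_lat hk hA c' 1 hl'
    rw [pow_one] at hu' hv'
    refine Submodule.add_mem _ (ih hu' hl' a ?_ (b + 1) hb (by lia))
      (ih hl hv' (a + 1) ha b ?_ (by lia))
    · rwa [pow_succ, Module.End.mul_apply] at ha
    · rwa [pow_succ, Module.End.mul_apply] at hb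

end Duality

/-! ### Regularity -/

section Regularity

variable {K : Type} [Field K] {ι : Type} [Fintype ι]

/-- The iterates of a regular cyclic vector have bounded poles. -/
lemma IsCyclic.exists_forall_conn_pow_mem_lat {B : Matrix ι ι (LS K)} {v : ι → LS K} {r : ℕ}
    {a : Fin r → LS K} (h : IsCyclic B v r a) (hr : 0 < r) (ha : ∀ j, a j ∈ ordGE K 0) :
    ∃ m, ∀ j : ℕ, (conn B ^ j) v ∈ lat ι m := by
  have hsub := h.isSub 0
  rw [neg_zero, x_zero, one_smul] at hsub
  have hint : Integral (cyclicMatrix 0 a) := integral_cyclicMatrix le_rfl fun i => by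
    rw [zero_mul, x_zero, one_mul]; exact ha i
  set C := cyclicMatrix 0 a
  set G : Matrix ι (Fin r) (LS K) :=
    Matrix.of fun i (j : Fin r) => (x K (0 * (j : ℕ)) • (conn B ^ (j : ℕ)) v) i with hG
  obtain ⟨m, hm⟩ := exists_forall_mem_ordGE fun ij : ι × Fin r => G ij.1 ij.2
  have hGm : ∀ w ∈ lat (K := K) (Fin r) 0, G *ᵥ w ∈ lat ι m := fun w hw i =>
    Submodule.sum_mem _ fun j _ => by
      have := mul_mem_ordGE (hm (i, j)) (hw j)
      rwa [add_zero] at this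
  refine ⟨m, fun j => ?_⟩
  have key : ∃ w ∈ lat (K := K) (Fin r) 0, (conn B ^ j) v = G *ᵥ w := by
    induction j with
    | zero =>
      refine ⟨Pi.single ⟨0, hr⟩ 1, fun i => ?_, ?_⟩
      · rw [Pi.single_apply]
        split_ifs
        · exact one_mem_ordGE
        · exact Submodule.zero_mem _
      · rw [mulVec_single_one]
        funext i
        simp [hG, x_zero]
    | succ j ih =>
      obtain ⟨w, hw, e⟩ := ih
      exact ⟨conn C w, conn_mem_lat hint hw, by
        rw [pow_succ', Module.End.mul_apply, e, hsub.conn_mulVec]⟩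
  obtain ⟨w, hw, e⟩ := key
  exact e ▸ hGm w hw

/-- If a connection with leading eigenvalue `0` has no irregular eigenvector after
ramification, then the iterates of all its vectors have bounded poles. -/
lemma exists_forall_conn_pow_mem_lat [CharZero K] [IsAlgClosed K] {A : Matrix ι ι (LS K)}
    (hA : Integral A)
    (hno : ∀ (q : ℕ+) (h : LS K) (u : ι → LS K), u ≠ 0 →
      conn (ramM q (x K (-1) • A)) u = h • u → h ∈ ordGE K (-(q : ℕ) + 1) → h ∈ ordGE K 0)
    {v : ι → LS K} (hv : v ∈ genEig one_pos hA 0) :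
    ∃ m, ∀ j : ℕ, (conn (x K (-1) • A) ^ j) v ∈ lat ι m := by
  by_cases hv0 : v = 0
  · exact ⟨0, fun j => by rw [hv0, map_zero]; exact Submodule.zero_mem _⟩
  obtain ⟨r, hr, -, a, ha⟩ := exists_isCyclic (x K (-1) • A) hv0
  refine ha.exists_forall_conn_pow_mem_lat hr ?_
  by_contra! hirr
  obtain ⟨q, h, u, hu, hh, hirr, hmem⟩ := ha.exists_irregular_eigenvector hirr
  have hqk : 0 < ((q : ℕ) : ℤ) * 1 := by have := q.pos; lia
  -- The leading eigenvalue is `0`, so the eigenvalue of `u` has a pole of order less than `q`, as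
  -- `hno` requires.
  have humem : u ∈ genEig hqk (integral_ramM q hA) ((q : ℕ) * 0) := by
    refine Submodule.span_le.mpr ?_ hmem
    rintro _ ⟨j, rfl⟩
    refine ramV_mem_genEig q one_pos hA hqk ?_
    have : ∀ j : ℕ, (conn (x K (-1) • A) ^ j) v ∈ genEig one_pos hA 0 := by
      intro j
      induction j with
      | zero => exact hv
      | succ j ih =>
        rw [pow_succ', Module.End.mul_apply]
        exact conn_mem_genEig one_pos hA ih
    exact this j
  have hh' := hh
  rw [ramM_smul_x] at hh'
  obtain ⟨h1, h2⟩ := eigenvalue_of_mem_genEig hqk _ humem hu hh'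
  refine hirr (hno q h u hu hh fun n hn => ?_)
  rw [mul_one, mul_zero] at *
  rcases (Int.lt_add_one_iff.mp hn).eq_or_lt with e | e
  · rw [e, h2]
  · exact h1 n e

end Regularity

end

section

open Matrix LS

/-! ### Linear forms on a summand, from the dual connection. -/

section DualFrame

variable {K : Type} [Field K] {ι : Type} [Fintype ι] [DecidableEq ι]

lemma integral_add_smul_one {A : Matrix ι ι (LS K)} (hA : Integral A) (α : K) :
    Integral (A + α • (1 : Matrix ι ι (LS K))) := fun a b => by
  refine Submodule.add_mem _ (hA a b) (Submodule.smul_mem _ _ ?_)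
  rw [Matrix.one_apply]
  split_ifs
  · exact one_mem_ordGE
  · exact Submodule.zero_mem _

lemma deltaSub_add_smul_one (k : ℤ) (A : Matrix ι ι (LS K)) (α c : K) :
    deltaSub k (A + α • 1) c = deltaSub k A (c - α) := by
  refine LinearMap.ext fun v => ?_
  rw [deltaSub_apply, deltaSub_apply]
  funext a
  rw [Pi.sub_apply, Pi.sub_apply, delta_apply, delta_apply, add_mulVec, smul_mulVec, one_mulVec,
    Pi.add_apply, sub_smul, Pi.sub_apply, Pi.smul_apply, Pi.smul_apply]
  abel

/-- If the dual of the summand of a connection with leading eigenvalue `α` has no irregular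
eigenvector after ramification and twist, then the summand has a family of linear forms
with bounded poles, stable under the dual of the twisted connection, and containing the coordinates. -/
lemma exists_dual_family [CharZero K] [IsAlgClosed K] {A : Matrix ι ι (LS K)} (hA : Integral A)
    (α : K) (hno : ∀ (q : ℕ+) (h : LS K) (u : ι → LS K), u ≠ 0 →
      conn (ramM q (x K (-1) • (-Aᵀ + α • (1 : Matrix ι ι (LS K))))) u = h • u →
      h ∈ ordGE K (-(q : ℕ) + 1) → h ∈ ordGE K 0) :
    ∃ l : ι → ℕ → ι → LS K, (∃ m, ∀ i j, l i j ∈ lat ι m) ∧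
      (∀ i, ∀ w ∈ genEig one_pos hA α, l i 0 ⬝ᵥ w = w i) ∧
      ∀ i j w, l i j ⬝ᵥ (conn (x K (-1) • A) w - (α • x K (-1)) • w) =
        LS.d (l i j ⬝ᵥ w) - l i (j + 1) ⬝ᵥ w := by
  classical
  have hA' := integral_neg_transpose hA
  have hA'' := integral_add_smul_one hA' α
  -- On the summand of `α`, the coordinate form `e_i` agrees with its component of leading
  -- eigenvalue `-α` in the dual; the other components are orthogonal to the summand. If `-α` is not
  -- an eigenvalue, that component is `0`.
  have hl : ∀ i, ∃ u ∈ genEig one_pos hA' (-α), ∀ w ∈ genEig one_pos hA α, u ⬝ᵥ w = w i := by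
    intro i
    have : Nonempty ι := ⟨i⟩
    obtain ⟨y, hy, hsum⟩ := exists_sum_genEig one_pos hA' (v := Pi.single i 1) fun a => by
      rw [Pi.single_apply]
      split_ifs
      · exact one_mem_ordGE
      · exact Submodule.zero_mem _
    refine ⟨if -α ∈ leadEigs (-Aᵀ) then y (-α) else 0, ?_, fun w hw => ?_⟩
    · split_ifs with h
      · exact hy _ h
      · exact Submodule.zero_mem _
    · have h1 : w i = ∑ c ∈ leadEigs (-Aᵀ), y c ⬝ᵥ w := by
        rw [← sum_dotProduct, hsum, single_one_dotProduct]
      have h2 : ∀ c ∈ leadEigs (-Aᵀ), y c ⬝ᵥ w = if c = -α then y (-α) ⬝ᵥ w else 0 := by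
        intro c hc
        split_ifs with h
        · rw [h]
        · exact dotProduct_eq_zero_of_mem_genEig one_pos hA (fun e => h (eq_neg_of_add_eq_zero_left e))
            (hy c hc) hw
      rw [h1, Finset.sum_congr rfl h2, Finset.sum_ite_eq']
      split_ifs <;> simp
  choose u hu hcoord using hl
  have hu' : ∀ i, u i ∈ genEig one_pos hA'' 0 := fun i m => by
    obtain ⟨n, hn⟩ := hu i m
    exact ⟨n, by rwa [deltaSub_add_smul_one, zero_sub]⟩
  have hb := fun i => exists_forall_conn_pow_mem_lat hA'' hno (hu' i)
  choose m hm using hb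
  obtain ⟨M, hM⟩ := Set.Finite.bddBelow (Set.finite_range m)
  -- The forms are the iterates of the twisted dual connection on these components. The twist moves
  -- the leading eigenvalue `-α` to `0`, where the iterates have bounded poles.
  refine ⟨fun i j => (conn (x K (-1) • (-Aᵀ + α • (1 : Matrix ι ι (LS K)))) ^ j) (u i),
    ⟨M, fun i j => lat_mono (hM ⟨i, rfl⟩) (hm i j)⟩, fun i w hw => ?_, fun i j w => ?_⟩
  · exact hcoord i w hw
  · have h1 : -(x K (-1) • A + (-(α • x K (-1))) • (1 : Matrix ι ι (LS K)))ᵀ =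
        x K (-1) • (-Aᵀ + α • (1 : Matrix ι ι (LS K))) := by
      ext1 a b
      simp only [Matrix.neg_apply, transpose_apply, Matrix.add_apply, Matrix.smul_apply,
        Matrix.one_apply, smul_eq_mul, mul_ite, mul_one, mul_zero, smul_ite, smul_zero,
        eq_comm (a := b)]
      split_ifs
      · rw [mul_add, mul_smul_comm, mul_one]; ring
      · ring
    have h2 := d_dotProduct_eq_conn (x K (-1) • A + (-(α • x K (-1))) • (1 : Matrix ι ι (LS K)))
      ((conn (x K (-1) • (-Aᵀ + α • (1 : Matrix ι ι (LS K)))) ^ j) (u i)) w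
    rw [h1, conn_add_smul_one, neg_smul, ← sub_eq_add_neg] at h2
    simp only [pow_succ', Module.End.mul_apply]
    rw [h2, add_sub_cancel_left]

end DualFrame

/-! ### The formal decomposition -/

section Decomposition

lemma coeff_polar (p : Polynomial ℂ) (j : ℕ) : coeff (-(j : ℤ)) (of (polar ℂ p)) = p.coeff j := by
  rw [polar, Polynomial.sum, map_sum, map_sum]
  simp only [coeff_of, HahnSeries.coeff_single, neg_inj, Nat.cast_inj]
  rw [Finset.sum_ite_eq]
  split_ifs with h
  · rfl
  · exact (Polynomial.notMem_support_iff.mp h).symm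

variable {d : ℕ} {A : Matrix (Fin d) (Fin d) ℂ⟦X⟧}

/-- Strict specializability with ramification and exponential twist prevents
irregular eigenvectors with small poles. -/
lemma mem_ordGE_of_conn_eq_smul
    (hS : ∀ q : ℕ, 1 ≤ q → ∀ p : Polynomial ℂ, p.coeff 0 = 0 →
      ∃ V, IsStrictVFiltration (tDt A q p 1) 1 V)
    (α : ℂ) (q : ℕ+) (h : LS ℂ) (u : Fin d → LS ℂ) (hu : u ≠ 0)
    (hh : conn (ramM q (x ℂ (-1) • (-(toLS A)ᵀ + α • (1 : Matrix (Fin d) (Fin d) (LS ℂ))))) u =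
      h • u) (hpole : h ∈ ordGE ℂ (-(q : ℕ) + 1)) : h ∈ ordGE ℂ 0 := by
  by_contra hirr
  obtain ⟨n, hn, hn0⟩ : ∃ n < 0, coeff n h ≠ 0 := by
    by_contra! H
    exact hirr H
  have hnq : -((q : ℕ) : ℤ) + 1 ≤ n := by
    by_contra! H
    exact hn0 (hpole n H)
  -- `φ` is chosen so that `t∂_tφ` cancels the polar part of `h - q α t^(-q)`, the eigenvalue before
  -- the twist by `α`. The summand `j = 0` is zero because division by zero gives zero. As `h` has a
  -- pole of order less than `q`, an irregular `h` gives `φ` a nonzero term of degree other than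
  -- `-q`.
  set p : Polynomial ℂ := ∑ j ∈ Finset.range q,
      Polynomial.monomial j (coeff (-(j : ℤ)) h / j) - Polynomial.monomial (q : ℕ) α with hp
  have hcoeff : ∀ j : ℕ, p.coeff j =
      (if j < q then coeff (-(j : ℤ)) h / j else 0) - if (q : ℕ) = j then α else 0 := fun j => by
    simp only [hp, Polynomial.coeff_sub, Polynomial.finsetSum_coeff, Polynomial.coeff_monomial,
      Finset.sum_ite_eq', Finset.mem_range]
  have hqpos := q.pos
  have hp0 : p.coeff 0 = 0 := by
    rw [hcoeff, if_neg hqpos.ne']; simp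
  obtain ⟨V, hV⟩ := hS q q.pos p hp0
  refine hu (hV.eq_zero_of_conn_eq_smul hp0 ⟨(-n).toNat, by lia, ?_⟩
    (h := h - (((q : ℕ) : ℂ) * α) • x ℂ (-((q : ℕ) : ℤ)) + LS.d (of (polar ℂ p))) ?_ ?_)
  · rw [hcoeff, if_pos (by lia), if_neg (by lia), sub_zero]
    have e : -(((-n).toNat : ℕ) : ℤ) = n := by lia
    rw [e]
    exact div_ne_zero hn0 (by exact_mod_cast (by lia : (-n).toNat ≠ 0))
  · intro k hk
    obtain ⟨j, rfl⟩ : ∃ j : ℕ, k = -(j : ℤ) := ⟨(-k).toNat, by lia⟩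
    have hj : (j : ℂ) ≠ 0 := by exact_mod_cast (by lia : j ≠ 0)
    rw [map_add, map_sub, map_smul, coeff_x, coeff_d, coeff_polar, hcoeff]
    push_cast
    rcases lt_trichotomy j (q : ℕ) with hjq | hjq | hjq
    · rw [if_pos hjq, if_neg (by lia), if_neg (by lia)]
      field_simp
      simp
    · rw [if_pos (by lia), if_neg (by lia), if_pos (by lia), hpole _ (by lia), hjq]
      simp
    · rw [if_neg (by lia), if_neg (by lia), if_neg (by lia), hpole _ (by lia)]
      simp
  · have h1 : ramM q (x ℂ (-1) • (-(toLS A)ᵀ + α • (1 : Matrix (Fin d) (Fin d) (LS ℂ)))) =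
        ramM q (x ℂ (-1) • -(toLS A)ᵀ) + ((((q : ℕ) : ℂ) * α) • x ℂ (-((q : ℕ) : ℤ))) • 1 := by
      rw [ramM_smul_x, ramM_smul_x, mul_one]
      ext1 a b
      simp only [ramM, Matrix.smul_apply, Matrix.add_apply, map_apply, Matrix.one_apply, smul_eq_mul,
        map_add, map_smul, smul_add, mul_add]
      congr 1
      split_ifs
      · rw [map_one, smul_smul, mul_smul_comm, mul_one, mul_one]
      · simp
    rw [h1, conn_add_smul_one] at hh
    rw [add_sub_cancel_right, sub_smul, ← hh, add_sub_cancel_right]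

end Decomposition

end

section

open Matrix LS

/-! ### Regular lattices and the decomposition without ramification. -/

section NoRamification

variable {d : ℕ} {A : Matrix (Fin d) (Fin d) ℂ⟦X⟧}

/-- A vector of Laurent series, with coordinates in the field of Laurent series. -/
def vec (v : Fin d → ℂ⸨X⸩) : Fin d → LS ℂ := fun a => of (v a)

lemma vec_smul (f : ℂ⸨X⸩) (v : Fin d → ℂ⸨X⸩) : vec (f • v) = of f • vec v := rfl

lemma vec_sub (v w : Fin d → ℂ⸨X⸩) : vec (v - w) = vec v - vec w := rfl

lemma vec_formalConn (A : Matrix (Fin d) (Fin d) ℂ⟦X⟧) (v : Fin d → ℂ⸨X⸩) :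
    vec (formalConn A v) = conn (x ℂ (-1) • toLS A) (vec v) := by
  funext a
  rw [conn_apply, smul_mulVec]
  rfl

lemma vec_powerSeries_smul (f : ℂ⟦X⟧) (v : Fin d → ℂ⸨X⸩) :
    vec (f • v) = of (HahnSeries.ofPowerSeries ℤ ℂ f) • vec v :=
  funext fun a => congrArg LS.of (Algebra.smul_def f (v a))

/-- The summand of the formal connection with leading eigenvalue `α`. -/
def formalEig (A : Matrix (Fin d) (Fin d) ℂ⟦X⟧) (α : ℂ) : Submodule ℂ⸨X⸩ (Fin d → ℂ⸨X⸩) :=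
  genEig one_pos (integral_toLS A) α

lemma mem_formalEig {α : ℂ} {v : Fin d → ℂ⸨X⸩} :
    v ∈ formalEig A α ↔ vec v ∈ genEig one_pos (integral_toLS A) α := Iff.rfl

/-- A submodule of the lattice of vectors of power series is finitely generated. -/
lemma fg_of_forall_mem_ordGE (L : Submodule ℂ⟦X⟧ (Fin d → ℂ⸨X⸩))
    (hL : ∀ w ∈ L, ∀ a, of (w a) ∈ ordGE ℂ 0) : L.FG := by
  let φ : (Fin d → ℂ⟦X⟧) →ₗ[ℂ⟦X⟧] (Fin d → ℂ⸨X⸩) :=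
    (Algebra.linearMap ℂ⟦X⟧ ℂ⸨X⸩).compLeft (Fin d)
  have h : (L.comap φ).map φ = L := by
    rw [Submodule.map_comap_eq, inf_eq_right]
    intro w hw
    choose g hg using fun a => exists_ofPowerSeries (hL w hw a)
    exact ⟨g, funext hg⟩
  rw [← h]
  exact (IsNoetherian.noetherian (L.comap φ)).map φ

/-- The lattice consists of the vectors of the summand on which all forms `l i j` are integral. The
forms `l i 0` are the coordinates, so it lies in a free module of finite rank over power series and
is finitely generated. The bounded poles of the forms put a multiple of each vector in it, and the
twisted connection only replaces `l i j` by `l i (j + 1)`, up to a derivative. -/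
lemma isRegular_genEig (α : ℂ) (l : Fin d → ℕ → Fin d → LS ℂ)
    (hb : ∃ m, ∀ i j, l i j ∈ lat (Fin d) m)
    (hl0 : ∀ i, ∀ w ∈ genEig one_pos (integral_toLS A) α, l i 0 ⬝ᵥ w = w i)
    (hl : ∀ i j w, l i j ⬝ᵥ (conn (x ℂ (-1) • toLS A) w - (α • x ℂ (-1)) • w) =
      LS.d (l i j ⬝ᵥ w) - l i (j + 1) ⬝ᵥ w) :
    IsRegular (fun v => formalConn A v - euler (polar ℂ (Polynomial.monomial 1 (-α))) • v)
      (formalEig A α) := by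
  have hpolar : of (euler (polar ℂ (Polynomial.monomial 1 (-α)))) = α • x ℂ (-1) := by
    rw [polar, Polynomial.sum_monomial_index _ _ (by simp), euler_single]
    ext n
    rw [coeff_of, map_smul, coeff_x, HahnSeries.coeff_single, Nat.cast_one]
    split_ifs <;> simp
  let L : Submodule ℂ⟦X⟧ (Fin d → ℂ⸨X⸩) :=
    { carrier := {w | vec w ∈ genEig one_pos (integral_toLS A) α ∧
        ∀ i j, l i j ⬝ᵥ vec w ∈ ordGE ℂ 0}
      zero_mem' := ⟨Submodule.zero_mem _, fun i j => by
        change l i j ⬝ᵥ (0 : Fin d → LS ℂ) ∈ _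
        rw [dotProduct_zero]; exact Submodule.zero_mem _⟩
      add_mem' := fun {v w} hv hw => ⟨Submodule.add_mem _ hv.1 hw.1, fun i j => by
        have := Submodule.add_mem _ (hv.2 i j) (hw.2 i j)
        rwa [← dotProduct_add] at this⟩
      smul_mem' := fun f w hw => by
        rw [Set.mem_ofPred_eq, vec_powerSeries_smul]
        refine ⟨Submodule.smul_mem _ _ hw.1, fun i j => ?_⟩
        rw [dotProduct_smul]
        exact mul_mem_ordGE_of_left (ofPowerSeries_mem_ordGE f) (hw.2 i j) }
  have hL : ∀ {w}, w ∈ L ↔ vec w ∈ genEig one_pos (integral_toLS A) α ∧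
      ∀ i j, l i j ⬝ᵥ vec w ∈ ordGE ℂ 0 := Iff.rfl
  refine ⟨L, fg_of_forall_mem_ordGE L fun w hw a => ?_, ?_, fun v hv => ?_⟩
  · have := hw.2 a 0
    rwa [hl0 a _ hw.1] at this
  · refine le_antisymm (Submodule.span_le.mpr fun w hw => hw.1) fun w hw => ?_
    obtain ⟨m, hm⟩ := hb
    obtain ⟨m', hm'⟩ := exists_mem_lat (vec w)
    have hx : ∀ n, of (HahnSeries.single n 1) = x ℂ n := fun _ => rfl
    have h1 : (HahnSeries.single (-(m + m')) 1 : ℂ⸨X⸩) • w ∈ L := by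
      rw [hL, vec_smul, hx]
      refine ⟨Submodule.smul_mem _ _ hw, fun i j => ?_⟩
      rw [dotProduct_smul]
      have := x_mul_mem_ordGE (m := -(m + m')) (dotProduct_mem_ordGE (hm i j) hm')
      rwa [neg_add_cancel] at this
    have h2 : w = (HahnSeries.single (m + m') 1 : ℂ⸨X⸩) •
        (HahnSeries.single (-(m + m')) 1 : ℂ⸨X⸩) • w := by
      change vec w = x ℂ (m + m') • x ℂ (-(m + m')) • vec w
      rw [smul_smul, x_mul_x_neg, one_smul]
    rw [h2]
    exact Submodule.smul_mem _ _ (Submodule.subset_span h1)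
  · rw [hL] at hv ⊢
    rw [vec_sub, vec_smul, vec_formalConn, hpolar]
    refine ⟨Submodule.sub_mem _ (conn_mem_genEig one_pos (integral_toLS A) hv.1)
      (Submodule.smul_mem _ _ hv.1), fun i j => ?_⟩
    rw [hl]
    exact Submodule.sub_mem _ (d_mem_ordGE (hv.2 i j)) (hv.2 i (j + 1))

/-- The exponents are `φ_i = -α_i/η`, with `α_i` the distinct eigenvalues of the leading matrix,
since `η∂_η(-α/η) = α/η`. The splitting by leading eigenvalues is thus already the required one;
strict specializability serves only to show that each summand is regular after its twist. -/
theorem exists_decomposition (hS : ∀ q : ℕ, 1 ≤ q → ∀ p : Polynomial ℂ, p.coeff 0 = 0 →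
      ∃ V, IsStrictVFiltration (tDt A q p 1) 1 V) :
    ∃ (n : ℕ) (p : Fin n → Polynomial ℂ) (W : Fin n → Submodule ℂ⸨X⸩ (Fin d → ℂ⸨X⸩)),
      Function.Injective p ∧ (∀ i, (p i).coeff 0 = 0) ∧ DirectSum.IsInternal W ∧
      (∀ i, ∀ v ∈ W i, formalConn A v ∈ W i) ∧
      ∀ i, IsRegular (fun v => formalConn A v - euler (polar ℂ (p i)) • v) (W i) := by
  classical
  have hA := integral_toLS A
  set S := leadEigs (toLS A) with hSdef
  let α : Fin S.card → ℂ := fun i => (S.equivFin.symm i : ℂ)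
  have hα : Function.Injective α := Subtype.val_injective.comp S.equivFin.symm.injective
  have hint : DirectSum.IsInternal fun i => genEig one_pos hA (α i) := by
    rw [DirectSum.isInternal_submodule_iff_iSupIndep_and_iSup_eq_top]
    refine ⟨(iSupIndep_genEig one_pos hA).comp hα, ?_⟩
    rw [S.equivFin.symm.iSup_comp (g := fun c : S => genEig one_pos hA (c : ℂ)), iSup_subtype]
    exact iSup_genEig one_pos hA
  refine ⟨S.card, fun i => Polynomial.monomial 1 (-α i), fun i => formalEig A (α i),
    fun i j h => hα ?_, fun i => ?_, hint, fun i v hv => ?_, fun i => ?_⟩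
  · exact neg_injective (Polynomial.monomial_injective 1 h)
  · rw [Polynomial.coeff_monomial, if_neg one_ne_zero]
  · rw [mem_formalEig, vec_formalConn]
    exact conn_mem_genEig one_pos hA hv
  · obtain ⟨l, hb, hl0, hl⟩ := exists_dual_family hA (α i) fun q h u hu hh hpole =>
      mem_ordGE_of_conn_eq_smul hS (α i) q h u hu hh hpole
    exact isRegular_genEig (α i) l hb hl0 hl

lemma ConnBundle.noRamification {Ω : Set ℂ} {d : ℕ} (H : ConnBundle Ω d) (h1 : (1 : ℂ) ∈ Ω)
    (hH : H.RescalingStrictlySpecializable) : H.NoRamification :=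
  exists_decomposition fun q hq p hp => hH q hq p hp 1 h1

end NoRamification

end

end Rescaling

end

theorem propositionB3 (Ω : Set ℂ) (d : ℕ) (T : Rescaling.IntegrableTwistorStructure Ω d) :
    (T.H'.RescalingStrictlySpecializable → T.H'.NoRamification) ∧
      (T.H''.RescalingStrictlySpecializable → T.H''.NoRamification) := by
  -- The fibre at `z = 1` recovers the connection itself, up to ramification and twist; the pairing
  -- plays no part.
  have h1 : (1 : ℂ) ∈ Ω := T.closedBall_subset (by simp)
  exact ⟨T.H'.noRamification h1, T.H''.noRamification h1⟩
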